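/- Let $n\ge 0$, $z_0,\dots,z_{n+1}\in\mathbb C$ with $z_0\ne z_{n+1}$, let $p\in\{z_0,\infty\}$ and $q\in\{z_{n+1},\infty\}$, and let $\gamma$ be a path in $\mathbb P^1(\mathbb C)$ from $p$ to $q$ whose interior is a piecewise $C^1$ path in $\mathbb C\setminus\{z_0,\dots,z_{n+1}\}$. Assume that $\gamma$ does not wind infinitely often around its endpoints: continuous branches of the argument of $\gamma(t)-p$ as $t\to 0$ and of $\gamma(t)-q$ as $t\to1$ (of $\gamma(t)$, if the endpoint is $\infty$) are bounded. Fix continuous branches of $\log(\gamma(t)-z_i)$ along $\gamma$. For $\boldsymbol\alpha=(\alpha_0,\dots,\alpha_{n+1})\in\mathbb C^{n+2}$ put $$B_\gamma(\boldsymbol\alpha)=\int_{0<t_1<\dots<t_{n+1}<1}\ \prod_{i=0}^{n}\frac{d\gamma(t_{i+1})}{(\gamma(t_{i+1})-z_i)^{\alpha_i}(\gamma(t_{i+1})-z_{i+1})^{1-\alpha_{i+1}}},\qquad B^{0}_\gamma(\boldsymbol\alpha)=\int_0^1\frac{d\gamma(t)}{(\gamma(t)-z_0)^{\alpha_0}(\gamma(t)-z_{n+1})^{1-\alpha_{n+1}}},$$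 understood as limits of the integrals over $[a,b]$ in place of $[0,1]$, as $a\to0^+$ and $b\to1^-$. Let $D\subset\mathbb C^{n+2}$ be the set of $\boldsymbol\alpha$ with * $\Re\alpha_0<1$ if $p\neq\infty$, and $\Re(\alpha_0-\alpha_i)>0$ for $1\le i\le n+1$ if $p=\infty$; * $\Re\alpha_{n+1}>0$ if $q\neq\infty$, and $\Re(\alpha_i-\alpha_{n+1})>0$ for $0\le i\le n$ if $q=\infty$. If $p=q\,(=\infty)$, assume that $\gamma$ is nontrivial in the sense that $B^0_\gamma$ does not vanish identically on $D$. Finally assume that there is a point $x\in\{z_0,z_{n+1},\infty\}\setminus\{p,q\}$ such that $z_1,\dots,z_n$ all lie in the connected component of $\mathbb P^1(\mathbb C)\setminus\gamma$ containing $x$ (where $\gamma$ includes its endpoints). Then the integrals $B_\gamma(\boldsymbol\alpha)$ and $B^0_\gamma(\boldsymbol\alpha)$ converge for $\boldsymbol\alpha\in D$, and the normalized complete iterated beta integral $$\hat B_\gamma\bigl(\begin{smallmatrix}z_0\\ \alpha_0\end{smallmatrix}\big|\cdots\big|\begin{smallmatrix}z_{n+1}\\ \alpha_{n+1}\end{smallmatrix}\bigr)=\frac{B_\gamma(\boldsymbol\alpha)}{B^0_\gamma(\boldsymbol\alpha)}$$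 extends from $D$ to a meromorphic function of $\boldsymbol\alpha\in\mathbb C^{n+2}$ (a quotient of entire functions) which is invariant under simultaneous translation of the exponents: $$\hat B_\gamma\bigl(\begin{smallmatrix}z_0\\ \alpha_0\end{smallmatrix}\big|\cdots\big|\begin{smallmatrix}z_{n+1}\\ \alpha_{n+1}\end{smallmatrix}\bigr)=\hat B_\gamma\bigl(\begin{smallmatrix}z_0\\ \alpha_0+\lambda\end{smallmatrix}\big|\cdots\big|\begin{smallmatrix}z_{n+1}\\ \alpha_{n+1}+\lambda\end{smallmatrix}\bigr)\qquad(\lambda\in\mathbb C),$$ one side being regular at $\boldsymbol\alpha$ if and only if the other is. In particular, with $\boldsymbol\alpha+\lambda=(\alpha_i+\lambda)_i$, one has $B_\gamma(\boldsymbol\alpha)\,B^0_\gamma(\boldsymbol\alpha+\lambda)=B_\gamma(\boldsymbol\alpha+\lambda)\,B^0_\gamma(\boldsymbol\alpha)$ whenever $\boldsymbol\alpha,\boldsymbol\alpha+\lambda\in D$. -/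

import Mathlib

open Filter Topology Set

namespace BetaIntegral

/-- The iterated integral of the densities `φ 0, …, φ (m-1)` over
`a < t₁ < ⋯ < t_m < b`, where `t₁` belongs to `φ 0`. It equals `1` for `m = 0`. -/
noncomputable def iteratedIntegral : (m : ℕ) → (Fin m → ℝ → ℂ) → ℝ → ℝ → ℂ
  | 0, _, _, _ => 1
  | m + 1, φ, a, b =>
      ∫ t in a..b, iteratedIntegral m (fun i => φ i.castSucc) a t * φ (Fin.last m) t

/-- `γ`, restricted to the open interval `(0,1)`, is a piecewise `C¹` path on
`ℂ ∖ {z 0, …, z (n+1)}` that goes from `p ∈ {z 0, ∞}` to `q ∈ {z (n+1), ∞}` in the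
Riemann sphere. (Breakpoints are handled by a finite exceptional set off which `γ` is `C¹`,
the derivative being locally integrable on `(0,1)`.) -/
structure IsPathBetween {n : ℕ} (z : Fin (n + 2) → ℂ) (p q : OnePoint ℂ) (γ : ℝ → ℂ) :
    Prop where
  start_mem : p = (z 0 : OnePoint ℂ) ∨ p = OnePoint.infty
  end_mem : q = (z (Fin.last (n + 1)) : OnePoint ℂ) ∨ q = OnePoint.infty
  tendsto_start : Tendsto (fun t => (γ t : OnePoint ℂ)) (𝓝[>] 0) (𝓝 p)
  tendsto_end : Tendsto (fun t => (γ t : OnePoint ℂ)) (𝓝[<] 1) (𝓝 q)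
  continuousOn : ContinuousOn γ (Ioo 0 1)
  piecewise : ∃ S : Finset ℝ, ContDiffOn ℝ 1 γ (Ioo 0 1 \ (S : Set ℝ))
  locallyIntegrable : MeasureTheory.LocallyIntegrableOn (deriv γ) (Ioo 0 1)
  avoids : ∀ t ∈ Ioo (0 : ℝ) 1, ∀ i, γ t ≠ z i

/-- The trace of the path in the Riemann sphere, endpoints included. -/
def trace (p q : OnePoint ℂ) (γ : ℝ → ℂ) : Set (OnePoint ℂ) :=
  {p, q} ∪ (fun t => (γ t : OnePoint ℂ)) '' Ioo 0 1

/-- `z 1, …, z n` all lie in the connected component of the complement of the path that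
contains one (and the same) of the points of `{z 0, z (n+1), ∞} ∖ {p, q}`. -/
def InSpecialComponent {n : ℕ} (z : Fin (n + 2) → ℂ) (p q : OnePoint ℂ) (γ : ℝ → ℂ) : Prop :=
  ∃ x ∈ ({(z 0 : OnePoint ℂ), (z (Fin.last (n + 1)) : OnePoint ℂ), OnePoint.infty} :
      Set (OnePoint ℂ)) \ {p, q},
    ∀ i, i ≠ 0 → i ≠ Fin.last (n + 1) →
      (z i : OnePoint ℂ) ∈ connectedComponentIn (trace p q γ)ᶜ x

/-- `L i` is a continuous branch of `log (γ t - z i)` along the path. -/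
def IsLogBranch {n : ℕ} (z : Fin (n + 2) → ℂ) (γ : ℝ → ℂ) (L : Fin (n + 2) → ℝ → ℂ) : Prop :=
  ∀ i, ContinuousOn (L i) (Ioo 0 1) ∧ ∀ t ∈ Ioo (0 : ℝ) 1, Complex.exp (L i t) = γ t - z i

/-- The path does not circulate infinitely often around its endpoints.
If the endpoint is `z 0` (resp. `z (n+1)`) this is literally the boundedness of the argument of
`γ t` minus the endpoint; if the endpoint is `∞` it is the boundedness of the argument of
`γ t`, because `(γ t - z i) / γ t → 1`. -/
def IsWellBehaved {n : ℕ} (L : Fin (n + 2) → ℝ → ℂ) : Prop :=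
  (∃ C : ℝ, ∀ᶠ t in 𝓝[>] (0 : ℝ), |(L 0 t).im| ≤ C) ∧
    ∃ C : ℝ, ∀ᶠ t in 𝓝[<] (1 : ℝ), |(L (Fin.last (n + 1)) t).im| ≤ C

/-- The pullback along `γ` of the beta form
`dt / ((t - zᵢ) ^ αᵢ * (t - zᵢ₊₁) ^ (1 - αᵢ₊₁))`, the powers being taken with the branches
`L`. -/
noncomputable def betaForm {m : ℕ} (γ : ℝ → ℂ) (L : Fin (m + 1) → ℝ → ℂ)
    (α : Fin (m + 1) → ℂ) (i : Fin m) (t : ℝ) : ℂ :=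
  Complex.exp (-α i.castSucc * L i.castSucc t) *
    Complex.exp ((α i.succ - 1) * L i.succ t) * deriv γ t

/-- The iterated beta integral along the whole path converges, with value `w`. -/
def HasBeta {m : ℕ} (γ : ℝ → ℂ) (L : Fin (m + 1) → ℝ → ℂ) (α : Fin (m + 1) → ℂ) (w : ℂ) :
    Prop :=
  Tendsto (fun ab : ℝ × ℝ => iteratedIntegral m (betaForm γ L α) ab.1 ab.2)
    (𝓝[>] 0 ×ˢ 𝓝[<] 1) (𝓝 w)

/-- The denominator of the normalized integral: the beta integral of the two outer points. -/
def HasOuterBeta {n : ℕ} (γ : ℝ → ℂ) (L : Fin (n + 2) → ℝ → ℂ) (α : Fin (n + 2) → ℂ) (w : ℂ) :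
    Prop :=
  HasBeta γ ![L 0, L (Fin.last (n + 1))] ![α 0, α (Fin.last (n + 1))] w

/-- The domain of convergence in the exponents. -/
def convDomain (n : ℕ) (p q : OnePoint ℂ) : Set (Fin (n + 2) → ℂ) :=
  {α | (p ≠ OnePoint.infty → (α 0).re < 1) ∧
    (p = OnePoint.infty → ∀ i, i ≠ 0 → 0 < (α 0 - α i).re) ∧
    (q ≠ OnePoint.infty → 0 < (α (Fin.last (n + 1))).re) ∧
    (q = OnePoint.infty → ∀ i, i ≠ Fin.last (n + 1) → 0 < (α i - α (Fin.last (n + 1))).re)}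

/-- `P / Q` is a meromorphic function on all of `ℂ ^ (n+2)` (with `P`, `Q` entire, `Q` not
identically zero) that continues the normalized integral from the domain of convergence, on
which numerator and denominator converge. -/
def IsMeromorphicContinuation {n : ℕ} (p q : OnePoint ℂ) (γ : ℝ → ℂ)
    (L : Fin (n + 2) → ℝ → ℂ) (P Q : (Fin (n + 2) → ℂ) → ℂ) : Prop :=
  Differentiable ℂ P ∧ Differentiable ℂ Q ∧ (∃ β, Q β ≠ 0) ∧
    ∀ β ∈ convDomain n p q, ∃ b c : ℂ,
      HasBeta γ L β b ∧ HasOuterBeta γ L β c ∧ Q β * b = P β * c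

/-- The meromorphically continued normalized integral is regular at `α`, with value `w`. -/
def HasNormalizedBeta {n : ℕ} (p q : OnePoint ℂ) (γ : ℝ → ℂ) (L : Fin (n + 2) → ℝ → ℂ)
    (α : Fin (n + 2) → ℂ) (w : ℂ) : Prop :=
  ∃ P Q : (Fin (n + 2) → ℂ) → ℂ,
    IsMeromorphicContinuation p q γ L P Q ∧ Q α ≠ 0 ∧ w = P α / Q α

end BetaIntegral

namespace BetaIntegral

open MeasureTheory

/-! ### Iterated integrals of densities with finitely many discontinuities -/

/-! Write B for the numerator and B⁰ for the denominator, and let the first inner point w = z₁ vary.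
Differentiating under the integral and integrating by parts gives, on the domain D of convergence,
∂B/∂w = ((α₀-α₁)/(z₀-w) + (α₁-α₂)/(z₂-w)) B + (1/(z₀-w) - 1/(z₂-w)) B' + B''/(z₂-w), where B' and
B'' are the integrals with z₁, respectively z₂, deleted; the last term is absent if there is only
one inner point. The boundary terms tend to zero on D. Only differences of exponents occur as
coefficients. By induction on the number of inner points (without inner points B = B⁰), the function
g(w) = B(α)B⁰(α+λ) - B(α+λ)B⁰(α) therefore satisfies the homogeneous equation g' = ((α₀-α₁)/(z₀-w) +
(α₁-α₂)/(z₂-w)) g (`IsInvariant.hasDerivAt`).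

This g is holomorphic and single-valued on the finite part of the component C of the complement of
the path that contains the inner points. C also contains a singular point of the equation: z₂ if
there are at least two inner points, and otherwise the point x of the hypothesis, which is z₀, z₂ or
∞. If the differences of α₀, α₁, α₂ are not integers, a single-valued holomorphic solution near such
a point is zero (`eventually_eq_zero_of_regular_singular`,
`eventually_eq_zero_of_regular_singular_infty`), so g = 0 on C by the identity theorem on the
sphere. Continuity in the exponents removes the genericity assumption (`IsInvariant.succ`).

The analysis takes place at the two ends of the path, which may have infinite length there. In a
logarithmic coordinate the bounded argument confines the path to a half strip with real part tending
to -∞, and the forms become holomorphic on a half plane. Iterated integrals then depend on their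
endpoints only (`betaInt_eq_planeInt`), so they can be estimated along horizontal and vertical
segments. The k-th integral grows like exp(`weight` k * Re w), and D is chosen so that the relevant
weights, or differences of weights, are positive. All estimates are locally uniform in points and
exponents, hence the limits depend continuously on both and holomorphically on the first inner
point.

For the meromorphic continuation, translate the logarithmic coordinate by 2πi. This multiplies the
local integrals by exponentials of the exponents; composition with a loop around the endpoint gives
a triangular system whose coefficients, the loop integrals, are entire (`monodromy_left`,
`monodromy_right`). Solving it shows that B and B⁰ become entire after multiplication by products of
factors e^{2πi(...)} - 1 (`IsBetaPath.exists_entireOn`). Since D meets each of its translates in a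
nonempty open set, the invariance on D passes to the continuation
(`IsQuotientPair.quotient_translate`). -/

/-- `iteratedIntegral` for a sequence of densities. -/
noncomputable def iterInt (φ : ℕ → ℝ → ℂ) : ℕ → ℝ → ℝ → ℂ
  | 0, _, _ => 1
  | m + 1, a, b => ∫ t in a..b, iterInt φ m a t * φ m t

theorem iterInt_zero (φ : ℕ → ℝ → ℂ) (a b : ℝ) : iterInt φ 0 a b = 1 := rfl

theorem iterInt_succ (φ : ℕ → ℝ → ℂ) (m : ℕ) (a b : ℝ) :
    iterInt φ (m + 1) a b = ∫ t in a..b, iterInt φ m a t * φ m t := rfl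

theorem iteratedIntegral_eq_iterInt (φ : ℕ → ℝ → ℂ) (m : ℕ) (a b : ℝ) :
    iteratedIntegral m (fun i => φ i) a b = iterInt φ m a b := by
  induction m generalizing b with
  | zero => rfl
  | succ m ih => simp [iteratedIntegral, iterInt, ih]

/-- A function that is integrable on the compact subintervals of `(0,1)` and continuous on
`(0,1) ∖ S`. -/
structure IsDensity (S : Set ℝ) (φ : ℝ → ℂ) : Prop where
  continuousAt : ∀ t ∈ Ioo (0 : ℝ) 1, t ∉ S → ContinuousAt φ t
  integrable : ∀ a ∈ Ioo (0 : ℝ) 1, ∀ b ∈ Ioo (0 : ℝ) 1, IntervalIntegrable φ volume a b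

variable {S : Set ℝ} {φ : ℝ → ℂ}

theorem uIcc_subset_unit {a b : ℝ} (ha : a ∈ Ioo (0 : ℝ) 1) (hb : b ∈ Ioo (0 : ℝ) 1) :
    uIcc a b ⊆ Ioo (0 : ℝ) 1 :=
  ordConnected_Ioo.uIcc_subset ha hb

theorem exists_unit_Ioo {a b : ℝ} (ha : a ∈ Ioo (0 : ℝ) 1) (hb : b ∈ Ioo (0 : ℝ) 1) :
    ∃ l r : ℝ, l ∈ Ioo (0 : ℝ) 1 ∧ r ∈ Ioo (0 : ℝ) 1 ∧ l ≤ r ∧ a ∈ Ioo l r ∧ b ∈ Ioo l r := by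
  have h1 := min_le_left a b
  have h2 := min_le_right a b
  have h3 := le_max_left a b
  have h4 := le_max_right a b
  have h5 : 0 < min a b := lt_min ha.1 hb.1
  have h6 : max a b < 1 := max_lt ha.2 hb.2
  refine ⟨min a b / 2, (max a b + 1) / 2, ⟨?_, ?_⟩, ⟨?_, ?_⟩, ?_, ⟨?_, ?_⟩, ⟨?_, ?_⟩⟩ <;>
    linarith [ha.1, ha.2, hb.1, hb.2]

theorem IsDensity.continuousOn_mul (hφ : IsDensity S φ) {f : ℝ → ℂ}
    (hf : ContinuousOn f (Ioo 0 1)) : IsDensity S (fun t => f t * φ t) where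
  continuousAt t ht hS := (hf.continuousAt (Ioo_mem_nhds ht.1 ht.2)).mul (hφ.continuousAt t ht hS)
  integrable a ha b hb :=
    (hφ.integrable a ha b hb).continuousOn_mul (hf.mono (uIcc_subset_unit ha hb))

theorem IsDensity.continuousOn_integral (hφ : IsDensity S φ) {a : ℝ} (ha : a ∈ Ioo (0 : ℝ) 1) :
    ContinuousOn (fun t => ∫ s in a..t, φ s) (Ioo 0 1) := by
  intro t ht
  obtain ⟨l, r, hl, hr, hlr, hal, hat⟩ := exists_unit_Ioo ha ht
  have := intervalIntegral.continuousOn_primitive_interval' (a := a) (hφ.integrable l hl r hr)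
    (by rw [uIcc_of_le hlr]; exact ⟨hal.1.le, hal.2.le⟩)
  rw [uIcc_of_le hlr] at this
  exact (this.continuousAt (Icc_mem_nhds hat.1 hat.2)).continuousWithinAt

theorem IsDensity.hasDerivAt_integral (hφ : IsDensity S φ) {a t : ℝ} (ha : a ∈ Ioo (0 : ℝ) 1)
    (ht : t ∈ Ioo (0 : ℝ) 1) (hS : t ∉ S) :
    HasDerivAt (fun t => ∫ s in a..t, φ s) (φ t) t := by
  obtain ⟨l, r, hl, hr, hlr, hal, hat⟩ := exists_unit_Ioo ha ht
  refine intervalIntegral.integral_hasDerivAt_right (hφ.integrable a ha t ht) ?_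
    (hφ.continuousAt t ht hS)
  refine ⟨Ioc l r, Ioc_mem_nhds hat.1 hat.2, ?_⟩
  exact ((intervalIntegrable_iff_integrableOn_Ioc_of_le hlr).1
    (hφ.integrable l hl r hr)).aestronglyMeasurable

theorem integral_eq_sub_of_hasDerivAt_off {S : Set ℝ} (hS : S.Countable) {F f : ℝ → ℂ} {a b : ℝ}
    (ha : a ∈ Ioo (0 : ℝ) 1) (hb : b ∈ Ioo (0 : ℝ) 1)
    (hF : ContinuousOn F (Ioo 0 1)) (hd : ∀ t ∈ Ioo (0 : ℝ) 1, t ∉ S → HasDerivAt F (f t) t)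
    (hf : IntervalIntegrable f volume a b) : ∫ t in a..b, f t = F b - F a := by
  refine integral_eq_of_hasDerivAt_off_countable F f hS
    (hF.mono (uIcc_subset_unit ha hb)) (fun x hx => hd x ?_ hx.2) hf
  exact uIcc_subset_unit ha hb (Ioo_subset_Icc_self hx.1)

section

variable {S : Set ℝ} {φ : ℕ → ℝ → ℂ}

theorem continuousOn_iterInt (hφ : ∀ i, IsDensity S (φ i)) (m : ℕ) {a : ℝ}
    (ha : a ∈ Ioo (0 : ℝ) 1) : ContinuousOn (fun t => iterInt φ m a t) (Ioo 0 1) := by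
  induction m with
  | zero => exact continuousOn_const
  | succ m ih => exact ((hφ m).continuousOn_mul ih).continuousOn_integral ha

theorem isDensity_iterInt_mul (hφ : ∀ i, IsDensity S (φ i)) (m : ℕ) {a : ℝ}
    (ha : a ∈ Ioo (0 : ℝ) 1) (k : ℕ) : IsDensity S (fun t => iterInt φ m a t * φ k t) :=
  (hφ k).continuousOn_mul (continuousOn_iterInt hφ m ha)

theorem hasDerivAt_iterInt (hφ : ∀ i, IsDensity S (φ i)) (m : ℕ) {a t : ℝ}
    (ha : a ∈ Ioo (0 : ℝ) 1) (ht : t ∈ Ioo (0 : ℝ) 1) (hS : t ∉ S) :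
    HasDerivAt (fun t => iterInt φ (m + 1) a t) (iterInt φ m a t * φ m t) t :=
  (isDensity_iterInt_mul hφ m ha m).hasDerivAt_integral ha ht hS

theorem iterInt_succ_self (φ : ℕ → ℝ → ℂ) (m : ℕ) (a : ℝ) : iterInt φ (m + 1) a a = 0 := by
  simp [iterInt]

/-- Path composition for iterated integrals. -/
theorem iterInt_comp (hφ : ∀ i, IsDensity S (φ i)) (m : ℕ) {a b c : ℝ}
    (ha : a ∈ Ioo (0 : ℝ) 1) (hb : b ∈ Ioo (0 : ℝ) 1) (hc : c ∈ Ioo (0 : ℝ) 1) :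
    iterInt φ m a c = ∑ k ∈ Finset.range (m + 1),
      iterInt φ k a b * iterInt (fun i => φ (i + k)) (m - k) b c := by
  induction m generalizing c with
  | zero => simp [iterInt]
  | succ m ih =>
    rw [Finset.sum_range_succ, Nat.sub_self, iterInt_zero, mul_one, iterInt_succ,
      ← intervalIntegral.integral_add_adjacent_intervals
        ((isDensity_iterInt_mul hφ m ha m).integrable a ha b hb)
        ((isDensity_iterInt_mul hφ m ha m).integrable b hb c hc), add_comm, iterInt_succ]
    congr 1
    have h1 : ∫ t in b..c, iterInt φ m a t * φ m t = ∫ t in b..c,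
        ∑ k ∈ Finset.range (m + 1), iterInt φ k a b *
          (iterInt (fun i => φ (i + k)) (m - k) b t * φ m t) := by
      refine intervalIntegral.integral_congr fun t ht => ?_
      simp only [ih (uIcc_subset_unit hb hc ht), Finset.sum_mul, mul_assoc]
    rw [h1, intervalIntegral.integral_finsetSum]
    · refine Finset.sum_congr rfl fun k hk => ?_
      have hk' : k ≤ m := Nat.lt_succ_iff.1 (Finset.mem_range.1 hk)
      rw [intervalIntegral.integral_const_mul, Nat.succ_sub hk', iterInt_succ,
        Nat.sub_add_cancel hk']
    · intro k hk
      exact ((hφ m).continuousOn_mul (continuousOn_iterInt (fun i => hφ (i + k)) (m - k)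
        hb)).integrable b hb c hc |>.const_mul _

theorem iterInt_congr {φ ψ : ℕ → ℝ → ℂ} {a b : ℝ} (m : ℕ)
    (h : ∀ i < m, ∀ t ∈ uIcc a b, φ i t = ψ i t) : iterInt φ m a b = iterInt ψ m a b := by
  induction m generalizing b with
  | zero => rfl
  | succ m ih =>
    refine intervalIntegral.integral_congr fun t ht => ?_
    rw [h m (Nat.lt_succ_self m) t ht, ih fun i hi s hs => h i (hi.trans (Nat.lt_succ_self m)) s
      (uIcc_subset_uIcc left_mem_uIcc ht hs)]

theorem iterInt_smul (φ : ℕ → ℝ → ℂ) (c : ℕ → ℂ) (m : ℕ) (a b : ℝ) :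
    iterInt (fun i t => c i * φ i t) m a b = (∏ i ∈ Finset.range m, c i) * iterInt φ m a b := by
  induction m generalizing b with
  | zero => simp [iterInt]
  | succ m ih =>
    rw [iterInt_succ, iterInt_succ, Finset.prod_range_succ,
      ← intervalIntegral.integral_const_mul]
    refine intervalIntegral.integral_congr fun t _ => ?_
    simp only [ih]
    ring

end

/-! ### Integrals and iterated integrals depending on a parameter -/

section

variable {X F : Type*} [TopologicalSpace X] [NormedAddCommGroup F]

/-- Tube lemma: compactness in t turns joint continuity into one bound valid for all parameters near
x₀. It supplies the dominating functions below. -/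
theorem eventually_norm_le_of_continuousOn {U : Set X} (hU : IsOpen U) {f : X → ℝ → F}
    (hf : ContinuousOn (fun p : X × ℝ => f p.1 p.2) (U ×ˢ Ioo (0 : ℝ) 1)) {x₀ : X} (hx : x₀ ∈ U)
    {l r : ℝ} (hl : l ∈ Ioo (0 : ℝ) 1) (hr : r ∈ Ioo (0 : ℝ) 1) :
    ∃ C : ℝ, ∀ᶠ x in 𝓝 x₀, x ∈ U ∧ ∀ t ∈ uIcc l r, ‖f x t‖ ≤ C := by
  have hsub := uIcc_subset_unit hl hr
  have hopen : IsOpen (U ×ˢ Ioo (0 : ℝ) 1) := hU.prod isOpen_Ioo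
  have hc : ContinuousOn (fun t => f x₀ t) (uIcc l r) := fun t ht =>
    ((hf.continuousAt (hopen.mem_nhds ⟨hx, hsub ht⟩)).comp (f := fun t : ℝ => (x₀, t))
      (by fun_prop)).continuousWithinAt
  obtain ⟨C, hC⟩ := isCompact_uIcc.exists_bound_of_continuousOn hc
  refine ⟨C + 1, Filter.Eventually.and (hU.mem_nhds hx) ?_⟩
  refine isCompact_uIcc.eventually_forall_of_forall_eventually fun t ht => ?_
  have : ContinuousAt (fun p : X × ℝ => ‖f p.1 p.2‖) (x₀, t) :=
    ContinuousAt.norm (hf.continuousAt (hopen.mem_nhds ⟨hx, hsub ht⟩))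
  refine (this.eventually_lt_const ((hC t ht).trans_lt (lt_add_one C))).mono fun z hz => hz.le

theorem continuousOn_slice {U : Set X} (hU : IsOpen U) {f : X → ℝ → F}
    (hf : ContinuousOn (fun p : X × ℝ => f p.1 p.2) (U ×ˢ Ioo (0 : ℝ) 1)) {x : X} (hx : x ∈ U) :
    ContinuousOn (f x) (Ioo 0 1) := fun t ht =>
  ((hf.continuousAt ((hU.prod isOpen_Ioo).mem_nhds ⟨hx, ht⟩)).comp (f := fun t : ℝ => (x, t))
      (by fun_prop)).continuousWithinAt

theorem continuousAt_slice {U : Set X} (hU : IsOpen U) {f : X → ℝ → F}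
    (hf : ContinuousOn (fun p : X × ℝ => f p.1 p.2) (U ×ˢ Ioo (0 : ℝ) 1)) {x : X} (hx : x ∈ U)
    {t : ℝ} (ht : t ∈ Ioo (0 : ℝ) 1) : ContinuousAt (fun x => f x t) x :=
  (hf.continuousAt ((hU.prod isOpen_Ioo).mem_nhds ⟨hx, ht⟩)).comp (f := fun x : X => (x, t))
      (by fun_prop)

variable [NormedSpace ℂ F]

theorem intervalIntegrable_smul {S : Set ℝ} {ρ : ℝ → ℂ} (hρ : IsDensity S ρ) {f : ℝ → F}
    (hf : ContinuousOn f (Ioo 0 1)) {a b : ℝ} (ha : a ∈ Ioo (0 : ℝ) 1) (hb : b ∈ Ioo (0 : ℝ) 1) :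
    IntervalIntegrable (fun s => ρ s • f s) volume a b :=
  (hρ.integrable a ha b hb).smul_continuousOn (hf.mono (uIcc_subset_unit ha hb))

theorem continuousOn_param_integral [FirstCountableTopology X] {S : Set ℝ} {ρ : ℝ → ℂ}
    (hρ : IsDensity S ρ) {U : Set X} (hU : IsOpen U) {f : X → ℝ → F}
    (hf : ContinuousOn (fun p : X × ℝ => f p.1 p.2) (U ×ˢ Ioo (0 : ℝ) 1)) {a : ℝ}
    (ha : a ∈ Ioo (0 : ℝ) 1) :
    ContinuousOn (fun p : X × ℝ => ∫ s in a..p.2, ρ s • f p.1 s) (U ×ˢ Ioo (0 : ℝ) 1) := by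
  classical
  rintro ⟨x₀, t₀⟩ ⟨hx, ht⟩
  simp only at hx ht
  obtain ⟨l, r, hl, hr, hlr, hal, hat⟩ := exists_unit_Ioo ha ht
  obtain ⟨C, hC⟩ := eventually_norm_le_of_continuousOn hU hf hx hl hr
  have hC' : ∀ᶠ x in 𝓝 x₀, x ∈ U := hU.mem_nhds hx
  -- The dominated-convergence lemma asks for measurability at every parameter, so the integrand is
  -- cut off to 0 outside U.
  let G : X → ℝ → F := fun x s => if x ∈ U then ρ s • f x s else 0
  have key : ContinuousAt (fun p : X × ℝ => ∫ s in a..p.2, G p.1 s) (x₀, t₀) := by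
    refine intervalIntegral.continuousAt_parametric_primitive_of_dominated
      (fun s => ‖ρ s‖ * C) l r ?_ ?_ ?_ ?_ hal hat (by simp)
    · intro x
      by_cases hxU : x ∈ U
      · simp only [G, hxU, if_true]
        exact (intervalIntegrable_iff.1 (intervalIntegrable_smul hρ (continuousOn_slice hU hf hxU)
          hl hr)).aestronglyMeasurable
      · simp only [G, hxU, if_false]
        exact aestronglyMeasurable_const
    · filter_upwards [hC] with x hx
      refine (ae_restrict_iff' measurableSet_uIoc).2 (Eventually.of_forall fun s hs => ?_)
      simp only [G, hx.1, if_true, norm_smul]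
      exact mul_le_mul_of_nonneg_left (hx.2 s (uIoc_subset_uIcc hs)) (norm_nonneg _)
    · exact (hρ.integrable l hl r hr).norm.mul_const C
    · refine (ae_restrict_iff' measurableSet_uIoc).2 (Eventually.of_forall fun s hs => ?_)
      have h1 := (continuousAt_slice hU hf hx
        (uIcc_subset_unit hl hr (uIoc_subset_uIcc hs))).const_smul (ρ s)
      refine h1.congr ?_
      filter_upwards [hC'] with x hx
      simp [G, hx]
  refine (key.congr ?_).continuousWithinAt
  filter_upwards [(continuous_fst.tendsto (x₀, t₀)).eventually hC'] with p hp
  simp only [G, hp, if_true]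

theorem continuousOn_param_iterInt [FirstCountableTopology X] {S : Set ℝ} {ρ : ℝ → ℂ}
    (hρ : IsDensity S ρ) {U : Set X} (hU : IsOpen U) {ψ : ℕ → X → ℝ → ℂ}
    (hψ : ∀ i, ContinuousOn (fun p : X × ℝ => ψ i p.1 p.2) (U ×ˢ Ioo (0 : ℝ) 1)) (m : ℕ) {a : ℝ}
    (ha : a ∈ Ioo (0 : ℝ) 1) :
    ContinuousOn (fun p : X × ℝ => iterInt (fun i t => ψ i p.1 t * ρ t) m a p.2)
      (U ×ˢ Ioo (0 : ℝ) 1) := by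
  induction m with
  | zero => exact continuousOn_const
  | succ m ih =>
    refine (continuousOn_param_integral hρ hU
      (f := fun x t => iterInt (fun i t => ψ i x t * ρ t) m a t * ψ m x t) (ih.mul (hψ m)) ha).congr fun p _ => ?_
    simp only [iterInt_succ, smul_eq_mul]
    exact intervalIntegral.integral_congr fun t _ => by ring

end

/-! ### Holomorphic dependence of iterated integrals on a parameter -/

section

variable {E : Type*} [NormedAddCommGroup E] [NormedSpace ℂ E]

theorem hasFDerivAt_param_integral {S : Set ℝ} {ρ : ℝ → ℂ}
    (hρ : IsDensity S ρ) {U : Set E} (hU : IsOpen U) {f : E → ℝ → ℂ} {f' : E → ℝ → E →L[ℂ] ℂ}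
    (hf : ContinuousOn (fun p : E × ℝ => f p.1 p.2) (U ×ˢ Ioo (0 : ℝ) 1))
    (hf' : ContinuousOn (fun p : E × ℝ => f' p.1 p.2) (U ×ˢ Ioo (0 : ℝ) 1))
    (hd : ∀ x ∈ U, ∀ t ∈ Ioo (0 : ℝ) 1, HasFDerivAt (fun x => f x t) (f' x t) x)
    {a b : ℝ} (ha : a ∈ Ioo (0 : ℝ) 1) (hb : b ∈ Ioo (0 : ℝ) 1) {x : E} (hx : x ∈ U) :
    HasFDerivAt (fun x => ∫ s in a..b, ρ s • f x s) (∫ s in a..b, ρ s • f' x s) x := by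
  obtain ⟨C, hC⟩ := eventually_norm_le_of_continuousOn hU hf' hx ha hb
  have hsub := uIcc_subset_unit ha hb
  refine intervalIntegral.hasFDerivAt_integral_of_dominated_of_fderiv_le
    (F' := fun x s => ρ s • f' x s) (bound := fun s => ‖ρ s‖ * C) hC ?_ ?_ ?_ ?_ ?_ ?_
  · filter_upwards [hU.mem_nhds hx] with y hy
    exact (intervalIntegrable_iff.1 (intervalIntegrable_smul hρ (continuousOn_slice hU hf hy) ha hb)).aestronglyMeasurable
  · exact intervalIntegrable_smul hρ (continuousOn_slice hU hf hx) ha hb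
  · exact (intervalIntegrable_iff.1 (intervalIntegrable_smul hρ (continuousOn_slice hU hf' hx)
      ha hb)).aestronglyMeasurable
  · refine Eventually.of_forall fun s hs y hy => ?_
    rw [norm_smul]
    exact mul_le_mul_of_nonneg_left (hy.2 s (uIoc_subset_uIcc hs)) (norm_nonneg _)
  · exact (hρ.integrable a ha b hb).norm.mul_const C
  · refine Eventually.of_forall fun s hs y hy => ?_
    exact (hd y hy.1 s (hsub (uIoc_subset_uIcc hs))).const_smul (ρ s)

/-- `f` and its derivative in the first variable are jointly continuous on `U × (0,1)`. -/
def JointC1 (U : Set E) (f : E → ℝ → ℂ) : Prop :=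
  ContinuousOn (fun p : E × ℝ => f p.1 p.2) (U ×ˢ Ioo (0 : ℝ) 1) ∧
  ∃ f' : E → ℝ → E →L[ℂ] ℂ, ContinuousOn (fun p : E × ℝ => f' p.1 p.2) (U ×ˢ Ioo (0 : ℝ) 1) ∧
    ∀ x ∈ U, ∀ t ∈ Ioo (0 : ℝ) 1, HasFDerivAt (fun x => f x t) (f' x t) x

variable {U : Set E} {f g : E → ℝ → ℂ}

theorem JointC1.mul (hf : JointC1 U f) (hg : JointC1 U g) :
    JointC1 U (fun x t => f x t * g x t) := by
  obtain ⟨cf, f', cf', df⟩ := hf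
  obtain ⟨cg, g', cg', dg⟩ := hg
  exact ⟨cf.mul cg, fun x t => f x t • g' x t + g x t • f' x t, (cf.smul cg').add (cg.smul cf'),
    fun x hx t ht => (df x hx t ht).mul (dg x hx t ht)⟩

theorem JointC1.add (hf : JointC1 U f) (hg : JointC1 U g) :
    JointC1 U (fun x t => f x t + g x t) := by
  obtain ⟨cf, f', cf', df⟩ := hf
  obtain ⟨cg, g', cg', dg⟩ := hg
  exact ⟨cf.add cg, fun x t => f' x t + g' x t, cf'.add cg',
    fun x hx t ht => (df x hx t ht).add (dg x hx t ht)⟩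

theorem JointC1.cexp (hf : JointC1 U f) : JointC1 U (fun x t => Complex.exp (f x t)) := by
  obtain ⟨cf, f', cf', df⟩ := hf
  exact ⟨cf.cexp, fun x t => Complex.exp (f x t) • f' x t, cf.cexp.smul cf',
    fun x hx t ht => (df x hx t ht).cexp⟩

theorem jointC1_of_continuousOn {h : ℝ → ℂ} (hh : ContinuousOn h (Ioo 0 1)) :
    JointC1 U (fun _ t => h t) :=
  ⟨hh.comp continuousOn_snd fun _ hp => hp.2, fun _ _ => 0, continuousOn_const,
    fun x _ t _ => hasFDerivAt_const (h t) x⟩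

theorem jointC1_of_contDiff {h : E → ℂ} (hh : ContDiff ℂ 1 h) : JointC1 U (fun x _ => h x) :=
  ⟨hh.continuous.comp_continuousOn continuousOn_fst, fun x _ => fderiv ℂ h x,
    (hh.continuous_fderiv one_ne_zero).comp_continuousOn continuousOn_fst,
    fun x _ _ _ => (hh.differentiable one_ne_zero x).hasFDerivAt⟩

theorem JointC1.differentiableOn (hf : JointC1 U f) {t : ℝ} (ht : t ∈ Ioo (0 : ℝ) 1) :
    DifferentiableOn ℂ (fun x => f x t) U := by
  obtain ⟨-, f', -, df⟩ := hf
  exact fun x hx => (df x hx t ht).differentiableAt.differentiableWithinAt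

/-- Stability under indefinite integration, together with stability under products, makes `JointC1`
pass to iterated integrals by induction, with no need for a formula for the derivative. -/
theorem JointC1.integral {S : Set ℝ} {ρ : ℝ → ℂ} (hρ : IsDensity S ρ) (hU : IsOpen U)
    (hf : JointC1 U f) {a : ℝ} (ha : a ∈ Ioo (0 : ℝ) 1) :
    JointC1 U (fun x t => ∫ s in a..t, f x s * ρ s) := by
  obtain ⟨cf, f', cf', df⟩ := hf
  have h : (fun (x : E) (t : ℝ) => ∫ s in a..t, f x s * ρ s) =
      fun x t => ∫ s in a..t, ρ s • f x s := by
    ext x t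
    exact intervalIntegral.integral_congr fun s _ => by simp [mul_comm]
  rw [h]
  exact ⟨continuousOn_param_integral hρ hU cf ha, fun x t => ∫ s in a..t, ρ s • f' x s,
    continuousOn_param_integral hρ hU cf' ha,
    fun x hx t ht => hasFDerivAt_param_integral hρ hU cf cf' df ha ht hx⟩

theorem JointC1.iterInt {S : Set ℝ} {ρ : ℝ → ℂ} (hρ : IsDensity S ρ) (hU : IsOpen U)
    {ψ : ℕ → E → ℝ → ℂ} (hψ : ∀ i, JointC1 U (ψ i)) (m : ℕ) {a : ℝ} (ha : a ∈ Ioo (0 : ℝ) 1) :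
    JointC1 U (fun x t => iterInt (fun i t => ψ i x t * ρ t) m a t) := by
  induction m with
  | zero => exact jointC1_of_continuousOn continuousOn_const
  | succ m ih =>
    convert (ih.mul (hψ m)).integral hρ hU ha using 5
    simp only [iterInt_succ]
    ring_nf

end

/-! ### Iterated primitives on a half plane -/

open Classical in
/-- A primitive of `f` on `H`, if there is one. -/
noncomputable def primitiveOn (H : Set ℂ) (f : ℂ → ℂ) : ℂ → ℂ :=
  if h : ∃ F : ℂ → ℂ, ∀ w ∈ H, HasDerivAt F (f w) w then h.choose else 0

/-- The iterated integral of the holomorphic densities `g 0, …, g (m-1)` from `w₀` to `w` along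
paths in `H`. -/
noncomputable def planeInt (H : Set ℂ) (g : ℕ → ℂ → ℂ) : ℕ → ℂ → ℂ → ℂ
  | 0 => fun _ _ => 1
  | m + 1 => fun w₀ w => primitiveOn H (fun v => planeInt H g m w₀ v * g m v) w -
      primitiveOn H (fun v => planeInt H g m w₀ v * g m v) w₀

theorem planeInt_zero (H : Set ℂ) (g : ℕ → ℂ → ℂ) (w₀ w : ℂ) : planeInt H g 0 w₀ w = 1 := rfl

theorem planeInt_succ_self (H : Set ℂ) (g : ℕ → ℂ → ℂ) (m : ℕ) (w : ℂ) :
    planeInt H g (m + 1) w w = 0 := sub_self _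

theorem hasDerivAt_primitiveOn {H : Set ℂ} (hc : Convex ℝ H) (ho : IsOpen H) {f : ℂ → ℂ}
    (hf : DifferentiableOn ℂ f H) {w : ℂ} (hw : w ∈ H) :
    HasDerivAt (primitiveOn H f) (f w) w := by
  have h : ∃ F : ℂ → ℂ, ∀ w ∈ H, HasDerivAt F (f w) w := by
    obtain ⟨F, hF⟩ := hc.exists_forall_hasDerivWithinAt hf
    exact ⟨F, fun w hw => (hF w hw).hasDerivAt (ho.mem_nhds hw)⟩
  rw [primitiveOn, dif_pos h]
  exact h.choose_spec w hw

section

variable {H : Set ℂ} {g : ℕ → ℂ → ℂ}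

theorem differentiableOn_planeInt (hc : Convex ℝ H) (ho : IsOpen H)
    (hg : ∀ i, DifferentiableOn ℂ (g i) H) (m : ℕ) (w₀ : ℂ) :
    DifferentiableOn ℂ (planeInt H g m w₀) H := by
  induction m with
  | zero => exact differentiableOn_const 1
  | succ m ih =>
    intro w hw
    exact ((hasDerivAt_primitiveOn hc ho (ih.mul (hg m)) hw).sub_const
      _).differentiableAt.differentiableWithinAt

theorem hasDerivAt_planeInt (hc : Convex ℝ H) (ho : IsOpen H)
    (hg : ∀ i, DifferentiableOn ℂ (g i) H) (m : ℕ) (w₀ : ℂ) {w : ℂ} (hw : w ∈ H) :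
    HasDerivAt (planeInt H g (m + 1) w₀) (planeInt H g m w₀ w * g m w) w :=
  (hasDerivAt_primitiveOn hc ho ((differentiableOn_planeInt hc ho hg m w₀).mul (hg m))
    hw).sub_const _

theorem eqOn_of_hasDerivAt (hc : Convex ℝ H) {f₁ f₂ f' : ℂ → ℂ}
    (h₁ : ∀ w ∈ H, HasDerivAt f₁ (f' w) w) (h₂ : ∀ w ∈ H, HasDerivAt f₂ (f' w) w) {w₀ : ℂ}
    (hw₀ : w₀ ∈ H) (h : f₁ w₀ = f₂ w₀) {w : ℂ} (hw : w ∈ H) : f₁ w = f₂ w := by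
  have := hc.norm_image_sub_le_of_norm_hasDerivWithin_le (f := fun w => f₁ w - f₂ w)
    (f' := fun _ => 0) (C := 0)
    (fun w hw => by simpa using ((h₁ w hw).fun_sub (h₂ w hw)).hasDerivWithinAt) (by simp) hw₀ hw
  simp only [h, sub_self, sub_zero, zero_mul, norm_le_zero_iff] at this
  exact sub_eq_zero.1 this

/-- As functions of w₂ the two sides have the same derivative, by the induction hypothesis, and the
same value at w₁. -/
theorem planeInt_comp (hc : Convex ℝ H) (ho : IsOpen H)
    (hg : ∀ i, DifferentiableOn ℂ (g i) H) (m : ℕ) {w₀ w₁ w₂ : ℂ} (hw₁ : w₁ ∈ H)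
    (hw₂ : w₂ ∈ H) :
    planeInt H g m w₀ w₂ = ∑ k ∈ Finset.range (m + 1),
      planeInt H g k w₀ w₁ * planeInt H (fun i => g (i + k)) (m - k) w₁ w₂ := by
  induction m generalizing w₂ with
  | zero => simp [planeInt]
  | succ m ih =>
    refine eqOn_of_hasDerivAt hc (fun w hw => hasDerivAt_planeInt hc ho hg m w₀ hw)
      (f₂ := fun w => ∑ k ∈ Finset.range (m + 1 + 1),
      planeInt H g k w₀ w₁ * planeInt H (fun i => g (i + k)) (m + 1 - k) w₁ w)
      (fun w hw => ?_) hw₁ ?_ hw₂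
    · simp only [Finset.sum_range_succ _ (m + 1), Nat.sub_self, planeInt_zero, mul_one]
      refine HasDerivAt.add_const _ ?_
      rw [ih hw, Finset.sum_mul]
      refine HasDerivAt.fun_sum fun k hk => ?_
      have hk' : k ≤ m := Nat.lt_succ_iff.1 (Finset.mem_range.1 hk)
      have := hasDerivAt_planeInt hc ho (fun i => hg (i + k)) (m - k) w₁ hw
      rw [Nat.sub_add_cancel hk'] at this
      rw [Nat.succ_sub hk', mul_assoc]
      exact this.const_mul _
    · simp only [Finset.sum_range_succ _ (m + 1), Nat.sub_self, planeInt_zero, mul_one]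
      rw [Finset.sum_eq_zero, zero_add]
      intro k hk
      have hk' : k ≤ m := Nat.lt_succ_iff.1 (Finset.mem_range.1 hk)
      rw [Nat.succ_sub hk', planeInt_succ_self, mul_zero]

/-- Again by uniqueness of primitives: translating both endpoints by T multiplies each density by
its factor `q i`. -/
theorem planeInt_add_period (hc : Convex ℝ H) (ho : IsOpen H)
    (hg : ∀ i, DifferentiableOn ℂ (g i) H) {T : ℂ} (hT : ∀ w ∈ H, w + T ∈ H) {q : ℕ → ℂ}
    (hq : ∀ i, ∀ w ∈ H, g i (w + T) = q i * g i w) (m : ℕ) {w₀ w : ℂ} (hw₀ : w₀ ∈ H)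
    (hw : w ∈ H) :
    planeInt H g m (w₀ + T) (w + T) = (∏ i ∈ Finset.range m, q i) * planeInt H g m w₀ w := by
  induction m generalizing w with
  | zero => simp [planeInt]
  | succ m ih =>
    refine eqOn_of_hasDerivAt hc (f₁ := fun w => planeInt H g (m + 1) (w₀ + T) (w + T))
      (f₂ := fun w => (∏ i ∈ Finset.range (m + 1), q i) * planeInt H g (m + 1) w₀ w)
      (fun w hw => ?_) (fun w hw =>
        (hasDerivAt_planeInt hc ho hg m w₀ hw).const_mul _) hw₀ ?_ hw
    · have := (hasDerivAt_planeInt hc ho hg m (w₀ + T) (hT w hw)).comp_add_const w T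
      refine this.congr_deriv ?_
      rw [ih hw, hq m w hw, Finset.prod_range_succ]
      ring
    · simp [planeInt_succ_self]

/-- The iterated integral along a path in `H` depends on the endpoints only. -/
theorem iterInt_eq_planeInt (hc : Convex ℝ H) (ho : IsOpen H)
    (hg : ∀ i, DifferentiableOn ℂ (g i) H) {S : Set ℝ} (hS : S.Countable) {φ : ℕ → ℝ → ℂ}
    (hφ : ∀ i, IsDensity S (φ i)) {ℓ ℓ' : ℝ → ℂ} (m : ℕ) {a b : ℝ} (ha : a ∈ Ioo (0 : ℝ) 1)
    (hb : b ∈ Ioo (0 : ℝ) 1)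
    (hℓc : ContinuousOn ℓ (Ioo 0 1)) (hℓ : ∀ t ∈ Ioo (0 : ℝ) 1, t ∉ S → HasDerivAt ℓ (ℓ' t) t)
    (hH : ∀ t ∈ uIcc a b, ℓ t ∈ H)
    (hφg : ∀ i < m, ∀ t ∈ uIcc a b, φ i t = g i (ℓ t) * ℓ' t) :
    iterInt φ m a b = planeInt H g m (ℓ a) (ℓ b) := by
  induction m generalizing b with
  | zero => rfl
  | succ m ih =>
    have hsub := uIcc_subset_unit ha hb
    rw [iterInt_succ]
    have h1 : ∀ t ∈ uIcc a b, iterInt φ m a t = planeInt H g m (ℓ a) (ℓ t) := fun t ht =>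
      ih (hsub ht) (fun s hs => hH s (uIcc_subset_uIcc left_mem_uIcc ht hs))
        fun i hi s hs => hφg i (hi.trans (Nat.lt_succ_self m)) s
          (uIcc_subset_uIcc left_mem_uIcc ht hs)
    rw [integral_eq_of_hasDerivAt_off_countable (fun t => planeInt H g (m + 1) (ℓ a) (ℓ t))
      (fun t => iterInt φ m a t * φ m t) hS, planeInt_succ_self, sub_zero]
    · exact (differentiableOn_planeInt hc ho hg (m + 1) (ℓ a)).continuousOn.comp
        (hℓc.mono hsub) hH
    · rintro t ⟨ht, htS⟩
      have ht' : t ∈ uIcc a b := Ioo_subset_Icc_self ht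
      rw [h1 t ht', hφg m (Nat.lt_succ_self m) t ht', ← mul_assoc]
      exact (hasDerivAt_planeInt hc ho hg m (ℓ a) (hH t ht')).comp t (hℓ t (hsub ht') htS)
    · exact (isDensity_iterInt_mul hφ m ha m).integrable a ha b hb

end

/-! ### Growth estimates in a half strip -/

/-- A left half plane. -/
def leftHalfPlane (M : ℝ) : Set ℂ := {w | w.re < -M}

/-- A left half strip. -/
def halfStrip (M K : ℝ) : Set ℂ := {w | w.re < -M ∧ |w.im| ≤ K}

theorem convex_leftHalfPlane (M : ℝ) : Convex ℝ (leftHalfPlane M) := convex_halfSpace_re_lt _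

theorem isOpen_leftHalfPlane (M : ℝ) : IsOpen (leftHalfPlane M) :=
  isOpen_lt Complex.continuous_re continuous_const

/-- Integrate f' along a horizontal and then a vertical segment inside the strip. The vertical one
has length at most 2K, and the horizontal integral of exp(σx) contributes at most |σ|⁻¹ times the
larger endpoint value. -/
theorem norm_sub_le_of_exp_growth_of_le {M K A σ : ℝ} (hA : 0 ≤ A) (hσ : σ ≠ 0) {f f' : ℂ → ℂ}
    (hf : ∀ w ∈ leftHalfPlane M, HasDerivAt f (f' w) w) {w₀ w : ℂ} (hw₀ : w₀ ∈ halfStrip M K)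
    (hw : w ∈ halfStrip M K) (hle : w₀.re ≤ w.re)
    (hb : ∀ v ∈ halfStrip M K, v.re ∈ Icc w₀.re w.re → ‖f' v‖ ≤ A * Real.exp (σ * v.re)) :
    ‖f w - f w₀‖ ≤ A * (2 * K + |σ|⁻¹) * max (Real.exp (σ * w₀.re)) (Real.exp (σ * w.re)) := by
  set E := max (Real.exp (σ * w₀.re)) (Real.exp (σ * w.re)) with hE
  have hE0 : 0 ≤ E := (Real.exp_pos _).le.trans (le_max_left _ _)
  -- The corner between the horizontal and the vertical segment.
  let w₁ : ℂ := ⟨w.re, w₀.im⟩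
  have hw₁ : w₁ ∈ halfStrip M K := ⟨hw.1, hw₀.2⟩
  have h1 : ‖f w - f w₁‖ ≤ A * (2 * K) * E := by
    have hconv : Convex ℝ ({v : ℂ | v.re = w.re} ∩ {v | -K ≤ v.im} ∩ {v | v.im ≤ K}) :=
      ((convex_hyperplane (f := Complex.re) Complex.reLm.isLinear _).inter
        (convex_halfSpace_im_ge _)).inter (convex_halfSpace_im_le _)
    have hmem : ∀ v ∈ ({v : ℂ | v.re = w.re} ∩ {v | -K ≤ v.im} ∩ {v | v.im ≤ K}),
        v ∈ halfStrip M K := fun v hv =>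
      ⟨by rw [show v.re = w.re from hv.1.1]; exact hw.1, abs_le.2 ⟨hv.1.2, hv.2⟩⟩
    have := hconv.norm_image_sub_le_of_norm_hasDerivWithin_le (f := f) (f' := f') (C := A * E)
      (fun v hv => (hf v (hmem v hv).1).hasDerivWithinAt)
      (fun v hv => by
        refine (hb v (hmem v hv) ?_).trans ?_
        · rw [show v.re = w.re from hv.1.1]; exact ⟨hle, le_rfl⟩
        · rw [show v.re = w.re from hv.1.1]
          exact mul_le_mul_of_nonneg_left (le_max_right _ _) hA)
      (x := w₁) (y := w) ⟨⟨rfl, (abs_le.1 hw₀.2).1⟩, (abs_le.1 hw₀.2).2⟩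
      ⟨⟨rfl, (abs_le.1 hw.2).1⟩, (abs_le.1 hw.2).2⟩
    have hdist : ‖w - w₁‖ ≤ 2 * K := by
      have h : w - w₁ = ((w.im - w₀.im : ℝ) : ℂ) * Complex.I := by
        apply Complex.ext <;> simp [w₁]
      rw [h, norm_mul, Complex.norm_I, mul_one, Complex.norm_real, Real.norm_eq_abs]
      have := abs_sub w.im w₀.im
      linarith [hw.2, hw₀.2]
    calc ‖f w - f w₁‖ ≤ A * E * ‖w - w₁‖ := this
      _ ≤ A * E * (2 * K) := by gcongr
      _ = A * (2 * K) * E := by ring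
  have h2 : ‖f w₁ - f w₀‖ ≤ A * |σ|⁻¹ * E := by
    have hmem : ∀ x ∈ Icc w₀.re w.re, (⟨x, w₀.im⟩ : ℂ) ∈ halfStrip M K := fun x hx =>
      ⟨lt_of_le_of_lt hx.2 hw.1, hw₀.2⟩
    have hd : ∀ x ∈ Icc w₀.re w.re,
        HasDerivAt (fun x : ℝ => f ⟨x, w₀.im⟩ - f w₀) (f' ⟨x, w₀.im⟩) x := fun x hx => by
      have h3 : HasDerivAt (fun x : ℝ => (⟨x, w₀.im⟩ : ℂ)) 1 x := by
        have : (fun x : ℝ => (⟨x, w₀.im⟩ : ℂ)) = fun x : ℝ => (x : ℂ) + (w₀.im : ℂ) * Complex.I := by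
          ext x
          rw [Complex.mk_eq_add_mul_I]
        rw [this]
        exact (Complex.ofRealCLM.hasDerivAt (x := x)).add_const _
      simpa using ((hf _ (hmem x hx).1).comp x h3).sub_const (f w₀)
    have := image_norm_le_of_norm_deriv_right_le_deriv_boundary
      (f := fun x : ℝ => f ⟨x, w₀.im⟩ - f w₀) (f' := fun x => f' ⟨x, w₀.im⟩)
      (a := w₀.re) (b := w.re)
      -- The comparison function is the primitive of A exp(σx) that vanishes at the left end.
      (B := fun x => A * (Real.exp (σ * x) - Real.exp (σ * w₀.re)) / σ)
      (B' := fun x => A * Real.exp (σ * x))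
      (fun x hx => (hd x hx).continuousAt.continuousWithinAt)
      (fun x hx => (hd x (Ico_subset_Icc_self hx)).hasDerivWithinAt) (by simp)
      (fun x => by
        have h4 := (((((hasDerivAt_id x).const_mul σ).exp).sub_const
          (Real.exp (σ * w₀.re))).const_mul A).div_const σ
        refine h4.congr_deriv ?_
        simp only [id]
        field_simp)
      (fun x hx => hb _ (hmem x (Ico_subset_Icc_self hx)) (Ico_subset_Icc_self hx))
      (right_mem_Icc.2 hle)
    refine this.trans ((le_abs_self _).trans ?_)
    rw [abs_div, abs_mul, abs_of_nonneg hA, div_eq_mul_inv, mul_assoc, mul_assoc, mul_comm |σ|⁻¹]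
    gcongr
    rw [abs_sub_le_iff]
    constructor <;> linarith [le_max_left (Real.exp (σ * w₀.re)) (Real.exp (σ * w.re)),
      le_max_right (Real.exp (σ * w₀.re)) (Real.exp (σ * w.re)), Real.exp_pos (σ * w₀.re),
      Real.exp_pos (σ * w.re)]
  calc ‖f w - f w₀‖ ≤ ‖f w - f w₁‖ + ‖f w₁ - f w₀‖ := norm_sub_le_norm_sub_add_norm_sub _ _ _
    _ ≤ A * (2 * K) * E + A * |σ|⁻¹ * E := add_le_add h1 h2
    _ = A * (2 * K + |σ|⁻¹) * E := by ring

theorem norm_sub_le_of_exp_growth {M K A σ : ℝ} (hA : 0 ≤ A) (hσ : σ ≠ 0) {f f' : ℂ → ℂ}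
    (hf : ∀ w ∈ leftHalfPlane M, HasDerivAt f (f' w) w) {w₀ w : ℂ} (hw₀ : w₀ ∈ halfStrip M K)
    (hw : w ∈ halfStrip M K)
    (hb : ∀ v ∈ halfStrip M K, v.re ∈ uIcc w₀.re w.re → ‖f' v‖ ≤ A * Real.exp (σ * v.re)) :
    ‖f w - f w₀‖ ≤ A * (2 * K + |σ|⁻¹) * max (Real.exp (σ * w₀.re)) (Real.exp (σ * w.re)) := by
  rcases le_total w₀.re w.re with h | h
  · exact norm_sub_le_of_exp_growth_of_le hA hσ hf hw₀ hw h (by rwa [uIcc_of_le h] at hb)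
  · rw [norm_sub_rev, max_comm]
    exact norm_sub_le_of_exp_growth_of_le hA hσ hf hw hw₀ h (by rwa [uIcc_of_ge h] at hb)

section

variable {M K A δ : ℝ} {g : ℕ → ℂ → ℂ} {τ : ℕ → ℝ}

theorem strip_constant_nonneg (hA : 0 ≤ A) (hK : 0 ≤ K) (hδ : 0 < δ) :
    0 ≤ A * (2 * K + δ⁻¹) := by positivity

/-- The growth exponents of the densities telescope: after k integrations the integrand grows like
exp(τ k * Re v), and since τ k ≥ δ each integration costs only the constant A(2K + 1/δ). Here w₀ is
the point nearer to the end of the path. -/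
theorem norm_planeInt_le_left (hA : 0 ≤ A) (hK : 0 ≤ K) (hδ : 0 < δ)
    (hg : ∀ i, DifferentiableOn ℂ (g i) (leftHalfPlane M)) (m : ℕ)
    (hb : ∀ i < m, ∀ v ∈ halfStrip M K, ‖g i v‖ ≤ A * Real.exp ((τ (i + 1) - τ i) * v.re))
    (h0 : 0 ≤ τ 0) (hτ : ∀ k, 1 ≤ k → k ≤ m → δ ≤ τ k) {w₀ w : ℂ} (hw₀ : w₀ ∈ halfStrip M K)
    (hw : w ∈ halfStrip M K) (hle : w₀.re ≤ w.re) :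
    ‖planeInt (leftHalfPlane M) g m w₀ w‖ ≤
      (A * (2 * K + δ⁻¹)) ^ m * (Real.exp (-τ 0 * w₀.re) * Real.exp (τ m * w.re)) := by
  have hC := strip_constant_nonneg hA hK hδ
  induction m generalizing w with
  | zero =>
    rw [planeInt_zero, norm_one, pow_zero, one_mul, ← Real.exp_add]
    exact Real.one_le_exp (by nlinarith)
  | succ m ih =>
    have hτm : δ ≤ τ (m + 1) := hτ (m + 1) (by omega) le_rfl
    have hpos : 0 < τ (m + 1) := hδ.trans_le hτm
    have := norm_sub_le_of_exp_growth
      (A := A * ((A * (2 * K + δ⁻¹)) ^ m * Real.exp (-τ 0 * w₀.re))) (by positivity) hpos.ne'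
      (f := planeInt (leftHalfPlane M) g (m + 1) w₀) (fun w hw => hasDerivAt_planeInt
        (convex_leftHalfPlane M) (isOpen_leftHalfPlane M) hg m w₀ hw) hw₀ hw
      (fun v hv hvre => by
        rw [uIcc_of_le hle] at hvre
        have h1 := ih (fun i hi => hb i (by omega)) (fun k h1 h2 => hτ k h1 (by omega)) hv hvre.1
        have h2 := hb m (by omega) v hv
        rw [norm_mul]
        refine (mul_le_mul h1 h2 (norm_nonneg _) (by positivity)).trans_eq ?_
        rw [show τ (m + 1) * v.re = τ m * v.re + (τ (m + 1) - τ m) * v.re by ring,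
          Real.exp_add (τ m * v.re)]
        ring)
    rw [planeInt_succ_self, sub_zero] at this
    refine this.trans ?_
    have hmax : max (Real.exp (τ (m + 1) * w₀.re)) (Real.exp (τ (m + 1) * w.re)) =
        Real.exp (τ (m + 1) * w.re) := max_eq_right (Real.exp_le_exp.2 (by nlinarith))
    have hinv : |τ (m + 1)|⁻¹ ≤ δ⁻¹ := by
      rw [abs_of_pos hpos]
      exact inv_anti₀ hδ hτm
    rw [hmax]
    calc A * ((A * (2 * K + δ⁻¹)) ^ m * Real.exp (-τ 0 * w₀.re)) * (2 * K + |τ (m + 1)|⁻¹) *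
          Real.exp (τ (m + 1) * w.re)
        ≤ A * ((A * (2 * K + δ⁻¹)) ^ m * Real.exp (-τ 0 * w₀.re)) * (2 * K + δ⁻¹) *
          Real.exp (τ (m + 1) * w.re) := by gcongr
      _ = _ := by ring

theorem norm_planeInt_le_right (hA : 0 ≤ A) (hK : 0 ≤ K) (hδ : 0 < δ) (hM : 0 ≤ M)
    (hg : ∀ i, DifferentiableOn ℂ (g i) (leftHalfPlane M)) (m : ℕ)
    (hb : ∀ i < m, ∀ v ∈ halfStrip M K, ‖g i v‖ ≤ A * Real.exp ((τ (i + 1) - τ i) * v.re))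
    (h0 : τ 0 ≤ 0) (hτ : ∀ k, 1 ≤ k → k ≤ m → τ k ≤ -δ) {w₀ w : ℂ} (hw₀ : w₀ ∈ halfStrip M K)
    (hw : w ∈ halfStrip M K) (hle : w.re ≤ w₀.re) :
    ‖planeInt (leftHalfPlane M) g m w₀ w‖ ≤
      (A * (2 * K + δ⁻¹)) ^ m * Real.exp (τ m * w.re) := by
  have hC := strip_constant_nonneg hA hK hδ
  induction m generalizing w with
  | zero =>
    rw [planeInt_zero, norm_one, pow_zero, one_mul]
    exact Real.one_le_exp (by nlinarith [hw.1])
  | succ m ih =>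
    have hτm : τ (m + 1) ≤ -δ := hτ (m + 1) (by omega) le_rfl
    have hneg : τ (m + 1) < 0 := by linarith
    have := norm_sub_le_of_exp_growth
      (A := A * ((A * (2 * K + δ⁻¹)) ^ m)) (by positivity) hneg.ne
      (f := planeInt (leftHalfPlane M) g (m + 1) w₀) (fun w hw => hasDerivAt_planeInt
        (convex_leftHalfPlane M) (isOpen_leftHalfPlane M) hg m w₀ hw) hw₀ hw
      (fun v hv hvre => by
        rw [uIcc_of_ge hle] at hvre
        have h1 := ih (fun i hi => hb i (by omega)) (fun k h1 h2 => hτ k h1 (by omega)) hv hvre.2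
        have h2 := hb m (by omega) v hv
        rw [norm_mul]
        refine (mul_le_mul h1 h2 (norm_nonneg _) (by positivity)).trans_eq ?_
        rw [show τ (m + 1) * v.re = τ m * v.re + (τ (m + 1) - τ m) * v.re by ring,
          Real.exp_add (τ m * v.re)]
        ring)
    rw [planeInt_succ_self, sub_zero] at this
    refine this.trans ?_
    have hmax : max (Real.exp (τ (m + 1) * w₀.re)) (Real.exp (τ (m + 1) * w.re)) =
        Real.exp (τ (m + 1) * w.re) := max_eq_right (Real.exp_le_exp.2 (by nlinarith))
    have hinv : |τ (m + 1)|⁻¹ ≤ δ⁻¹ := by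
      rw [abs_of_neg hneg]
      exact inv_anti₀ hδ (by linarith)
    rw [hmax]
    calc A * ((A * (2 * K + δ⁻¹)) ^ m) * (2 * K + |τ (m + 1)|⁻¹) * Real.exp (τ (m + 1) * w.re)
        ≤ A * ((A * (2 * K + δ⁻¹)) ^ m) * (2 * K + δ⁻¹) *
          Real.exp (τ (m + 1) * w.re) := by gcongr
      _ = _ := by ring

/-- Lowering all weights by δ changes no difference of weights and keeps them at least δ. The
lowered weights still control the integral, and the δ that was removed remains as the small factor
exp(δ * Re w₀). -/
theorem norm_planeInt_shift_le_left (hA : 0 ≤ A) (hK : 0 ≤ K) (hδ : 0 < δ)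
    (hg : ∀ i, DifferentiableOn ℂ (g i) (leftHalfPlane M)) {m : ℕ}
    (hb : ∀ i < m, ∀ v ∈ halfStrip M K, ‖g i v‖ ≤ A * Real.exp ((τ (i + 1) - τ i) * v.re))
    (hτ : ∀ k, 1 ≤ k → k ≤ m → 2 * δ ≤ τ k) {k j : ℕ} (hk : 1 ≤ k) (hkj : k + j ≤ m)
    {w₀ w : ℂ} (hw₀ : w₀ ∈ halfStrip M K) (hw : w ∈ halfStrip M K) (hle : w₀.re ≤ w.re)
    (hM : 0 ≤ M) :
    Real.exp (τ k * w₀.re) * ‖planeInt (leftHalfPlane M) (fun i => g (i + k)) j w₀ w‖ ≤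
      (A * (2 * K + δ⁻¹)) ^ j * Real.exp (δ * w₀.re) := by
  have hC := strip_constant_nonneg hA hK hδ
  have h := norm_planeInt_le_left (τ := fun i => τ (i + k) - δ) hA hK hδ (fun i => hg (i + k)) j
    (fun i hi v hv => by
      have := hb (i + k) (by omega) v hv
      rwa [show τ (i + 1 + k) - δ - (τ (i + k) - δ) = τ (i + k + 1) - τ (i + k) by
        rw [show i + 1 + k = i + k + 1 by omega]; ring])
    (by have := hτ (0 + k) (by omega) (by omega); linarith)
    (fun i h1 h2 => by have := hτ (i + k) (by omega) (by omega); linarith) hw₀ hw hle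
  refine (mul_le_mul_of_nonneg_left h (Real.exp_pos _).le).trans ?_
  have h2 : Real.exp ((τ (j + k) - δ) * w.re) ≤ 1 := by
    have := hτ (j + k) (by omega) (by omega)
    have h3 := hw.1
    exact Real.exp_le_one_iff.2 (by nlinarith)
  have h3 : Real.exp (τ k * w₀.re) * Real.exp (-(τ (0 + k) - δ) * w₀.re) =
      Real.exp (δ * w₀.re) := by
    rw [← Real.exp_add, zero_add]
    ring_nf
  calc Real.exp (τ k * w₀.re) * ((A * (2 * K + δ⁻¹)) ^ j *
        (Real.exp (-(τ (0 + k) - δ) * w₀.re) * Real.exp ((τ (j + k) - δ) * w.re)))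
      = (A * (2 * K + δ⁻¹)) ^ j * ((Real.exp (τ k * w₀.re) *
        Real.exp (-(τ (0 + k) - δ) * w₀.re)) * Real.exp ((τ (j + k) - δ) * w.re)) := by ring
    _ ≤ (A * (2 * K + δ⁻¹)) ^ j * (Real.exp (δ * w₀.re) * 1) := by
        rw [h3]; gcongr
    _ = _ := by ring

/-- Cauchy estimate for the limit of the iterated integral at its lower endpoint. -/
theorem norm_planeInt_sub_le_left (hA : 0 ≤ A) (hK : 0 ≤ K) (hδ : 0 < δ)
    (hg : ∀ i, DifferentiableOn ℂ (g i) (leftHalfPlane M)) {m : ℕ}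
    (hb : ∀ i < m, ∀ v ∈ halfStrip M K, ‖g i v‖ ≤ A * Real.exp ((τ (i + 1) - τ i) * v.re))
    (h0 : τ 0 = 0) (hτ : ∀ k, 1 ≤ k → k ≤ m → 2 * δ ≤ τ k)
    {w₀ w₁ w : ℂ} (hw₀ : w₀ ∈ halfStrip M K) (hw₁ : w₁ ∈ halfStrip M K)
    (hw : w ∈ halfStrip M K) (hle : w₀.re ≤ w.re) (hle' : w₁.re ≤ w.re) (hM : 0 ≤ M) :
    ‖planeInt (leftHalfPlane M) g m w₁ w - planeInt (leftHalfPlane M) g m w₀ w‖ ≤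
      m * (A * (2 * K + δ⁻¹)) ^ m * Real.exp (δ * max w₀.re w₁.re) := by
  wlog h : w₁.re ≤ w₀.re generalizing w₀ w₁
  · rw [norm_sub_rev, max_comm]
    exact this hw₁ hw₀ hle' hle (le_of_not_ge h)
  have hC := strip_constant_nonneg hA hK hδ
  -- Split at w₀. The term with nothing before w₀ is the integral that is subtracted; in every other
  -- term the two factors together are of size exp(δ * Re w₀).
  rw [planeInt_comp (convex_leftHalfPlane M) (isOpen_leftHalfPlane M) hg m hw₀.1 hw.1,
    Finset.sum_range_succ', planeInt_zero, one_mul, Nat.sub_zero]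
  simp only [Nat.add_zero, add_sub_cancel_right, max_eq_left h]
  refine (norm_sum_le _ _).trans ?_
  rw [mul_assoc, ← nsmul_eq_mul]
  refine (Finset.sum_le_card_nsmul _ _ _ fun k hk => ?_).trans_eq (by rw [Finset.card_range])
  have hk' : k < m := Finset.mem_range.1 hk
  rw [norm_mul]
  have h1 := norm_planeInt_le_left (τ := τ) hA hK hδ hg (k + 1)
    (fun i hi => hb i (by omega)) h0.ge
    (fun i h1 h2 => by have := hτ i h1 (by omega); linarith) hw₁ hw₀ h
  have h2 := norm_planeInt_shift_le_left hA hK hδ hg hb hτ (k := k + 1) (j := m - (k + 1))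
    (by omega) (by omega) hw₀ hw hle hM
  rw [h0, neg_zero, zero_mul, Real.exp_zero, one_mul] at h1
  refine (mul_le_mul_of_nonneg_right h1 (norm_nonneg _)).trans ?_
  rw [mul_assoc]
  refine (mul_le_mul_of_nonneg_left h2 (by positivity)).trans_eq ?_
  rw [← mul_assoc, ← pow_add, show k + 1 + (m - (k + 1)) = m by omega]

/-- Raising all weights by δ leaves them at most -δ, so that one δ of decay is kept for the last
integration. -/
theorem norm_planeInt_shift_le_right (hA : 0 ≤ A) (hK : 0 ≤ K) (hδ : 0 < δ) (hM : 0 ≤ M)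
    (hg : ∀ i, DifferentiableOn ℂ (g i) (leftHalfPlane M)) {m : ℕ}
    (hb : ∀ i < m, ∀ v ∈ halfStrip M K, ‖g i v‖ ≤ A * Real.exp ((τ (i + 1) - τ i) * v.re))
    (hτ : ∀ k < m, τ k ≤ -(2 * δ)) {k j : ℕ} (hkj : k + j < m)
    {w₀ w : ℂ} (hw₀ : w₀ ∈ halfStrip M K) (hw : w ∈ halfStrip M K) (hle : w.re ≤ w₀.re) :
    ‖planeInt (leftHalfPlane M) (fun i => g (i + k)) j w₀ w‖ ≤
      (A * (2 * K + δ⁻¹)) ^ j * Real.exp ((τ (j + k) + δ) * w.re) := by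
  refine norm_planeInt_le_right (τ := fun i => τ (i + k) + δ) hA hK hδ hM (fun i => hg (i + k)) j
    (fun i hi v hv => ?_) ?_ (fun i h1 h2 => ?_) hw₀ hw hle
  · have := hb (i + k) (by omega) v hv
    rwa [show τ (i + 1 + k) + δ - (τ (i + k) + δ) = τ (i + k + 1) - τ (i + k) by
        rw [show i + 1 + k = i + k + 1 by omega]; ring]
  · have := hτ (0 + k) (by omega)
    linarith
  · have := hτ (i + k) (by omega)
    linarith

/-- Cauchy estimate for the limit of the iterated integral at its upper endpoint. -/
theorem norm_planeInt_sub_le_right (hA : 0 ≤ A) (hK : 0 ≤ K) (hδ : 0 < δ) (hM : 0 ≤ M)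
    (hg : ∀ i, DifferentiableOn ℂ (g i) (leftHalfPlane M)) {m : ℕ}
    (hb : ∀ i < m, ∀ v ∈ halfStrip M K, ‖g i v‖ ≤ A * Real.exp ((τ (i + 1) - τ i) * v.re))
    (h0 : τ m = 0) (hτ : ∀ k < m, τ k ≤ -(2 * δ)) {k : ℕ} (hk : k ≤ m)
    {w₀ w w' : ℂ} (hw₀ : w₀ ∈ halfStrip M K) (hw : w ∈ halfStrip M K) (hw' : w' ∈ halfStrip M K)
    (hle : w.re ≤ w₀.re) (hle' : w'.re ≤ w₀.re) :
    ‖planeInt (leftHalfPlane M) (fun i => g (i + k)) (m - k) w₀ w' -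
        planeInt (leftHalfPlane M) (fun i => g (i + k)) (m - k) w₀ w‖ ≤
      (A * (2 * K + δ⁻¹)) ^ (m - k) * Real.exp (δ * max w.re w'.re) := by
  have hC := strip_constant_nonneg hA hK hδ
  rcases hk.eq_or_lt with rfl | hk
  · simp only [Nat.sub_self, planeInt_zero, sub_self, norm_zero, pow_zero, one_mul]
    positivity
  obtain ⟨j, hj⟩ : ∃ j, m = j + k + 1 := ⟨m - k - 1, by omega⟩
  have hmk : m - k = j + 1 := by omega
  rw [hmk]
  have := norm_sub_le_of_exp_growth
      (A := A * ((A * (2 * K + δ⁻¹)) ^ j)) (by positivity) hδ.ne'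
      (f := planeInt (leftHalfPlane M) (fun i => g (i + k)) (j + 1) w₀)
      (fun w hw => hasDerivAt_planeInt
        (convex_leftHalfPlane M) (isOpen_leftHalfPlane M) (fun i => hg (i + k)) j w₀ hw) hw hw'
      (fun v hv hvre => by
        have hvle : v.re ≤ w₀.re := hvre.2.trans (max_le hle hle')
        have h1 := norm_planeInt_shift_le_right hA hK hδ hM hg hb hτ (k := k) (j := j) (by omega)
          hw₀ hv hvle
        have h2 := hb (j + k) (by omega) v hv
        rw [← hj, h0] at h2
        rw [norm_mul]
        refine (mul_le_mul h1 h2 (norm_nonneg _) (by positivity)).trans_eq ?_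
        -- Since τ m = 0, the growth of the last density cancels that of the integral before it up
        -- to the spare exp(δ * Re v).
        rw [show δ * v.re = (τ (j + k) + δ) * v.re + (0 - τ (j + k)) * v.re by ring,
          Real.exp_add ((τ (j + k) + δ) * v.re)]
        ring)
  refine this.trans_eq ?_
  rw [abs_of_pos hδ, ← Real.exp_monotone.map_max, mul_max_of_nonneg _ _ hδ.le]
  ring

end

/-! ### Paths and normalized beta forms -/

/-- A continuous path on `(0,1)`, continuously differentiable off the countable set `S`. -/
structure IsRegularPath (S : Set ℝ) (γ : ℝ → ℂ) : Prop where
  countable : S.Countable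
  continuousOn : ContinuousOn γ (Ioo 0 1)
  hasDerivAt : ∀ t ∈ Ioo (0 : ℝ) 1, t ∉ S → HasDerivAt γ (deriv γ t) t
  density : IsDensity S (deriv γ)

theorem IsPathBetween.exists_isRegularPath {n : ℕ} {z : Fin (n + 2) → ℂ} {p q : OnePoint ℂ}
    {γ : ℝ → ℂ} (h : IsPathBetween z p q γ) : ∃ S : Set ℝ, IsRegularPath S γ := by
  obtain ⟨S, hS⟩ := h.piecewise
  have ho : IsOpen (Ioo (0 : ℝ) 1 \ (S : Set ℝ)) := isOpen_Ioo.sdiff S.finite_toSet.isClosed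
  refine ⟨S, S.countable_toSet, h.continuousOn, fun t ht htS => ?_, fun t ht htS => ?_,
    fun a ha b hb => ?_⟩
  · exact ((hS.differentiableOn one_ne_zero).differentiableAt (ho.mem_nhds ⟨ht, htS⟩)).hasDerivAt
  · exact (hS.continuousOn_deriv_of_isOpen ho le_rfl).continuousAt (ho.mem_nhds ⟨ht, htS⟩)
  · exact (h.locallyIntegrable.integrableOn_compact_subset (uIcc_subset_unit ha hb)
      isCompact_uIcc).intervalIntegrable

theorem half_mem_unit : (1 / 2 : ℝ) ∈ Ioo (0 : ℝ) 1 := by norm_num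

/-- The branch of `log ((γ t - z) / (γ (1/2) - z))` along `γ` that vanishes at `1/2`. -/
noncomputable def logInt (γ : ℝ → ℂ) (z : ℂ) (t : ℝ) : ℂ :=
  ∫ s in (1 / 2)..t, (γ s - z)⁻¹ * deriv γ s

section

variable {S : Set ℝ} {γ : ℝ → ℂ} {z : ℂ}

theorem IsRegularPath.continuousOn_inv (h : IsRegularPath S γ)
    (hz : ∀ t ∈ Ioo (0 : ℝ) 1, γ t ≠ z) : ContinuousOn (fun t => (γ t - z)⁻¹) (Ioo 0 1) :=
  (h.continuousOn.sub continuousOn_const).inv₀ fun t ht => sub_ne_zero.2 (hz t ht)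

theorem IsRegularPath.density_inv (h : IsRegularPath S γ)
    (hz : ∀ t ∈ Ioo (0 : ℝ) 1, γ t ≠ z) : IsDensity S (fun t => (γ t - z)⁻¹ * deriv γ t) :=
  h.density.continuousOn_mul (h.continuousOn_inv hz)

theorem continuousOn_logInt (h : IsRegularPath S γ) (hz : ∀ t ∈ Ioo (0 : ℝ) 1, γ t ≠ z) :
    ContinuousOn (logInt γ z) (Ioo 0 1) :=
  (h.density_inv hz).continuousOn_integral half_mem_unit

theorem hasDerivAt_logInt (h : IsRegularPath S γ) (hz : ∀ t ∈ Ioo (0 : ℝ) 1, γ t ≠ z) {t : ℝ}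
    (ht : t ∈ Ioo (0 : ℝ) 1) (hS : t ∉ S) :
    HasDerivAt (logInt γ z) ((γ t - z)⁻¹ * deriv γ t) t :=
  (h.density_inv hz).hasDerivAt_integral half_mem_unit ht hS

theorem eq_of_hasDerivAt_zero_off (hS : S.Countable) {F : ℝ → ℂ}
    (hF : ContinuousOn F (Ioo 0 1)) (hd : ∀ t ∈ Ioo (0 : ℝ) 1, t ∉ S → HasDerivAt F 0 t)
    {a b : ℝ} (ha : a ∈ Ioo (0 : ℝ) 1) (hb : b ∈ Ioo (0 : ℝ) 1) : F a = F b := by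
  have := integral_eq_sub_of_hasDerivAt_off (f := fun _ => 0) hS ha hb hF hd
    intervalIntegrable_const
  rw [intervalIntegral.integral_zero] at this
  exact (sub_eq_zero.1 this.symm).symm

/-- A continuous logarithm of `γ - z` differs from `logInt` by a constant. -/
theorem eq_logInt_add_of_exp_eq (h : IsRegularPath S γ) (hz : ∀ t ∈ Ioo (0 : ℝ) 1, γ t ≠ z)
    {L : ℝ → ℂ} (hLc : ContinuousOn L (Ioo 0 1))
    (hL : ∀ t ∈ Ioo (0 : ℝ) 1, Complex.exp (L t) = γ t - z) {t : ℝ} (ht : t ∈ Ioo (0 : ℝ) 1) :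
    L t = logInt γ z t + L (1 / 2) := by
  have hd : ∀ t ∈ Ioo (0 : ℝ) 1, t ∉ S → HasDerivAt L ((γ t - z)⁻¹ * deriv γ t) t := by
    intro t ht hS
    have hcont := hLc.continuousAt (Ioo_mem_nhds ht.1 ht.2)
    have hne := sub_ne_zero.2 (hz t ht)
    -- Near t one has L s = L t + log((γ s - z)/(γ t - z)) with the principal logarithm, as long as
    -- the imaginary part of L s - L t stays below π. This makes L differentiable.
    have h1 := ((((h.hasDerivAt t ht hS).sub_const z).div_const (γ t - z)).clog_real
      (by rw [div_self hne]; exact Complex.one_mem_slitPlane)).const_add (L t)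
    rw [div_self hne, div_one, div_eq_inv_mul] at h1
    refine h1.congr_of_eventuallyEq ?_
    have him : ∀ᶠ s in 𝓝 t, |(L s - L t).im| < Real.pi := by
      have h2 : ContinuousAt (fun s => |(L s - L t).im|) t :=
        (Complex.continuous_im.continuousAt.comp (hcont.sub continuousAt_const)).abs
      exact h2.eventually_lt_const (by simpa using Real.pi_pos)
    filter_upwards [Ioo_mem_nhds ht.1 ht.2, him] with s hs hsim
    rw [← hL s hs, ← hL t ht, ← Complex.exp_sub, Complex.log_exp (by linarith [(abs_lt.1 hsim).1])
      (abs_lt.1 hsim).2.le]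
    ring
  have := eq_of_hasDerivAt_zero_off h.countable (F := fun t => L t - logInt γ z t)
    (hLc.sub (continuousOn_logInt h hz))
    (fun t ht hS => by simpa using (hd t ht hS).fun_sub (hasDerivAt_logInt h hz ht hS)) ht half_mem_unit
  have h0 : logInt γ z (1 / 2) = 0 := by simp [logInt]
  rw [h0, sub_zero] at this
  rw [← this]
  ring

end

/-- The normalized beta form, without the factor `γ'`. -/
noncomputable def formCoeff (γ : ℝ → ℂ) (z α : ℕ → ℂ) (i : ℕ) (t : ℝ) : ℂ :=
  Complex.exp (-α i * logInt γ (z i) t + α (i + 1) * logInt γ (z (i + 1)) t) *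
    (γ t - z (i + 1))⁻¹

/-- The iterated integral over `[a,b]` of the `m` normalized beta forms that start with the
`k`-th one. -/
noncomputable def betaInt (γ : ℝ → ℂ) (z α : ℕ → ℂ) (k m : ℕ) (a b : ℝ) : ℂ :=
  iterInt (fun i t => formCoeff γ z α (i + k) t * deriv γ t) m a b

section

variable {S : Set ℝ} {γ : ℝ → ℂ} {z : ℕ → ℂ}

theorem continuousOn_formCoeff (h : IsRegularPath S γ)
    (hz : ∀ i, ∀ t ∈ Ioo (0 : ℝ) 1, γ t ≠ z i) (α : ℕ → ℂ) (i : ℕ) :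
    ContinuousOn (formCoeff γ z α i) (Ioo 0 1) :=
  (((continuousOn_logInt h (hz i)).const_smul (-α i)).add
    ((continuousOn_logInt h (hz (i + 1))).const_smul (α (i + 1)))).cexp.mul
    (h.continuousOn_inv (hz (i + 1)))

theorem isDensity_form (h : IsRegularPath S γ)
    (hz : ∀ i, ∀ t ∈ Ioo (0 : ℝ) 1, γ t ≠ z i) (α : ℕ → ℂ) (i : ℕ) :
    IsDensity S (fun t => formCoeff γ z α i t * deriv γ t) :=
  h.density.continuousOn_mul (continuousOn_formCoeff h hz α i)

theorem betaInt_comp (h : IsRegularPath S γ)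
    (hz : ∀ i, ∀ t ∈ Ioo (0 : ℝ) 1, γ t ≠ z i) (α : ℕ → ℂ) (k m : ℕ) {a b c : ℝ}
    (ha : a ∈ Ioo (0 : ℝ) 1) (hb : b ∈ Ioo (0 : ℝ) 1) (hc : c ∈ Ioo (0 : ℝ) 1) :
    betaInt γ z α k m a c = ∑ j ∈ Finset.range (m + 1),
      betaInt γ z α k j a b * betaInt γ z α (j + k) (m - j) b c := by
  rw [betaInt, iterInt_comp (fun i => isDensity_form h hz α (i + k)) m ha hb hc]
  simp only [betaInt, add_assoc]

/-- Comparison of the iterated integral of the beta forms with its normalized version. -/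
theorem iteratedIntegral_betaForm (h : IsRegularPath S γ)
    (hz : ∀ i, ∀ t ∈ Ioo (0 : ℝ) 1, γ t ≠ z i) {m : ℕ} {L : Fin (m + 1) → ℝ → ℂ}
    {α : Fin (m + 1) → ℂ} {α' : ℕ → ℂ} (hα : ∀ i : Fin (m + 1), α' i = α i)
    (hL : ∀ i : Fin (m + 1), ContinuousOn (L i) (Ioo 0 1) ∧
      ∀ t ∈ Ioo (0 : ℝ) 1, Complex.exp (L i t) = γ t - z i) {a b : ℝ} (ha : a ∈ Ioo (0 : ℝ) 1)
    (hb : b ∈ Ioo (0 : ℝ) 1) :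
    iteratedIntegral m (betaForm γ L α) a b =
      Complex.exp (α (Fin.last m) * L (Fin.last m) (1 / 2) - α 0 * L 0 (1 / 2)) *
        betaInt γ z α' 0 m a b := by
  -- The i-th form differs from its normalized version by exp(K (i+1) - K i). These constants
  -- telescope, so the branches of the inner logarithms drop out.
  let K : ℕ → ℂ := fun i => if hi : i < m + 1 then α ⟨i, hi⟩ * L ⟨i, hi⟩ (1 / 2) else 0
  let Φ : ℕ → ℝ → ℂ := fun i t => if hi : i < m then betaForm γ L α ⟨i, hi⟩ t else 0
  have h1 : iteratedIntegral m (betaForm γ L α) a b = iterInt Φ m a b := by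
    rw [← iteratedIntegral_eq_iterInt]
    congr 1
    ext i t
    simp [Φ]
  rw [h1, betaInt, iterInt_congr (ψ := fun i t => Complex.exp (K (i + 1) - K i) *
    (formCoeff γ z α' i t * deriv γ t)), iterInt_smul, ← Complex.exp_sum,
    Finset.sum_range_sub]
  · congr 3
    simp [K, Fin.last]
  · intro i hi t ht
    have ht' := uIcc_subset_unit ha hb ht
    have hi1 : i < m + 1 := by omega
    have hi2 : i + 1 < m + 1 := by omega
    simp only [Φ, hi, dif_pos, K, hi1, hi2, betaForm, formCoeff]
    have e1 := eq_logInt_add_of_exp_eq h (hz i) (hL ⟨i, hi1⟩).1 (hL ⟨i, hi1⟩).2 ht'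
    have e2 := eq_logInt_add_of_exp_eq h (hz (i + 1)) (hL ⟨i + 1, hi2⟩).1 (hL ⟨i + 1, hi2⟩).2 ht'
    have e3 := (hL ⟨i + 1, hi2⟩).2 t ht'
    have a1 := hα ⟨i, hi1⟩
    have a2 := hα ⟨i + 1, hi2⟩
    simp only at a1 a2 e3
    rw [← e3, ← Complex.exp_neg, a1, a2, ← mul_assoc, ← mul_assoc, ← Complex.exp_add,
      ← Complex.exp_add, ← Complex.exp_add]
    congr 2
    change -α ⟨i, hi1⟩ * L ⟨i, hi1⟩ t + (α ⟨i + 1, hi2⟩ - 1) * L ⟨i + 1, hi2⟩ t = _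
    rw [show (α ⟨i + 1, hi2⟩ - 1) * L ⟨i + 1, hi2⟩ t = α ⟨i + 1, hi2⟩ * L ⟨i + 1, hi2⟩ t -
      L ⟨i + 1, hi2⟩ t by ring, e1]
    nth_rewrite 1 [e2]
    ring

end

/-! ### Local models of the beta forms at an endpoint of the path -/

/-- The logarithm of `γ - z` in a logarithmic coordinate `w` at an endpoint. -/
noncomputable def localLog (ν r κ w : ℂ) : ℂ := ν * w + κ + Complex.log (1 + r * Complex.exp w)

/-- The normalized beta forms in a logarithmic coordinate at an endpoint. -/
noncomputable def localForm (ν r κ α : ℕ → ℂ) (i : ℕ) (w : ℂ) : ℂ :=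
  Complex.exp (-α i * localLog (ν i) (r i) (κ i) w +
    α (i + 1) * localLog (ν (i + 1)) (r (i + 1)) (κ (i + 1)) w) *
  (ν (i + 1) + r (i + 1) * Complex.exp w / (1 + r (i + 1) * Complex.exp w))

/-- The order of vanishing of the logarithmic derivative of `γ - z` in the coordinate `exp w`. -/
noncomputable def ordOf (ν : ℂ) : ℝ := if ν = 0 then 1 else 0

/-- The real exponent of the `k`-fold iterated integral at an endpoint. -/
noncomputable def weight (ν α : ℕ → ℂ) (k : ℕ) : ℝ :=
  (ν k * α k).re - (ν 0 * α 0).re + ∑ i ∈ Finset.range k, ordOf (ν (i + 1))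

theorem weight_zero (ν α : ℕ → ℂ) : weight ν α 0 = 0 := by simp [weight]

theorem weight_succ_sub (ν α : ℕ → ℂ) (k : ℕ) : weight ν α (k + 1) - weight ν α k =
    (ν (k + 1) * α (k + 1)).re - (ν k * α k).re + ordOf (ν (k + 1)) := by
  rw [weight, weight, Finset.sum_range_succ]
  ring

section

variable {M K R : ℝ}

theorem norm_exp_le_of_mem {w : ℂ} (hw : w ∈ leftHalfPlane M) :
    ‖Complex.exp w‖ ≤ Real.exp (-M) := by
  rw [Complex.norm_exp]
  exact Real.exp_le_exp.2 (le_of_lt hw)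

theorem norm_mul_exp_le {r w : ℂ} (hr : ‖r‖ ≤ R) (hRM : R * Real.exp (-M) ≤ 1 / 2)
    (hw : w ∈ leftHalfPlane M) : ‖r * Complex.exp w‖ ≤ 1 / 2 := by
  rw [norm_mul]
  exact (mul_le_mul hr (norm_exp_le_of_mem hw) (norm_nonneg _) ((norm_nonneg _).trans hr)).trans hRM

theorem one_add_mem_slitPlane {x : ℂ} (hx : ‖x‖ ≤ 1 / 2) : 1 + x ∈ Complex.slitPlane := by
  left
  have := (abs_le.1 (Complex.abs_re_le_norm x)).1
  simp only [Complex.add_re, Complex.one_re]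
  linarith

theorem hasDerivAt_localLog {ν r κ w : ℂ} (h : ‖r * Complex.exp w‖ ≤ 1 / 2) :
    HasDerivAt (localLog ν r κ) (ν + r * Complex.exp w / (1 + r * Complex.exp w)) w := by
  have h1 := (((hasDerivAt_id w).const_mul ν).add_const κ).add
    ((((Complex.hasDerivAt_exp w).const_mul r).const_add 1).clog (one_add_mem_slitPlane h))
  exact h1.congr_deriv (by simp)

theorem differentiableOn_localForm {ν r κ α : ℕ → ℂ} (hr : ∀ i, ‖r i‖ ≤ R)
    (hRM : R * Real.exp (-M) ≤ 1 / 2) (i : ℕ) :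
    DifferentiableOn ℂ (localForm ν r κ α i) (leftHalfPlane M) := by
  intro w hw
  have h1 := norm_mul_exp_le (hr i) hRM hw
  have h2 := norm_mul_exp_le (hr (i + 1)) hRM hw
  refine DifferentiableAt.differentiableWithinAt ?_
  have d1 := (hasDerivAt_localLog (ν := ν i) (κ := κ i) h1).differentiableAt
  have d2 := (hasDerivAt_localLog (ν := ν (i + 1)) (κ := κ (i + 1)) h2).differentiableAt
  have hne := Complex.slitPlane_ne_zero (one_add_mem_slitPlane h2)
  have d3 : DifferentiableAt ℂ (fun w => r (i + 1) * Complex.exp w) w :=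
    Complex.differentiableAt_exp.const_mul _
  exact (((d1.const_mul (-α i)).add (d2.const_mul (α (i + 1)))).cexp).mul
    ((d3.div (d3.const_add 1) hne).const_add _)

theorem localLog_add_period (k : ℤ) (r κ w : ℂ) :
    localLog k r κ (w + 2 * Real.pi * Complex.I) =
      localLog k r κ w + k * (2 * Real.pi * Complex.I) := by
  rw [localLog, localLog, Complex.exp_periodic w]
  ring

theorem localForm_add_period {ν : ℕ → ℤ} {r κ α : ℕ → ℂ} (i : ℕ) (w : ℂ) :
    localForm (fun i => ν i) r κ α i (w + 2 * Real.pi * Complex.I) =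
      Complex.exp (2 * Real.pi * Complex.I * (ν (i + 1) * α (i + 1) - ν i * α i)) *
        localForm (fun i => ν i) r κ α i w := by
  rw [localForm, localForm, localLog_add_period, localLog_add_period, Complex.exp_periodic w,
    ← mul_assoc (Complex.exp _), ← Complex.exp_add]
  congr 2
  ring

/-- The constant in the growth estimate for the local forms. -/
noncomputable def growthConst (K R C D : ℝ) : ℝ :=
  (2 * R + 2) * Real.exp (2 * D * K + 2 * D * (C + 1))

theorem growthConst_nonneg {C D : ℝ} (hR : 0 ≤ R) : 0 ≤ growthConst K R C D := by
  unfold growthConst; positivity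

theorem norm_log_one_add_le_one {x : ℂ} (hx : ‖x‖ ≤ 1 / 2) : ‖Complex.log (1 + x)‖ ≤ 1 :=
  (Complex.norm_log_one_add_half_le_self hx).trans (by linarith)

/-- The powers contribute exp(Re(ν α) Re w) up to a bounded factor, because the imaginary part of w
is bounded. The logarithmic derivative is bounded, and if ν = 0 it is divisible by exp w; this is
the summand `ordOf` of the weight. -/
theorem norm_localForm_le {ν : ℕ → ℤ} {r κ α : ℕ → ℂ} {C D : ℝ} (hR : 0 ≤ R)
    (hRM : R * Real.exp (-M) ≤ 1 / 2) (i : ℕ) (hν : ∀ i, |ν i| ≤ 1)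
    (hr : ∀ j ∈ ({i, i + 1} : Set ℕ), ‖r j‖ ≤ R) (hκ : ∀ j ∈ ({i, i + 1} : Set ℕ), ‖κ j‖ ≤ C)
    (hα : ∀ j ∈ ({i, i + 1} : Set ℕ), ‖α j‖ ≤ D) {w : ℂ} (hw : w ∈ halfStrip M K) :
    ‖localForm (fun i => ν i) r κ α i w‖ ≤ growthConst K R C D *
      Real.exp ((weight (fun i => ν i) α (i + 1) - weight (fun i => ν i) α i) * w.re) := by
  have hC : 0 ≤ C := (norm_nonneg _).trans (hκ i (by simp))
  have hD : 0 ≤ D := (norm_nonneg _).trans (hα i (by simp))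
  have hνn : ∀ j, ‖(ν j : ℂ)‖ ≤ 1 := fun j => by
    rw [Complex.norm_intCast]; exact_mod_cast hν j
  have h2 := norm_mul_exp_le (hr (i + 1) (by simp)) hRM hw.1
  have hterm : ∀ j ∈ ({i, i + 1} : Set ℕ),
      ‖α j * (κ j + Complex.log (1 + r j * Complex.exp w))‖ ≤ D * (C + 1) := fun j hj => by
    rw [norm_mul]
    have := norm_log_one_add_le_one (norm_mul_exp_le (hr j hj) hRM hw.1)
    exact mul_le_mul (hα j hj) ((norm_add_le _ _).trans (add_le_add (hκ j hj) this))
      (norm_nonneg _) hD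
  have him : ∀ j ∈ ({i, i + 1} : Set ℕ), |((ν j : ℂ) * α j).im * w.im| ≤ D * K := fun j hj => by
    rw [abs_mul]
    refine mul_le_mul ((Complex.abs_im_le_norm _).trans ?_) hw.2 (abs_nonneg _) hD
    rw [norm_mul]
    exact (mul_le_mul (hνn j) (hα j hj) (norm_nonneg _) zero_le_one).trans (by rw [one_mul])
  have hexp : ‖Complex.exp (-α i * localLog (ν i) (r i) (κ i) w +
      α (i + 1) * localLog (ν (i + 1)) (r (i + 1)) (κ (i + 1)) w)‖ ≤
      Real.exp ((((ν (i + 1) : ℂ) * α (i + 1)).re - ((ν i : ℂ) * α i).re) * w.re) *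
        Real.exp (2 * D * K + 2 * D * (C + 1)) := by
    rw [Complex.norm_exp, ← Real.exp_add]
    refine Real.exp_le_exp.2 ?_
    have e : -α i * localLog (ν i) (r i) (κ i) w +
      α (i + 1) * localLog (ν (i + 1)) (r (i + 1)) (κ (i + 1)) w =
      (ν (i + 1) * α (i + 1)) * w - (ν i * α i) * w +
      (α (i + 1) * (κ (i + 1) + Complex.log (1 + r (i + 1) * Complex.exp w)) -
        α i * (κ i + Complex.log (1 + r i * Complex.exp w))) := by
      simp only [localLog]; ring
    rw [e, Complex.add_re, Complex.sub_re, Complex.mul_re _ w, Complex.mul_re _ w, Complex.sub_re]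
    have t1 := (abs_le.1 ((Complex.abs_re_le_norm _).trans (hterm i (by simp)))).1
    have t2 := (abs_le.1 ((Complex.abs_re_le_norm _).trans (hterm (i + 1) (by simp)))).2
    have t3 := (abs_le.1 (him i (by simp))).2
    have t4 := (abs_le.1 (him (i + 1) (by simp))).1
    linarith
  have hfac : ‖(ν (i + 1) : ℂ) + r (i + 1) * Complex.exp w / (1 + r (i + 1) * Complex.exp w)‖ ≤
      (2 * R + 2) * Real.exp (ordOf (ν (i + 1)) * w.re) := by
    have hden : 1 / 2 ≤ ‖1 + r (i + 1) * Complex.exp w‖ := by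
      have := norm_sub_norm_le (1 : ℂ) (-(r (i + 1) * Complex.exp w))
      rw [norm_neg, norm_one, sub_neg_eq_add] at this
      linarith
    have hq : ‖r (i + 1) * Complex.exp w / (1 + r (i + 1) * Complex.exp w)‖ ≤
        2 * ‖r (i + 1) * Complex.exp w‖ := by
      rw [norm_div, div_le_iff₀ (by linarith)]
      nlinarith [norm_nonneg (r (i + 1) * Complex.exp w)]
    by_cases h0 : (ν (i + 1) : ℂ) = 0
    · rw [h0, zero_add, ordOf, if_pos rfl, one_mul]
      refine hq.trans ?_
      rw [norm_mul, Complex.norm_exp, ← mul_assoc]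
      refine mul_le_mul_of_nonneg_right ?_ (Real.exp_pos _).le
      linarith [hr (i + 1) (by simp)]
    · rw [ordOf, if_neg h0, zero_mul, Real.exp_zero, mul_one]
      refine (norm_add_le _ _).trans ?_
      linarith [hνn (i + 1)]
  rw [localForm, norm_mul, weight_succ_sub]
  refine (mul_le_mul hexp hfac (norm_nonneg _) (by positivity)).trans_eq ?_
  rw [add_mul _ (ordOf _), Real.exp_add (_ * w.re) (ordOf _ * w.re), growthConst]
  ring

end

open Classical in
/-- The order of `γ - z` with respect to the coordinate `(γ - y) ^ η`, where `η = 1` if the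
endpoint is `y` and `η = -1` if it is `∞`. -/
noncomputable def endNu (η : ℤ) (y z : ℂ) : ℤ := if z = y then η else if η = 1 then 0 else -1

/-- The coefficient of the coordinate `u` in `γ - z`, up to a factor and a power of `u`. -/
noncomputable def endCoeff (η : ℤ) (y z : ℂ) : ℂ := if η = 1 then (y - z)⁻¹ else y - z

/-- Put u = (x - y)^η, so du/u = η dx/(x - y). For η = 1 and z ≠ y one has x - z = (y - z)(1 + u/(y
- z)); for z = y the convention 0⁻¹ = 0 correctly removes the correction term. For η = -1 one has x
- z = u⁻¹(1 + (y - z)u). The identity is the logarithmic derivative of these. -/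
theorem logDeriv_eq_of_endpoint {η : ℤ} (hη : η = 1 ∨ η = -1) {y z x ℓ : ℂ} (hy : x ≠ y)
    (hz : x ≠ z) (hℓ : Complex.exp ℓ = (x - y) ^ η)
    (h1 : 1 + endCoeff η y z * Complex.exp ℓ ≠ 0) :
    (x - z)⁻¹ = (endNu η y z + endCoeff η y z * Complex.exp ℓ /
      (1 + endCoeff η y z * Complex.exp ℓ)) * (η * (x - y)⁻¹) := by
  have hy' := sub_ne_zero.2 hy
  have hz' := sub_ne_zero.2 hz
  rcases hη with rfl | rfl
  · simp only [endNu, endCoeff, if_true, zpow_one] at *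
    rw [hℓ] at *
    by_cases hzy : z = y
    · subst hzy
      simp
    · have hyz : y - z ≠ 0 := sub_ne_zero.2 (Ne.symm hzy)
      have e : 1 + (y - z)⁻¹ * (x - y) = (x - z) / (y - z) := by field_simp; ring
      simp only [hzy, if_false, e]
      field_simp
      simp
  · have hne : ¬ ((-1 : ℤ) = 1) := by norm_num
    simp only [endNu, endCoeff, hne, if_false, zpow_neg, zpow_one, ite_self] at *
    rw [hℓ] at *
    have e : 1 + (y - z) * (x - y)⁻¹ = (x - z) / (x - y) := by field_simp; ring
    rw [e]
    push_cast
    field_simp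
    ring

/-- `ℓ` is a logarithmic coordinate of the path at the end described by the filter `𝓕`: it is a
continuous logarithm of `(γ - y) ^ η` with `η = 1` if the endpoint is `y` and `η = -1` if it is
`∞`. -/
structure IsEndChart (S : Set ℝ) (γ : ℝ → ℂ) (𝓕 : Filter ℝ) (y : ℂ) (η : ℤ) (K : ℝ)
    (ℓ : ℝ → ℂ) : Prop where
  eta : η = 1 ∨ η = -1
  basis : ∀ U ∈ 𝓕, ∃ I ∈ 𝓕, I ⊆ U ∧ I.OrdConnected ∧ I ⊆ Ioo 0 1
  ne : ∀ t ∈ Ioo (0 : ℝ) 1, γ t ≠ y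
  continuousOn : ContinuousOn ℓ (Ioo 0 1)
  hasDerivAt : ∀ t ∈ Ioo (0 : ℝ) 1, t ∉ S → HasDerivAt ℓ (η * (γ t - y)⁻¹ * deriv γ t) t
  exp_eq : ∀ t ∈ Ioo (0 : ℝ) 1, Complex.exp (ℓ t) = (γ t - y) ^ η
  tendsto_re : Tendsto (fun t => (ℓ t).re) 𝓕 atBot
  im_le : ∀ᶠ t in 𝓕, |(ℓ t).im| ≤ K

/-- The constant in the local expression of `logInt` normalized at `c`. -/
noncomputable def endConst (γ : ℝ → ℂ) (η : ℤ) (y : ℂ) (ℓ : ℝ → ℂ) (c : ℝ) (z : ℂ) : ℂ :=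
  logInt γ z c - endNu η y z * ℓ c - Complex.log (1 + endCoeff η y z * Complex.exp (ℓ c))

/-- The local beta forms of the path at an end. -/
noncomputable def endForm (γ : ℝ → ℂ) (η : ℤ) (y : ℂ) (ℓ : ℝ → ℂ) (c : ℝ) (z α : ℕ → ℂ) :
    ℕ → ℂ → ℂ :=
  localForm (fun i => endNu η y (z i)) (fun i => endCoeff η y (z i))
    (fun i => endConst γ η y ℓ c (z i)) α

section

variable {S : Set ℝ} {γ : ℝ → ℂ} {𝓕 : Filter ℝ} {y : ℂ} {η : ℤ} {K M R : ℝ} {ℓ : ℝ → ℂ}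

theorem IsEndChart.mono (h : IsEndChart S γ 𝓕 y η K ℓ) {K' : ℝ} (hK : K ≤ K') :
    IsEndChart S γ 𝓕 y η K' ℓ :=
  { h with im_le := h.im_le.mono fun _ ht => ht.trans hK }

theorem IsEndChart.nonneg [𝓕.NeBot] (h : IsEndChart S γ 𝓕 y η K ℓ) : 0 ≤ K := by
  obtain ⟨t, ht⟩ := h.im_le.exists
  exact (abs_nonneg _).trans ht

theorem IsEndChart.tendsto_exp (h : IsEndChart S γ 𝓕 y η K ℓ) {δ : ℝ} (hδ : 0 < δ) (C : ℝ) :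
    Tendsto (fun t => C * Real.exp (δ * (ℓ t).re)) 𝓕 (𝓝 0) := by
  have := (Real.tendsto_exp_atBot.comp (h.tendsto_re.const_mul_atBot hδ)).const_mul C
  simpa using this

theorem IsEndChart.exists_region (h : IsEndChart S γ 𝓕 y η K ℓ) (M : ℝ) :
    ∃ I ∈ 𝓕, I.OrdConnected ∧ I ⊆ Ioo 0 1 ∧ ∀ t ∈ I, ℓ t ∈ halfStrip M K := by
  obtain ⟨I, hI, hIU, hIc, hI01⟩ := h.basis {t | ℓ t ∈ halfStrip M K}
    ((h.tendsto_re.eventually (eventually_lt_atBot (-M))).and h.im_le)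
  exact ⟨I, hI, hIc, hI01, hIU⟩

theorem abs_endNu_le (h : η = 1 ∨ η = -1) (y z : ℂ) : |endNu η y z| ≤ 1 := by
  unfold endNu
  rcases h with rfl | rfl <;> split_ifs <;> simp

/-- Both sides have the same derivative off a countable set, and `endConst` is chosen to make them
agree at c. -/
theorem logInt_eq_localLog (hγ : IsRegularPath S γ) (h : IsEndChart S γ 𝓕 y η K ℓ) {z : ℂ}
    (hz : ∀ t ∈ Ioo (0 : ℝ) 1, γ t ≠ z) {I : Set ℝ} (hI : I.OrdConnected) (hI01 : I ⊆ Ioo 0 1)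
    (hs : ∀ t ∈ I, ‖endCoeff η y z * Complex.exp (ℓ t)‖ ≤ 1 / 2) {c t : ℝ} (hc : c ∈ I)
    (ht : t ∈ I) :
    logInt γ z t = localLog (endNu η y z) (endCoeff η y z) (endConst γ η y ℓ c z) (ℓ t) := by
  have hsub : uIcc c t ⊆ I := hI.uIcc_subset hc ht
  have hlog : ∀ s ∈ I, ∀ κ, HasDerivAt (localLog (endNu η y z) (endCoeff η y z) κ)
      (endNu η y z + endCoeff η y z * Complex.exp (ℓ s) /
      (1 + endCoeff η y z * Complex.exp (ℓ s))) (ℓ s) := fun s hsI κ =>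
    hasDerivAt_localLog (hs s hsI)
  have key := integral_eq_of_hasDerivAt_off_countable
    (fun s => logInt γ z s - localLog (endNu η y z) (endCoeff η y z)
      (endConst γ η y ℓ c z) (ℓ s)) (fun _ => 0) (a := c) (b := t) hγ.countable ?_ ?_
      intervalIntegrable_const
  · rw [intervalIntegral.integral_zero] at key
    have e : logInt γ z c = localLog (endNu η y z) (endCoeff η y z) (endConst γ η y ℓ c z)
        (ℓ c) := by
      rw [localLog, endConst]; ring
    rw [e, sub_self, sub_zero] at key
    exact sub_eq_zero.1 key.symm
  · refine ((continuousOn_logInt hγ hz).mono (hsub.trans hI01)).sub fun s hsI => ?_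
    exact (hlog s (hsub hsI) _).continuousAt.comp_continuousWithinAt
      ((h.continuousOn.mono (hsub.trans hI01)) s hsI)
  · rintro s ⟨hsI, hsS⟩
    have hsI' : s ∈ I := hsub (Ioo_subset_Icc_self hsI)
    have hs01 := hI01 hsI'
    have h1 := (hasDerivAt_logInt hγ hz hs01 hsS).sub
      ((hlog s hsI' (endConst γ η y ℓ c z)).comp s (h.hasDerivAt s hs01 hsS))
    refine h1.congr_deriv ?_
    rw [logDeriv_eq_of_endpoint h.eta (h.ne s hs01) (hz s hs01) (h.exp_eq s hs01)
      (Complex.slitPlane_ne_zero (one_add_mem_slitPlane (hs s hsI')))]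
    ring

theorem formCoeff_eq_endForm (hγ : IsRegularPath S γ) (h : IsEndChart S γ 𝓕 y η K ℓ)
    {z : ℕ → ℂ} (hz : ∀ i, ∀ t ∈ Ioo (0 : ℝ) 1, γ t ≠ z i) {I : Set ℝ} (hI : I.OrdConnected)
    (hI01 : I ⊆ Ioo 0 1) (hIM : ∀ t ∈ I, ℓ t ∈ halfStrip M K)
    (hR : ∀ i, ‖endCoeff η y (z i)‖ ≤ R) (hRM : R * Real.exp (-M) ≤ 1 / 2) (α : ℕ → ℂ)
    {c t : ℝ} (hc : c ∈ I) (ht : t ∈ I) (i : ℕ) :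
    formCoeff γ z α i t = endForm γ η y ℓ c z α i (ℓ t) * (η * (γ t - y)⁻¹) := by
  have hs : ∀ i, ∀ t ∈ I, ‖endCoeff η y (z i) * Complex.exp (ℓ t)‖ ≤ 1 / 2 := fun i t ht =>
    norm_mul_exp_le (hR i) hRM (hIM t ht).1
  rw [formCoeff, endForm, localForm, logInt_eq_localLog hγ h (hz i) hI hI01 (hs i) hc ht,
    logInt_eq_localLog hγ h (hz (i + 1)) hI hI01 (hs (i + 1)) hc ht,
    logDeriv_eq_of_endpoint h.eta (h.ne t (hI01 ht)) (hz (i + 1) t (hI01 ht))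
      (h.exp_eq t (hI01 ht))
      (Complex.slitPlane_ne_zero (one_add_mem_slitPlane (hs (i + 1) t ht)))]
  ring

theorem differentiableOn_endForm {z : ℕ → ℂ} (hR : ∀ i, ‖endCoeff η y (z i)‖ ≤ R)
    (hRM : R * Real.exp (-M) ≤ 1 / 2) (α : ℕ → ℂ) (c : ℝ) (i : ℕ) :
    DifferentiableOn ℂ (endForm γ η y ℓ c z α i) (leftHalfPlane M) :=
  differentiableOn_localForm hR hRM i

/-- Near an end the forms are pulled back along ℓ from holomorphic forms on a half plane, so only
the endpoints of ℓ matter. This is what makes a path of infinite length tractable. -/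
theorem betaInt_eq_planeInt (hγ : IsRegularPath S γ) (h : IsEndChart S γ 𝓕 y η K ℓ)
    {z : ℕ → ℂ} (hz : ∀ i, ∀ t ∈ Ioo (0 : ℝ) 1, γ t ≠ z i) {I : Set ℝ} (hI : I.OrdConnected)
    (hI01 : I ⊆ Ioo 0 1) (hIM : ∀ t ∈ I, ℓ t ∈ halfStrip M K)
    (hR : ∀ i, ‖endCoeff η y (z i)‖ ≤ R) (hRM : R * Real.exp (-M) ≤ 1 / 2) (α : ℕ → ℂ)
    {c a b : ℝ} (hc : c ∈ I) (ha : a ∈ I) (hb : b ∈ I) (k m : ℕ) :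
    betaInt γ z α k m a b =
      planeInt (leftHalfPlane M) (fun i => endForm γ η y ℓ c z α (i + k)) m (ℓ a) (ℓ b) := by
  have hsub := hI.uIcc_subset ha hb
  refine iterInt_eq_planeInt (convex_leftHalfPlane M) (isOpen_leftHalfPlane M)
    (fun i => differentiableOn_endForm hR hRM α c (i + k)) hγ.countable
    (fun i => isDensity_form hγ hz α (i + k)) m (hI01 ha) (hI01 hb) h.continuousOn h.hasDerivAt
    (fun t ht => (hIM t (hsub ht)).1) fun i _ t ht => ?_
  rw [formCoeff_eq_endForm hγ h hz hI hI01 hIM hR hRM α hc (hsub ht)]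
  ring

theorem norm_endForm_le {z α : ℕ → ℂ} {C D : ℝ} (h : η = 1 ∨ η = -1) (hR0 : 0 ≤ R)
    (hRM : R * Real.exp (-M) ≤ 1 / 2) (hR : ∀ i, ‖endCoeff η y (z i)‖ ≤ R) {c : ℝ}
    (hC : ∀ i, ‖endConst γ η y ℓ c (z i)‖ ≤ C) (hD : ∀ i, ‖α i‖ ≤ D) (i : ℕ) {w : ℂ}
    (hw : w ∈ halfStrip M K) :
    ‖endForm γ η y ℓ c z α i w‖ ≤ growthConst K R C D *
      Real.exp ((weight (fun i => endNu η y (z i)) α (i + 1) -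
        weight (fun i => endNu η y (z i)) α i) * w.re) :=
  norm_localForm_le hR0 hRM i (fun i => abs_endNu_le h y (z i)) (fun j _ => hR j)
    (fun j _ => hC j) (fun j _ => hD j) hw

theorem exists_halfPlane_bound (R : ℝ) : ∃ M : ℝ, 0 ≤ M ∧ R * Real.exp (-M) ≤ 1 / 2 := by
  have h : Tendsto (fun M : ℝ => R * Real.exp (-M)) atTop (𝓝 (R * 0)) :=
    (Real.tendsto_exp_neg_atTop_nhds_zero).const_mul R
  rw [mul_zero] at h
  obtain ⟨M, h1, h2⟩ := ((eventually_ge_atTop 0).and (h.eventually_lt_const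
    (show (0 : ℝ) < 1 / 2 by norm_num))).exists
  exact ⟨M, h1, h2.le⟩

end

/-! ### Continuous convergence of the iterated integrals at the ends of the path -/

section

variable {Θ : Type*} [TopologicalSpace Θ]

/-- A joint limit in index and parameter contains both the continuity of the limit function and
local uniformity. A uniform Cauchy estimate suffices: all nearby values are compared with the single
value f a₀ θ₀, where a₀ is fixed far out. -/
theorem exists_tendsto_of_uniform_cauchy {ι : Type*} {𝓕 : Filter ι} [𝓕.NeBot] {f : ι → Θ → ℂ}
    {θ₀ : Θ} {e : ι → ℝ} (he : Tendsto e 𝓕 (𝓝 0)) {J : Set ι} (hJ : J ∈ 𝓕) {V : Set Θ}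
    (hV : V ∈ 𝓝 θ₀) (hf : ∀ θ ∈ V, ∀ a ∈ J, ∀ b ∈ J, ‖f a θ - f b θ‖ ≤ max (e a) (e b))
    (hc : ∀ a ∈ J, ContinuousAt (f a) θ₀) :
    ∃ y, Tendsto (fun x : ι × Θ => f x.1 x.2) (𝓕 ×ˢ 𝓝 θ₀) (𝓝 y) := by
  rw [← cauchy_map_iff_exists_tendsto, Metric.cauchy_iff]
  refine ⟨inferInstance, fun ε hε => ?_⟩
  have hε4 : 0 < ε / 4 := by linarith
  have hJ' : J ∩ {a | e a < ε / 4} ∈ 𝓕 := inter_mem hJ (he.eventually_lt_const hε4)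
  obtain ⟨a₀, ha₀, ha₀e⟩ := Filter.nonempty_of_mem hJ'
  have hV' : V ∩ {θ | dist (f a₀ θ) (f a₀ θ₀) < ε / 4} ∈ 𝓝 θ₀ :=
    inter_mem hV (hc a₀ ha₀ (Metric.ball_mem_nhds _ hε4))
  have key : ∀ x ∈ (J ∩ {a | e a < ε / 4}) ×ˢ (V ∩ {θ | dist (f a₀ θ) (f a₀ θ₀) < ε / 4}),
      dist (f x.1 x.2) (f a₀ θ₀) < ε / 2 := by
    rintro ⟨a, θ⟩ ⟨⟨haJ, hae⟩, hθV, hθ⟩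
    have h1 := hf θ hθV a haJ a₀ ha₀
    rw [← dist_eq_norm] at h1
    have h2 : max (e a) (e a₀) < ε / 4 := max_lt hae ha₀e
    have h3 : dist (f a₀ θ) (f a₀ θ₀) < ε / 4 := hθ
    have := dist_triangle (f a θ) (f a₀ θ) (f a₀ θ₀)
    simp only
    linarith
  refine ⟨_, image_mem_map (prod_mem_prod hJ' hV'), ?_⟩
  rintro _ ⟨x, hx, rfl⟩ _ ⟨x', hx', rfl⟩
  have h1 := key x hx
  have h2 := key x' hx'
  have := dist_triangle_right (f x.1 x.2) (f x'.1 x'.2) (f a₀ θ₀)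
  linarith

/-- Local uniformity conditions on a family of beta integrals at an end of the path. -/
structure IsEndFamily (γ : ℝ → ℂ) (η : ℤ) (y : ℂ) (z α : Θ → ℕ → ℂ) (ν : ℕ → ℤ) (θ₀ : Θ) :
    Prop where
  avoids : ∀ᶠ θ in 𝓝 θ₀, ∀ i, ∀ t ∈ Ioo (0 : ℝ) 1, γ t ≠ z θ i
  nu_eq : ∀ᶠ θ in 𝓝 θ₀, ∀ i, endNu η y (z θ i) = ν i
  coeff_le : ∃ R, ∀ᶠ θ in 𝓝 θ₀, ∀ i, ‖endCoeff η y (z θ i)‖ ≤ R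
  log_le : ∀ c ∈ Ioo (0 : ℝ) 1, ∃ C, ∀ᶠ θ in 𝓝 θ₀, ∀ i, ‖logInt γ (z θ i) c‖ ≤ C
  exps_le : ∃ D, ∀ᶠ θ in 𝓝 θ₀, ∀ i, ‖α θ i‖ ≤ D
  continuousAt : ∀ a ∈ Ioo (0 : ℝ) 1, ∀ b ∈ Ioo (0 : ℝ) 1, ∀ k m,
    ContinuousAt (fun θ => betaInt γ (z θ) (α θ) k m a b) θ₀

variable {S : Set ℝ} {γ : ℝ → ℂ} {𝓕 : Filter ℝ} [𝓕.NeBot] {y : ℂ} {η : ℤ} {K : ℝ} {ℓ : ℝ → ℂ}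
  {z α : Θ → ℕ → ℂ} {ν : ℕ → ℤ} {θ₀ : Θ}

/-- One half plane, one base point c near the end and one constant A serve all parameters near θ₀,
so that the strip estimates become locally uniform. -/
theorem IsEndFamily.exists_bounds (h : IsEndChart S γ 𝓕 y η K ℓ)
    (hF : IsEndFamily γ η y z α ν θ₀) (K' : ℝ) :
    ∃ M R : ℝ, 0 ≤ M ∧ R * Real.exp (-M) ≤ 1 / 2 ∧
      ∃ I ∈ 𝓕, I.OrdConnected ∧ I ⊆ Ioo 0 1 ∧ (∀ t ∈ I, ℓ t ∈ halfStrip M K) ∧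
      ∃ c ∈ I, ∃ A : ℝ, 0 ≤ A ∧ ∀ᶠ θ in 𝓝 θ₀, (∀ i, ∀ t ∈ Ioo (0 : ℝ) 1, γ t ≠ z θ i) ∧
        (∀ i, ‖endCoeff η y (z θ i)‖ ≤ R) ∧
        ∀ i, ∀ v ∈ halfStrip M K', ‖endForm γ η y ℓ c (z θ) (α θ) i v‖ ≤ A * Real.exp
          ((weight (fun i => ν i) (α θ) (i + 1) - weight (fun i => ν i) (α θ) i) * v.re) := by
  obtain ⟨R, hR⟩ := hF.coeff_le
  obtain ⟨M, hM, hRM⟩ := exists_halfPlane_bound R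
  obtain ⟨I, hI, hIc, hI01, hIM⟩ := h.exists_region M
  obtain ⟨c, hc⟩ := Filter.nonempty_of_mem hI
  obtain ⟨C, hC⟩ := hF.log_le c (hI01 hc)
  obtain ⟨D, hD⟩ := hF.exps_le
  have hR0 : 0 ≤ R := by
    obtain ⟨θ, hθ⟩ := hR.exists
    exact (norm_nonneg _).trans (hθ 0)
  refine ⟨M, R, hM, hRM, I, hI, hIc, hI01, hIM, c, hc,
    growthConst K' R (C + ‖ℓ c‖ + 1) D, growthConst_nonneg hR0, ?_⟩
  filter_upwards [hF.avoids, hF.nu_eq, hR, hC, hD] with θ h1 h2 h3 h4 h5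
  refine ⟨h1, h3, fun i v hv => ?_⟩
  have h6 : ∀ i, ‖endConst γ η y ℓ c (z θ i)‖ ≤ C + ‖ℓ c‖ + 1 := fun i => by
    refine (norm_sub_le _ _).trans (add_le_add ((norm_sub_le _ _).trans
      (add_le_add (h4 i) ?_)) ?_)
    · rw [norm_mul, Complex.norm_intCast]
      refine (mul_le_mul_of_nonneg_right ?_ (norm_nonneg _)).trans_eq (one_mul _)
      exact_mod_cast abs_endNu_le h.eta y (z θ i)
    · exact norm_log_one_add_le_one (norm_mul_exp_le (h3 i) hRM (hIM c hc).1)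
  have := norm_endForm_le h.eta hR0 hRM h3 h6 h5 i hv
  simpa only [h2] using this

theorem mul_exp_max {C δ x x' : ℝ} (hC : 0 ≤ C) (hδ : 0 ≤ δ) : C * Real.exp (δ * max x x') =
    max (C * Real.exp (δ * x)) (C * Real.exp (δ * x')) := by
  rw [mul_max_of_nonneg _ _ hδ, Real.exp_monotone.map_max, mul_max_of_nonneg _ _ hC]

/-- Convergence at the lower end of the path. -/
theorem IsEndFamily.exists_tendsto_left (hγ : IsRegularPath S γ)
    (h : IsEndChart S γ 𝓕 y η K ℓ) (hF : IsEndFamily γ η y z α ν θ₀) {m : ℕ}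
    (hw : ∃ δ > 0, ∀ᶠ θ in 𝓝 θ₀, ∀ k, 1 ≤ k → k ≤ m → 2 * δ ≤ weight (fun i => ν i) (α θ) k)
    {c' : ℝ} (hc' : c' ∈ Ioo (0 : ℝ) 1) {m' : ℕ} (hm' : m' ≤ m) :
    ∃ w, Tendsto (fun x : ℝ × Θ => betaInt γ (z x.2) (α x.2) 0 m' x.1 c') (𝓕 ×ˢ 𝓝 θ₀) (𝓝 w) := by
  obtain ⟨M, R, hM, hRM, I, hI, hIc, hI01, hIM, c, hc, A, hA, hev⟩ := hF.exists_bounds h K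
  obtain ⟨δ, hδ, hδw⟩ := hw
  have hK := h.nonneg
  -- The Cauchy estimate is available only for a base point c inside the chart. Path composition
  -- then moves the base point to c'.
  have hhead : ∀ j ≤ m', ∃ w, Tendsto (fun x : ℝ × Θ => betaInt γ (z x.2) (α x.2) 0 j x.1 c)
      (𝓕 ×ˢ 𝓝 θ₀) (𝓝 w) := by
    intro j hj
    have hJ : I ∩ {a | (ℓ a).re ≤ (ℓ c).re} ∈ 𝓕 :=
      inter_mem hI (h.tendsto_re.eventually (eventually_le_atBot _))
    refine exists_tendsto_of_uniform_cauchy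
      (f := fun a θ => betaInt γ (z θ) (α θ) 0 j a c)
      (h.tendsto_exp hδ (j * (A * (2 * K + δ⁻¹)) ^ j))
      hJ (hev.and hδw) (fun θ hθ a ha b hb => ?_) fun a ha =>
        hF.continuousAt a (hI01 ha.1) c (hI01 hc) 0 j
    obtain ⟨⟨h1, h2, h3⟩, h4⟩ := hθ
    rw [betaInt_eq_planeInt hγ h h1 hIc hI01 hIM h2 hRM (α θ) hc ha.1 hc,
      betaInt_eq_planeInt hγ h h1 hIc hI01 hIM h2 hRM (α θ) hc hb.1 hc,
      ← mul_exp_max (by positivity) hδ.le, max_comm]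
    exact norm_planeInt_sub_le_left hA hK hδ
      (fun i => differentiableOn_endForm h2 hRM (α θ) c i)
      (fun i _ v hv => h3 i v hv) (weight_zero _ _)
      (fun k hk hkj => h4 k hk (hkj.trans (hj.trans hm'))) (hIM b hb.1) (hIM a ha.1) (hIM c hc)
      hb.2 ha.2 hM
  choose! w hw using hhead
  refine ⟨∑ j ∈ Finset.range (m' + 1), w j * betaInt γ (z θ₀) (α θ₀) (j + 0) (m' - j) c c', ?_⟩
  have key : Tendsto (fun x : ℝ × Θ => ∑ j ∈ Finset.range (m' + 1),
      betaInt γ (z x.2) (α x.2) 0 j x.1 c *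
        betaInt γ (z x.2) (α x.2) (j + 0) (m' - j) c c') (𝓕 ×ˢ 𝓝 θ₀)
      (𝓝 (∑ j ∈ Finset.range (m' + 1), w j *
        betaInt γ (z θ₀) (α θ₀) (j + 0) (m' - j) c c')) := by
    refine tendsto_finsetSum _ fun j hj => (hw j (Nat.lt_succ_iff.1 (Finset.mem_range.1 hj))).mul ?_
    exact (hF.continuousAt c (hI01 hc) c' hc' (j + 0) (m' - j)).tendsto.comp tendsto_snd
  refine key.congr' ?_
  filter_upwards [prod_mem_prod hI hF.avoids] with x hx
  exact (betaInt_comp hγ hx.2 (α x.2) 0 m' (hI01 hx.1) (hI01 hc) hc').symm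

/-- Convergence at the upper end of the path. -/
theorem IsEndFamily.exists_tendsto_right (hγ : IsRegularPath S γ)
    (h : IsEndChart S γ 𝓕 y η K ℓ) (hF : IsEndFamily γ η y z α ν θ₀) {m : ℕ}
    (hw : ∃ δ > 0, ∀ᶠ θ in 𝓝 θ₀, ∀ k < m,
      2 * δ ≤ weight (fun i => ν i) (α θ) m - weight (fun i => ν i) (α θ) k)
    {c' : ℝ} (hc' : c' ∈ Ioo (0 : ℝ) 1) {k : ℕ} (hk : k ≤ m) :
    ∃ w, Tendsto (fun x : ℝ × Θ => betaInt γ (z x.2) (α x.2) k (m - k) c' x.1) (𝓕 ×ˢ 𝓝 θ₀)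
      (𝓝 w) := by
  obtain ⟨M, R, hM, hRM, I, hI, hIc, hI01, hIM, c, hc, A, hA, hev⟩ := hF.exists_bounds h K
  obtain ⟨δ, hδ, hδw⟩ := hw
  have hK := h.nonneg
  have htail : ∀ j ≤ m, ∃ w, Tendsto (fun x : ℝ × Θ =>
      betaInt γ (z x.2) (α x.2) j (m - j) c x.1) (𝓕 ×ˢ 𝓝 θ₀) (𝓝 w) := by
    intro j hj
    have hJ : I ∩ {a | (ℓ a).re ≤ (ℓ c).re} ∈ 𝓕 :=
      inter_mem hI (h.tendsto_re.eventually (eventually_le_atBot _))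
    refine exists_tendsto_of_uniform_cauchy
      (f := fun a θ => betaInt γ (z θ) (α θ) j (m - j) c a)
      (h.tendsto_exp hδ ((A * (2 * K + δ⁻¹)) ^ (m - j)))
      hJ (hev.and hδw) (fun θ hθ a ha b hb => ?_) fun a ha =>
        hF.continuousAt c (hI01 hc) a (hI01 ha.1) j (m - j)
    obtain ⟨⟨h1, h2, h3⟩, h4⟩ := hθ
    rw [betaInt_eq_planeInt hγ h h1 hIc hI01 hIM h2 hRM (α θ) hc hc ha.1,
      betaInt_eq_planeInt hγ h h1 hIc hI01 hIM h2 hRM (α θ) hc hc hb.1,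
      ← mul_exp_max (by positivity) hδ.le, max_comm]
    refine norm_planeInt_sub_le_right
      (τ := fun i => weight (fun i => ν i) (α θ) i - weight (fun i => ν i) (α θ) m) hA hK hδ hM
      (fun i => differentiableOn_endForm h2 hRM (α θ) c i)
      (fun i _ v hv => by simpa only [sub_sub_sub_cancel_right] using h3 i v hv) (sub_self _)
      (fun k hk => by have := h4 k hk; linarith) hj (hIM c hc) (hIM b hb.1) (hIM a ha.1) hb.2 ha.2
  choose! w hw using htail
  refine ⟨∑ j ∈ Finset.range (m - k + 1), betaInt γ (z θ₀) (α θ₀) k j c' c * w (j + k), ?_⟩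
  have key : Tendsto (fun x : ℝ × Θ => ∑ j ∈ Finset.range (m - k + 1),
      betaInt γ (z x.2) (α x.2) k j c' c *
        betaInt γ (z x.2) (α x.2) (j + k) (m - k - j) c x.1) (𝓕 ×ˢ 𝓝 θ₀)
      (𝓝 (∑ j ∈ Finset.range (m - k + 1),
        betaInt γ (z θ₀) (α θ₀) k j c' c * w (j + k))) := by
    refine tendsto_finsetSum _ fun j hj => Tendsto.mul ?_ ?_
    · exact (hF.continuousAt c' hc' c (hI01 hc) k j).tendsto.comp tendsto_snd
    · have := Finset.mem_range.1 hj
      rw [show m - k - j = m - (j + k) by omega]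
      exact hw (j + k) (by omega)
  refine key.congr' ?_
  filter_upwards [prod_mem_prod hI hF.avoids] with x hx
  exact (betaInt_comp hγ hx.2 (α x.2) k (m - k) hc' (hI01 hc) (hI01 hx.1)).symm

end

/-! ### Vanishing of boundary terms -/

section

variable {Θ : Type*} [TopologicalSpace Θ] {S : Set ℝ} {γ : ℝ → ℂ} {𝓕 : Filter ℝ}
  {y : ℂ} {η : ℤ} {K : ℝ} {ℓ : ℝ → ℂ} {z α : Θ → ℕ → ℂ} {ν : ℕ → ℤ} {θ₀ : Θ}

theorem norm_mul_formCoeff_le (hγ : IsRegularPath S γ) (h : IsEndChart S γ 𝓕 y η K ℓ)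
    {z : ℕ → ℂ} (hz : ∀ i, ∀ t ∈ Ioo (0 : ℝ) 1, γ t ≠ z i) {I : Set ℝ} (hI : I.OrdConnected)
    {M R B : ℝ} (hI01 : I ⊆ Ioo 0 1) (hIM : ∀ t ∈ I, ℓ t ∈ halfStrip M K)
    (hR : ∀ i, ‖endCoeff η y (z i)‖ ≤ R) (hRM : R * Real.exp (-M) ≤ 1 / 2) {α : ℕ → ℂ}
    {c t : ℝ} (hc : c ∈ I) (ht : t ∈ I) (i : ℕ) (hB : ‖endForm γ η y ℓ c z α i (ℓ t)‖ ≤ B) :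
    ‖(γ t - y) * formCoeff γ z α i t‖ ≤ B := by
  rw [formCoeff_eq_endForm hγ h hz hI hI01 hIM hR hRM α hc ht]
  have h1 := sub_ne_zero.2 (h.ne t (hI01 ht))
  have h2 : ‖(η : ℂ)‖ = 1 := by rcases h.eta with rfl | rfl <;> simp
  rw [show (γ t - y) * (endForm γ η y ℓ c z α i (ℓ t) * (η * (γ t - y)⁻¹)) =
    endForm γ η y ℓ c z α i (ℓ t) * η by field_simp, norm_mul, h2, mul_one]
  exact hB

/-- This is the boundary term of the integration by parts in the differential equation. Its first
factor is of order exp(τ 1 * Re ℓ), and the iterated integral is at most of order exp((δ - τ 1) * Re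
ℓ), where τ is the weight; so exp(δ * Re ℓ) is left. -/
theorem IsEndFamily.tendsto_boundary_left [𝓕.NeBot] (hγ : IsRegularPath S γ)
    (h : IsEndChart S γ 𝓕 y η K ℓ) (hF : IsEndFamily γ η y z α ν θ₀) {m : ℕ}
    (hw : ∃ δ > 0, ∀ᶠ θ in 𝓝 θ₀, ∀ k, 1 ≤ k → k ≤ m → 2 * δ ≤ weight (fun i => ν i) (α θ) k)
    {c' : ℝ} (hc' : c' ∈ Ioo (0 : ℝ) 1) {j : ℕ} (hj : j + 1 ≤ m) :
    Tendsto (fun a => (γ a - y) * formCoeff γ (z θ₀) (α θ₀) 0 a *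
      betaInt γ (z θ₀) (α θ₀) 1 j a c') 𝓕 (𝓝 0) := by
  obtain ⟨M, R, hM, hRM, I, hI, hIc, hI01, hIM, c, hc, A, hA, hev⟩ := hF.exists_bounds h K
  obtain ⟨δ, hδ, hδw⟩ := hw
  have hK := h.nonneg
  obtain ⟨h1, h2, h3⟩ := hev.self_of_nhds
  have h4 := hδw.self_of_nhds
  have hsmall : ∀ i ≤ j, Tendsto (fun a => (γ a - y) * formCoeff γ (z θ₀) (α θ₀) 0 a *
      betaInt γ (z θ₀) (α θ₀) 1 i a c) 𝓕 (𝓝 0) := by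
    intro i hi
    refine squeeze_zero_norm' ?_ (h.tendsto_exp hδ (A * (A * (2 * K + δ⁻¹)) ^ i))
    filter_upwards [hI, h.tendsto_re.eventually (eventually_le_atBot (ℓ c).re)] with a ha hac
    rw [norm_mul, betaInt_eq_planeInt hγ h h1 hIc hI01 hIM h2 hRM (α θ₀) hc ha hc]
    have e1 := norm_mul_formCoeff_le hγ h h1 hIc hI01 hIM h2 hRM hc ha 0
      (h3 0 (ℓ a) (hIM a ha))
    rw [weight_zero, sub_zero, zero_add] at e1
    have e2 := norm_planeInt_shift_le_left (m := m) hA hK hδ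
      (fun i => differentiableOn_endForm h2 hRM (α θ₀) c i)
      (fun i _ v hv => h3 i v hv) h4 le_rfl (j := i) (by omega) (hIM a ha) (hIM c hc) hac hM
    refine (mul_le_mul_of_nonneg_right e1 (norm_nonneg _)).trans ?_
    rw [mul_assoc, mul_assoc]
    exact mul_le_mul_of_nonneg_left e2 hA
  have key : Tendsto (fun a => ∑ i ∈ Finset.range (j + 1), (γ a - y) *
      formCoeff γ (z θ₀) (α θ₀) 0 a * betaInt γ (z θ₀) (α θ₀) 1 i a c *
        betaInt γ (z θ₀) (α θ₀) (i + 1) (j - i) c c') 𝓕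
      (𝓝 (∑ i ∈ Finset.range (j + 1), 0 * betaInt γ (z θ₀) (α θ₀) (i + 1) (j - i) c c')) :=
    tendsto_finsetSum _ fun i hi =>
      (hsmall i (Nat.lt_succ_iff.1 (Finset.mem_range.1 hi))).mul_const _
  simp only [zero_mul, Finset.sum_const_zero] at key
  refine key.congr' ?_
  filter_upwards [hI] with a ha
  rw [betaInt_comp hγ h1 (α θ₀) 1 j (hI01 ha) (hI01 hc) hc', Finset.mul_sum]
  exact Finset.sum_congr rfl fun i _ => by ring

/-- The growth τ (m+1) - τ m of the last form and the growth τ m - τ (m+1) + δ of the integral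
before it add up to δ. -/
theorem IsEndFamily.tendsto_boundary_right [𝓕.NeBot] (hγ : IsRegularPath S γ)
    (h : IsEndChart S γ 𝓕 y η K ℓ) (hF : IsEndFamily γ η y z α ν θ₀) {m : ℕ}
    (hw : ∃ δ > 0, ∀ᶠ θ in 𝓝 θ₀, ∀ k < m + 1,
      2 * δ ≤ weight (fun i => ν i) (α θ) (m + 1) - weight (fun i => ν i) (α θ) k)
    {c' : ℝ} (hc' : c' ∈ Ioo (0 : ℝ) 1) {k : ℕ} (hk : k ≤ m) :
    Tendsto (fun b => (γ b - y) * formCoeff γ (z θ₀) (α θ₀) m b *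
      betaInt γ (z θ₀) (α θ₀) k (m - k) c' b) 𝓕 (𝓝 0) := by
  obtain ⟨M, R, hM, hRM, I, hI, hIc, hI01, hIM, c, hc, A, hA, hev⟩ := hF.exists_bounds h K
  obtain ⟨δ, hδ, hδw⟩ := hw
  have hK := h.nonneg
  obtain ⟨h1, h2, h3⟩ := hev.self_of_nhds
  have h4 := hδw.self_of_nhds
  have hsmall : ∀ i ≤ m, Tendsto (fun b => (γ b - y) * formCoeff γ (z θ₀) (α θ₀) m b *
      betaInt γ (z θ₀) (α θ₀) i (m - i) c b) 𝓕 (𝓝 0) := by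
    intro i hi
    refine squeeze_zero_norm' ?_ (h.tendsto_exp hδ (A * (A * (2 * K + δ⁻¹)) ^ (m - i)))
    filter_upwards [hI, h.tendsto_re.eventually (eventually_le_atBot (ℓ c).re)] with b hb hbc
    rw [norm_mul, betaInt_eq_planeInt hγ h h1 hIc hI01 hIM h2 hRM (α θ₀) hc hc hb]
    have e1 := norm_mul_formCoeff_le hγ h h1 hIc hI01 hIM h2 hRM hc hb m
      (h3 m (ℓ b) (hIM b hb))
    have e2 := norm_planeInt_shift_le_right (m := m + 1)
      (τ := fun i => weight (fun i => ν i) (α θ₀) i - weight (fun i => ν i) (α θ₀) (m + 1))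
      hA hK hδ hM (fun i => differentiableOn_endForm h2 hRM (α θ₀) c i)
      (fun i _ v hv => by simpa only [sub_sub_sub_cancel_right] using h3 i v hv)
      (fun k hk => by have := h4 k hk; linarith) (k := i) (j := m - i) (by omega)
      (hIM c hc) (hIM b hb) hbc
    rw [show m - i + i = m by omega] at e2
    refine (mul_le_mul e1 e2 (norm_nonneg _) (by positivity)).trans_eq ?_
    rw [show δ * (ℓ b).re = (weight (fun i => ν i) (α θ₀) (m + 1) -
      weight (fun i => ν i) (α θ₀) m) * (ℓ b).re + (weight (fun i => ν i) (α θ₀) m -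
      weight (fun i => ν i) (α θ₀) (m + 1) + δ) * (ℓ b).re by ring, Real.exp_add]
    ring
  have key : Tendsto (fun b => ∑ i ∈ Finset.range (m - k + 1),
      betaInt γ (z θ₀) (α θ₀) k i c' c * ((γ b - y) * formCoeff γ (z θ₀) (α θ₀) m b *
        betaInt γ (z θ₀) (α θ₀) (i + k) (m - (i + k)) c b)) 𝓕
      (𝓝 (∑ i ∈ Finset.range (m - k + 1), betaInt γ (z θ₀) (α θ₀) k i c' c * 0)) :=
    tendsto_finsetSum _ fun i hi => (hsmall (i + k) (by
      have := Finset.mem_range.1 hi; omega)).const_mul _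
  simp only [mul_zero, Finset.sum_const_zero] at key
  refine key.congr' ?_
  filter_upwards [hI] with b hb
  rw [betaInt_comp hγ h1 (α θ₀) k (m - k) hc' (hI01 hc) (hI01 hb), Finset.mul_sum]
  refine Finset.sum_congr rfl fun i hi => ?_
  rw [show m - k - i = m - (i + k) by have := Finset.mem_range.1 hi; omega]
  ring

end

/-! ### Functions that are given by entire functions on a domain -/

section

variable {E : Type*} [NormedAddCommGroup E] [NormedSpace ℂ E] {D : Set E}

/-- `f` agrees on `D` with an entire function. -/
def EntireOn (D : Set E) (f : E → ℂ) : Prop := ∃ N : E → ℂ, Differentiable ℂ N ∧ EqOn f N D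

theorem entireOn_of_differentiable {f : E → ℂ} (hf : Differentiable ℂ f) : EntireOn D f :=
  ⟨f, hf, fun _ _ => rfl⟩

theorem EntireOn.mul {f g : E → ℂ} (hf : EntireOn D f) (hg : EntireOn D g) :
    EntireOn D (fun θ => f θ * g θ) := by
  obtain ⟨N, hN, h⟩ := hf
  obtain ⟨N', hN', h'⟩ := hg
  exact ⟨fun θ => N θ * N' θ, hN.mul hN', fun θ hθ => by simp only [h hθ, h' hθ]⟩

theorem EntireOn.sum {ι : Type*} {s : Finset ι} {f : ι → E → ℂ}
    (hf : ∀ i ∈ s, EntireOn D (f i)) : EntireOn D (fun θ => ∑ i ∈ s, f i θ) := by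
  classical
  induction s using Finset.induction_on with
  | empty => exact entireOn_of_differentiable (differentiable_const (0 : ℂ))
  | insert a s ha ih =>
    obtain ⟨N, hN, h⟩ := hf a (Finset.mem_insert_self a s)
    obtain ⟨N', hN', h'⟩ := ih fun i hi => hf i (Finset.mem_insert_of_mem hi)
    refine ⟨fun θ => N θ + N' θ, hN.add hN', fun θ hθ => ?_⟩
    simp only [Finset.sum_insert ha, h hθ]
    rw [← h' hθ]

theorem EntireOn.congr {f g : E → ℂ} (hf : EntireOn D f) (h : EqOn g f D) : EntireOn D g := by
  obtain ⟨N, hN, h'⟩ := hf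
  exact ⟨N, hN, h.trans h'⟩

/-- Solving the triangular system step by step, H j acquires just one new denominator e j - 1. -/
theorem entireOn_of_recursion {H e : ℕ → E → ℂ} {c : ℕ → ℕ → E → ℂ} {m : ℕ}
    (he : ∀ i, Differentiable ℂ (e i)) (hc : ∀ k j, Differentiable ℂ (c k j))
    (h0 : ∀ θ ∈ D, H 0 θ = 1)
    (hrec : ∀ j, 1 ≤ j → j ≤ m → ∀ θ ∈ D,
      (e j θ - 1) * H j θ = ∑ k ∈ Finset.range j, H k θ * c k j θ) {j : ℕ} (hj : j ≤ m) :
    EntireOn D (fun θ => H j θ * ∏ i ∈ Finset.range m, (e (i + 1) θ - 1)) := by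
  have hup : ∀ j l, EntireOn D (fun θ => H j θ * ∏ i ∈ Finset.range l, (e (i + 1) θ - 1)) →
      ∀ l', l ≤ l' →
      EntireOn D (fun θ => H j θ * ∏ i ∈ Finset.range l', (e (i + 1) θ - 1)) := by
    intro j l h l' hl
    induction l', hl using Nat.le_induction with
    | base => exact h
    | succ l' _ ih =>
      refine (ih.mul (entireOn_of_differentiable ((he (l' + 1)).sub_const 1))).congr fun θ _ => ?_
      simp only [Finset.prod_range_succ]
      ring
  suffices h : EntireOn D (fun θ => H j θ * ∏ i ∈ Finset.range j, (e (i + 1) θ - 1)) from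
    hup j j h m hj
  induction j using Nat.strong_induction_on with
  | _ j ih =>
    rcases Nat.eq_zero_or_pos j with rfl | hpos
    · exact (entireOn_of_differentiable (differentiable_const (1 : ℂ))).congr fun θ hθ => by simp [h0 θ hθ]
    · obtain ⟨l, rfl⟩ : ∃ l, j = l + 1 := ⟨j - 1, by omega⟩
      have hs : EntireOn D (fun θ => ∑ k ∈ Finset.range (l + 1),
          (H k θ * ∏ i ∈ Finset.range l, (e (i + 1) θ - 1)) * c k (l + 1) θ) :=
        EntireOn.sum fun k hk => by
          have hk' := Finset.mem_range.1 hk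
          exact (hup k k (ih k hk' (by omega)) l (by omega)).mul (entireOn_of_differentiable (hc k (l + 1)))
      refine hs.congr fun θ hθ => ?_
      have := hrec (l + 1) hpos hj θ hθ
      simp only [Finset.prod_range_succ]
      calc H (l + 1) θ * ((∏ i ∈ Finset.range l, (e (i + 1) θ - 1)) * (e (l + 1) θ - 1))
          = (∏ i ∈ Finset.range l, (e (i + 1) θ - 1)) * ((e (l + 1) θ - 1) * H (l + 1) θ) := by
            ring
        _ = _ := by
          rw [this, Finset.mul_sum]
          exact Finset.sum_congr rfl fun k _ => by ring

end

/-! ### Monodromy at the ends of the path and meromorphic continuation -/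

/-- The period of the logarithmic coordinate. -/
noncomputable def logPeriod : ℂ := 2 * Real.pi * Complex.I

theorem logPeriod_re : logPeriod.re = 0 := by simp [logPeriod]

theorem logPeriod_im : logPeriod.im = 2 * Real.pi := by simp [logPeriod]

theorem add_logPeriod_mem_leftHalfPlane {M : ℝ} {w : ℂ} (hw : w ∈ leftHalfPlane M) :
    w + logPeriod ∈ leftHalfPlane M := by
  have : (w + logPeriod).re = w.re := by simp [logPeriod_re]
  change (w + logPeriod).re < -M
  rw [this]; exact hw

theorem add_logPeriod_mem_halfStrip {M K : ℝ} {w : ℂ} (hw : w ∈ halfStrip M K) :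
    w + logPeriod ∈ halfStrip M (K + 2 * Real.pi) := by
  refine ⟨add_logPeriod_mem_leftHalfPlane hw.1, ?_⟩
  rw [Complex.add_im, logPeriod_im]
  refine (abs_add_le _ _).trans ?_
  rw [abs_of_pos Real.two_pi_pos]
  linarith [hw.2]

theorem halfStrip_mono {M K K' : ℝ} (h : K ≤ K') : halfStrip M K ⊆ halfStrip M K' :=
  fun _ hw => ⟨hw.1, hw.2.trans h⟩

/-- The iterated integral of the local forms along a loop around the endpoint. -/
noncomputable def loopInt (γ : ℝ → ℂ) (η : ℤ) (y : ℂ) (ℓ : ℝ → ℂ) (c M : ℝ) (z α : ℕ → ℂ)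
    (k j : ℕ) : ℂ :=
  planeInt (leftHalfPlane M) (fun i => endForm γ η y ℓ c z α (i + k)) j (ℓ c) (ℓ c + logPeriod)

section

variable {E : Type*} [NormedAddCommGroup E] [NormedSpace ℂ E]
  {S : Set ℝ} {γ : ℝ → ℂ} {𝓕 : Filter ℝ} {y : ℂ} {η : ℤ} {K M R A δ : ℝ} {ℓ : ℝ → ℂ}

theorem differentiable_loopInt {z : ℕ → ℂ} (hR : ∀ i, ‖endCoeff η y (z i)‖ ≤ R)
    (hRM : R * Real.exp (-M) ≤ 1 / 2) {α : E → ℕ → ℂ} (hα : ∀ i, ContDiff ℂ 1 (fun θ => α θ i))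
    {c : ℝ} (hc : ℓ c ∈ leftHalfPlane M) (k j : ℕ) :
    Differentiable ℂ (fun θ => loopInt γ η y ℓ c M z (α θ) k j) := by
  -- The segment from `ℓ c` to `ℓ c + logPeriod` is run through for x from 1/3 to 2/3, because
  -- iterated integrals are treated only for limits inside (0,1).
  let p : ℝ → ℂ := fun x => ℓ c + logPeriod * (3 * x - 1)
  have hpre : ∀ x, (p x).re = (ℓ c).re := fun x => by
    have : ((3 : ℂ) * (x : ℂ) - 1) = ((3 * x - 1 : ℝ) : ℂ) := by push_cast; ring
    simp only [p, this, Complex.add_re, Complex.re_mul_ofReal, logPeriod_re, zero_mul, add_zero]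
  have hpH : ∀ x, p x ∈ leftHalfPlane M := fun x => by
    change (p x).re < -M
    rw [hpre]; exact hc
  have hpd : ∀ x, HasDerivAt p (3 * logPeriod) x := fun x => by
    have h1 : HasDerivAt (fun x : ℝ => (x : ℂ)) 1 x := Complex.ofRealCLM.hasDerivAt
    exact ((((h1.const_mul 3).sub_const 1).const_mul logPeriod).const_add (ℓ c)).congr_deriv
      (by ring)
  have hpc : Continuous p := by fun_prop
  have hloc : ∀ i x, ‖endCoeff η y (z i) * Complex.exp (p x)‖ ≤ 1 / 2 := fun i x =>
    norm_mul_exp_le (hR i) hRM (hpH x)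
  have hlog : ∀ i, ContinuousOn (fun x => localLog (endNu η y (z i)) (endCoeff η y (z i))
      (endConst γ η y ℓ c (z i)) (p x)) (Ioo 0 1) := fun i x _ =>
    ((hasDerivAt_localLog (hloc i x)).continuousAt.comp hpc.continuousAt).continuousWithinAt
  have hψ : ∀ i, JointC1 (univ : Set E) (fun θ x => endForm γ η y ℓ c z (α θ) i (p x)) := by
    intro i
    refine ((((jointC1_of_contDiff ((hα i).neg)).mul
      (jointC1_of_continuousOn (hlog i))).add ((jointC1_of_contDiff (hα (i + 1))).mul
      (jointC1_of_continuousOn (hlog (i + 1))))).cexp).mul (jointC1_of_continuousOn ?_)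
    have h1 : ∀ x, 1 + endCoeff η y (z (i + 1)) * Complex.exp (p x) ≠ 0 := fun x =>
      Complex.slitPlane_ne_zero (one_add_mem_slitPlane (hloc (i + 1) x))
    have h2 : Continuous fun x => endCoeff η y (z (i + 1)) * Complex.exp (p x) := by fun_prop
    exact (continuous_const.add (h2.div (continuous_const.add h2) h1)).continuousOn
  have hρ : IsDensity ∅ (fun _ => 3 * logPeriod) :=
    ⟨fun _ _ _ => continuousAt_const, fun _ _ _ _ => intervalIntegrable_const⟩
  have h13 : (1 / 3 : ℝ) ∈ Ioo (0 : ℝ) 1 := by norm_num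
  have h23 : (2 / 3 : ℝ) ∈ Ioo (0 : ℝ) 1 := by norm_num
  have key := (JointC1.iterInt hρ isOpen_univ (fun i => hψ (i + k)) j h13).differentiableOn h23
  rw [differentiableOn_univ] at key
  convert key using 2 with θ
  have e1 : p (1 / 3) = ℓ c := by simp [p]
  have e2 : p (2 / 3) = ℓ c + logPeriod := by
    simp only [p]; push_cast; ring
  rw [loopInt, ← e2, ← e1]
  refine (iterInt_eq_planeInt (convex_leftHalfPlane M) (isOpen_leftHalfPlane M)
    (fun i => differentiableOn_endForm hR hRM (α θ) c (i + k)) (S := ∅) countable_empty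
    (φ := fun i t => endForm γ η y ℓ c z (α θ) (i + k) (p t) * (3 * logPeriod))
    (fun i => hρ.continuousOn_mul (continuousOn_slice (f := fun θ x => endForm γ η y ℓ c z (α θ) (i + k) (p x))
      isOpen_univ (hψ (i + k)).1 (mem_univ θ))) j h13 h23 hpc.continuousOn (fun t _ _ => hpd t) (fun t _ => hpH t)
    fun _ _ _ _ => rfl).symm

theorem planeInt_endForm_add_period {z : ℕ → ℂ} (hR : ∀ i, ‖endCoeff η y (z i)‖ ≤ R)
    (hRM : R * Real.exp (-M) ≤ 1 / 2) (α : ℕ → ℂ) (c : ℝ) (k j : ℕ) {w₀ w : ℂ}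
    (hw₀ : w₀ ∈ leftHalfPlane M) (hw : w ∈ leftHalfPlane M) :
    planeInt (leftHalfPlane M) (fun i => endForm γ η y ℓ c z α (i + k)) j (w₀ + logPeriod)
      (w + logPeriod) = Complex.exp (logPeriod * (endNu η y (z (j + k)) * α (j + k) -
        endNu η y (z k) * α k)) *
      planeInt (leftHalfPlane M) (fun i => endForm γ η y ℓ c z α (i + k)) j w₀ w := by
  rw [planeInt_add_period (convex_leftHalfPlane M) (isOpen_leftHalfPlane M)
    (fun i => differentiableOn_endForm hR hRM α c (i + k))
    (fun w hw => add_logPeriod_mem_leftHalfPlane hw)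
    (q := fun i => Complex.exp (logPeriod * (endNu η y (z (i + k + 1)) * α (i + k + 1) -
      endNu η y (z (i + k)) * α (i + k)))) (fun i w _ => localForm_add_period (i + k) w) j hw₀ hw,
    ← Complex.exp_sum, ← Finset.mul_sum]
  congr 3
  have := Finset.sum_range_sub (fun i => (endNu η y (z (i + k)) : ℂ) * α (i + k)) j
  rw [zero_add] at this
  rw [← this]
  refine Finset.sum_congr rfl fun i _ => ?_
  rw [show i + 1 + k = i + k + 1 by omega]

/-- Monodromy relation at the lower end. -/
theorem monodromy_left [𝓕.NeBot] (hγ : IsRegularPath S γ) (h : IsEndChart S γ 𝓕 y η K ℓ)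
    {z α : ℕ → ℂ} (hz : ∀ i, ∀ t ∈ Ioo (0 : ℝ) 1, γ t ≠ z i) {I : Set ℝ} (hIF : I ∈ 𝓕)
    (hI : I.OrdConnected) (hI01 : I ⊆ Ioo 0 1) (hIM : ∀ t ∈ I, ℓ t ∈ halfStrip M K) (hM : 0 ≤ M)
    (hR : ∀ i, ‖endCoeff η y (z i)‖ ≤ R) (hRM : R * Real.exp (-M) ≤ 1 / 2)
    {c : ℝ} (hc : c ∈ I) (hA : 0 ≤ A) (hδ : 0 < δ)
    (hb : ∀ i, ∀ v ∈ halfStrip M (K + 2 * Real.pi), ‖endForm γ η y ℓ c z α i v‖ ≤ A *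
      Real.exp ((weight (fun i => endNu η y (z i)) α (i + 1) -
        weight (fun i => endNu η y (z i)) α i) * v.re)) {m : ℕ}
    (hw : ∀ k, 1 ≤ k → k ≤ m → 2 * δ ≤ weight (fun i => endNu η y (z i)) α k) {H : ℕ → ℂ}
    (hH : ∀ j ≤ m, Tendsto (fun a => betaInt γ z α 0 j a c) 𝓕 (𝓝 (H j))) {j : ℕ} (hj : j ≤ m) :
    (Complex.exp (logPeriod * (endNu η y (z j) * α j - endNu η y (z 0) * α 0)) - 1) * H j =
      ∑ k ∈ Finset.range j, H k * loopInt γ η y ℓ c M z α k (j - k) := by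
  have hK := h.nonneg
  have hK' : 0 ≤ K + 2 * Real.pi := by positivity
  have hmono : K ≤ K + 2 * Real.pi := by linarith [Real.two_pi_pos]
  set P := fun k j => planeInt (leftHalfPlane M) (fun i => endForm γ η y ℓ c z α (i + k)) j with hP
  have hdiff := fun i => differentiableOn_endForm (γ := γ) (ℓ := ℓ) hR hRM α c i
  have hlim : ∀ j ≤ m, Tendsto (fun a => P 0 j (ℓ a) (ℓ c)) 𝓕 (𝓝 (H j)) := fun j hj => by
    refine (hH j hj).congr' ?_
    filter_upwards [hIF] with a ha
    exact betaInt_eq_planeInt hγ h hz hI hI01 hIM hR hRM α hc ha hc 0 j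
  -- The limit at the end does not notice whether it is approached along ℓ a or along ℓ a + 2πi,
  -- since both stay in a common half strip. That is why the forms are estimated in the wider strip
  -- of height parameter K + 2π.
  have h1 : Tendsto (fun a => P 0 j (ℓ a + logPeriod) (ℓ c + logPeriod) -
      P 0 j (ℓ a) (ℓ c + logPeriod)) 𝓕 (𝓝 0) := by
    refine squeeze_zero_norm' ?_ (h.tendsto_exp hδ (j * (A * (2 * (K + 2 * Real.pi) + δ⁻¹)) ^ j))
    filter_upwards [hIF, h.tendsto_re.eventually (eventually_le_atBot (ℓ c).re)] with a ha hac
    have hre : ∀ w : ℂ, (w + logPeriod).re = w.re := fun w => by simp [logPeriod_re]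
    have := norm_planeInt_sub_le_left (m := j) (w₀ := ℓ a) (w₁ := ℓ a + logPeriod)
      (w := ℓ c + logPeriod) hA hK' hδ hdiff (fun i _ v hv => hb i v hv) (weight_zero _ _)
      (fun k hk hkj => hw k hk (hkj.trans hj)) (halfStrip_mono hmono (hIM a ha))
      (add_logPeriod_mem_halfStrip (hIM a ha)) (add_logPeriod_mem_halfStrip (hIM c hc))
      (by rw [hre]; exact hac) (by rw [hre, hre]; exact hac) hM
    rwa [hre, max_self] at this
  -- Translating both endpoints by the period gives the exponential factor; in the subtracted
  -- integral the stretch from ℓ c to ℓ c + 2πi is split off as a loop.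
  have h2 : ∀ᶠ a in 𝓕, P 0 j (ℓ a + logPeriod) (ℓ c + logPeriod) -
      P 0 j (ℓ a) (ℓ c + logPeriod) =
      Complex.exp (logPeriod * (endNu η y (z j) * α j - endNu η y (z 0) * α 0)) *
        P 0 j (ℓ a) (ℓ c) - ∑ k ∈ Finset.range (j + 1), P 0 k (ℓ a) (ℓ c) *
          loopInt γ η y ℓ c M z α k (j - k) := by
    filter_upwards [hIF] with a ha
    rw [hP]
    simp only
    rw [planeInt_endForm_add_period hR hRM α c 0 j (hIM a ha).1 (hIM c hc).1,
      planeInt_comp (w₀ := ℓ a) (w₁ := ℓ c) (convex_leftHalfPlane M) (isOpen_leftHalfPlane M)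
        (fun i => hdiff (i + 0)) j (hIM c hc).1 (add_logPeriod_mem_leftHalfPlane (hIM c hc).1)]
    rfl
  have h3 := tendsto_nhds_unique (h1.congr' h2) (((hlim j hj).const_mul _).sub
    (tendsto_finsetSum (Finset.range (j + 1)) fun k hk => (hlim k
      ((Nat.lt_succ_iff.1 (Finset.mem_range.1 hk)).trans hj)).mul_const
        (loopInt γ η y ℓ c M z α k (j - k))))
  rw [Finset.sum_range_succ, Nat.sub_self, loopInt, planeInt_zero, mul_one] at h3
  linear_combination -h3

/-- Monodromy relation at the upper end. -/
theorem monodromy_right [𝓕.NeBot] (hγ : IsRegularPath S γ) (h : IsEndChart S γ 𝓕 y η K ℓ)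
    {z α : ℕ → ℂ} (hz : ∀ i, ∀ t ∈ Ioo (0 : ℝ) 1, γ t ≠ z i) {I : Set ℝ} (hIF : I ∈ 𝓕)
    (hI : I.OrdConnected) (hI01 : I ⊆ Ioo 0 1) (hIM : ∀ t ∈ I, ℓ t ∈ halfStrip M K) (hM : 0 ≤ M)
    (hR : ∀ i, ‖endCoeff η y (z i)‖ ≤ R) (hRM : R * Real.exp (-M) ≤ 1 / 2)
    {c : ℝ} (hc : c ∈ I) (hA : 0 ≤ A) (hδ : 0 < δ)
    (hb : ∀ i, ∀ v ∈ halfStrip M (K + 2 * Real.pi), ‖endForm γ η y ℓ c z α i v‖ ≤ A *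
      Real.exp ((weight (fun i => endNu η y (z i)) α (i + 1) -
        weight (fun i => endNu η y (z i)) α i) * v.re)) {m : ℕ}
    (hw : ∀ k < m, 2 * δ ≤ weight (fun i => endNu η y (z i)) α m -
      weight (fun i => endNu η y (z i)) α k) {H : ℕ → ℂ}
    (hH : ∀ j ≤ m, Tendsto (fun a => betaInt γ z α j (m - j) c a) 𝓕 (𝓝 (H j))) {j : ℕ}
    (hj : j ≤ m) :
    H j = ∑ k ∈ Finset.range (m - j + 1), loopInt γ η y ℓ c M z α j k *
      (Complex.exp (logPeriod * (endNu η y (z m) * α m - endNu η y (z (k + j)) * α (k + j))) *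
        H (k + j)) := by
  have hK := h.nonneg
  have hK' : 0 ≤ K + 2 * Real.pi := by positivity
  have hmono : K ≤ K + 2 * Real.pi := by linarith [Real.two_pi_pos]
  set P := fun k j => planeInt (leftHalfPlane M) (fun i => endForm γ η y ℓ c z α (i + k)) j with hP
  have hdiff := fun i => differentiableOn_endForm (γ := γ) (ℓ := ℓ) hR hRM α c i
  have hlim : ∀ j ≤ m, Tendsto (fun a => P j (m - j) (ℓ c) (ℓ a)) 𝓕 (𝓝 (H j)) := fun j hj => by
    refine (hH j hj).congr' ?_
    filter_upwards [hIF] with a ha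
    exact betaInt_eq_planeInt hγ h hz hI hI01 hIM hR hRM α hc hc ha j (m - j)
  have h1 : ∀ i ≤ m, Tendsto (fun a => P i (m - i) (ℓ c + logPeriod) (ℓ a + logPeriod) -
      P i (m - i) (ℓ c + logPeriod) (ℓ a)) 𝓕 (𝓝 0) := fun i hi => by
    refine squeeze_zero_norm' ?_ (h.tendsto_exp hδ ((A * (2 * (K + 2 * Real.pi) + δ⁻¹)) ^ (m - i)))
    filter_upwards [hIF, h.tendsto_re.eventually (eventually_le_atBot (ℓ c).re)] with a ha hac
    have hre : ∀ w : ℂ, (w + logPeriod).re = w.re := fun w => by simp [logPeriod_re]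
    have := norm_planeInt_sub_le_right (m := m) (k := i) (w := ℓ a) (w' := ℓ a + logPeriod)
      (τ := fun k => weight (fun i => endNu η y (z i)) α k -
        weight (fun i => endNu η y (z i)) α m)
      (w₀ := ℓ c + logPeriod) hA hK' hδ hM hdiff
      (fun i _ v hv => by simpa only [sub_sub_sub_cancel_right] using hb i v hv) (sub_self _)
      (fun k hk => by have := hw k hk; linarith) hi (add_logPeriod_mem_halfStrip (hIM c hc))
      (halfStrip_mono hmono (hIM a ha)) (add_logPeriod_mem_halfStrip (hIM a ha))
      (by rw [hre]; exact hac) (by rw [hre, hre]; exact hac)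
    rwa [hre, max_self] at this
  -- Moving the start by the period multiplies the limit by an exponential, as the far end may be
  -- moved along with it.
  have h2 : ∀ i ≤ m, Tendsto (fun a => P i (m - i) (ℓ c + logPeriod) (ℓ a)) 𝓕
      (𝓝 (Complex.exp (logPeriod * (endNu η y (z m) * α m - endNu η y (z i) * α i)) * H i)) := by
    intro i hi
    have := ((hlim i hi).const_mul (Complex.exp (logPeriod *
      (endNu η y (z m) * α m - endNu η y (z i) * α i)))).sub (h1 i hi)
    rw [sub_zero] at this
    refine this.congr' ?_
    filter_upwards [hIF] with a ha
    have e := planeInt_endForm_add_period (γ := γ) (ℓ := ℓ) hR hRM α c i (m - i) (hIM c hc).1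
      (hIM a ha).1
    rw [Nat.sub_add_cancel hi] at e
    simp only [hP, e]
    ring
  refine tendsto_nhds_unique (hlim j hj) ((tendsto_finsetSum (Finset.range (m - j + 1))
    (f := fun k a => loopInt γ η y ℓ c M z α j k * P (k + j) (m - (k + j)) (ℓ c + logPeriod) (ℓ a))
    fun k hk => (h2 (k + j) (by have := Finset.mem_range.1 hk; omega)).const_mul _).congr' ?_)
  filter_upwards [hIF] with a ha
  have := planeInt_comp (w₀ := ℓ c) (w₁ := ℓ c + logPeriod) (w₂ := ℓ a) (convex_leftHalfPlane M)
    (isOpen_leftHalfPlane M) (fun i => hdiff (i + j)) (m - j)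
    (add_logPeriod_mem_leftHalfPlane (hIM c hc).1) (hIM a ha).1
  simp only [hP]
  rw [this]
  refine Finset.sum_congr rfl fun k hk => ?_
  rw [loopInt, show m - (k + j) = m - j - k by omega]
  simp only [add_assoc]

end

/-! ### The complete iterated beta integral and its dependence on parameters -/

/-- The complete iterated beta integral, as a limit of integrals over compact subintervals. -/
noncomputable def betaVal (γ : ℝ → ℂ) (z α : ℕ → ℂ) (m : ℕ) : ℂ :=
  limUnder (𝓝[>] (0 : ℝ) ×ˢ 𝓝[<] (1 : ℝ)) fun ab => betaInt γ z α 0 m ab.1 ab.2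

/-- The points that keep a positive distance from the path. -/
def avoidSet (γ : ℝ → ℂ) : Set ℂ := {z | ∃ r > 0, ∀ t ∈ Ioo (0 : ℝ) 1, r ≤ ‖γ t - z‖}

/-- A path with logarithmic coordinates at both ends. -/
structure IsBetaPath (S : Set ℝ) (γ : ℝ → ℂ) (y₀ y₁ : ℂ) (η₀ η₁ : ℤ) (K : ℝ) (ℓ₀ ℓ₁ : ℝ → ℂ) :
    Prop where
  regular : IsRegularPath S γ
  left : IsEndChart S γ (𝓝[>] 0) y₀ η₀ K ℓ₀
  right : IsEndChart S γ (𝓝[<] 1) y₁ η₁ K ℓ₁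
  ne : y₀ ≠ y₁

/-- The sequence `y₀, z 1, …, z (m-1), y₁, y₁, …` with the middle points off the path. -/
structure IsPointSeq (γ : ℝ → ℂ) (y₀ y₁ : ℂ) (m : ℕ) (z : ℕ → ℂ) : Prop where
  pos : 1 ≤ m
  zero : z 0 = y₀
  last : ∀ i, m ≤ i → z i = y₁
  mid : ∀ i, 1 ≤ i → i < m → z i ∈ avoidSet γ

/-- The domain of convergence for sequences of exponents. -/
def expDomain (η₀ η₁ : ℤ) (m : ℕ) : Set (ℕ → ℂ) :=
  {α | (η₀ = 1 → (α 0).re < 1) ∧ (η₀ = -1 → ∀ k, 1 ≤ k → k ≤ m → 0 < (α 0).re - (α k).re) ∧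
    (η₁ = 1 → 0 < (α m).re) ∧ (η₁ = -1 → ∀ k < m, 0 < (α k).re - (α m).re)}

/-- The values of `endNu` at the lower end. -/
def leftNu (η₀ : ℤ) (i : ℕ) : ℤ := if η₀ = 1 then if i = 0 then 1 else 0 else -1

/-- The values of `endNu` at the upper end. -/
def rightNu (η₁ : ℤ) (m i : ℕ) : ℤ := if η₁ = 1 then if m ≤ i then 1 else 0 else -1

section

variable {S : Set ℝ} {γ : ℝ → ℂ} {𝓕 : Filter ℝ} {y y₀ y₁ : ℂ} {η η₀ η₁ : ℤ} {K : ℝ}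
  {ℓ ℓ₀ ℓ₁ : ℝ → ℂ} {m : ℕ} {z : ℕ → ℂ}

theorem isOpen_avoidSet (γ : ℝ → ℂ) : IsOpen (avoidSet γ) := by
  rw [Metric.isOpen_iff]
  rintro z ⟨r, hr, h⟩
  refine ⟨r / 2, half_pos hr, fun w hw => ⟨r / 2, half_pos hr, fun t ht => ?_⟩⟩
  rw [Metric.mem_ball, dist_eq_norm] at hw
  have h1 := h t ht
  have h2 : γ t - z = (γ t - w) + (w - z) := by ring
  rw [h2] at h1
  linarith [norm_add_le (γ t - w) (w - z)]

theorem ne_of_mem_avoidSet {z : ℂ} (hz : z ∈ avoidSet γ) : ∀ t ∈ Ioo (0 : ℝ) 1, γ t ≠ z := by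
  obtain ⟨r, hr, h⟩ := hz
  rintro t ht rfl
  have := h t ht
  rw [sub_self, norm_zero] at this
  linarith

theorem IsEndChart.tendsto_of_eta_one (h : IsEndChart S γ 𝓕 y η K ℓ) (hη : η = 1) :
    Tendsto γ 𝓕 (𝓝 y) := by
  rw [tendsto_iff_norm_sub_tendsto_zero]
  obtain ⟨I, hI, -, -, hI01⟩ := h.basis univ univ_mem
  refine (Real.tendsto_exp_atBot.comp h.tendsto_re).congr' ?_
  filter_upwards [hI] with t ht
  have := h.exp_eq t (hI01 ht)
  rw [hη, zpow_one] at this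
  rw [← this, Complex.norm_exp]
  rfl

theorem IsEndChart.ne_of_mem_avoidSet [𝓕.NeBot] (h : IsEndChart S γ 𝓕 y η K ℓ) (hη : η = 1)
    {z : ℂ} (hz : z ∈ avoidSet γ) : z ≠ y := by
  rintro rfl
  obtain ⟨r, hr, hz⟩ := hz
  obtain ⟨I, hI, -, -, hI01⟩ := h.basis univ univ_mem
  have h1 := (tendsto_iff_norm_sub_tendsto_zero.1 (h.tendsto_of_eta_one hη)).eventually_lt_const hr
  obtain ⟨t, ht1, ht2⟩ := (h1.and hI).exists
  exact absurd (hz t (hI01 ht2)) (not_le.2 ht1)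

theorem IsBetaPath.ne_point (h : IsBetaPath S γ y₀ y₁ η₀ η₁ K ℓ₀ ℓ₁)
    (hz : IsPointSeq γ y₀ y₁ m z) (i : ℕ) : ∀ t ∈ Ioo (0 : ℝ) 1, γ t ≠ z i := by
  rcases Nat.eq_zero_or_pos i with rfl | hi
  · rw [hz.zero]; exact h.left.ne
  · rcases lt_or_ge i m with him | him
    · exact ne_of_mem_avoidSet (hz.mid i hi him)
    · rw [hz.last i him]; exact h.right.ne

theorem IsBetaPath.endNu_left (h : IsBetaPath S γ y₀ y₁ η₀ η₁ K ℓ₀ ℓ₁)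
    (hz : IsPointSeq γ y₀ y₁ m z) (i : ℕ) : endNu η₀ y₀ (z i) = leftNu η₀ i := by
  unfold endNu leftNu
  rcases h.left.eta with hη | hη
  · simp only [hη, if_true]
    rcases Nat.eq_zero_or_pos i with rfl | hi
    · simp [hz.zero]
    · rw [if_neg hi.ne', if_neg]
      rcases lt_or_ge i m with him | him
      · exact h.left.ne_of_mem_avoidSet hη (hz.mid i hi him)
      · rw [hz.last i him]; exact h.ne.symm
  · subst hη; simp

theorem IsBetaPath.endNu_right (h : IsBetaPath S γ y₀ y₁ η₀ η₁ K ℓ₀ ℓ₁)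
    (hz : IsPointSeq γ y₀ y₁ m z) (i : ℕ) : endNu η₁ y₁ (z i) = rightNu η₁ m i := by
  unfold endNu rightNu
  rcases h.right.eta with hη | hη
  · simp only [hη, if_true]
    rcases lt_or_ge i m with him | him
    · rw [if_neg (not_le.2 him), if_neg]
      rcases Nat.eq_zero_or_pos i with rfl | hi
      · rw [hz.zero]; exact h.ne
      · exact h.right.ne_of_mem_avoidSet hη (hz.mid i hi him)
    · simp [hz.last i him, him]
  · subst hη; simp

/-- At a finite starting point the weight is k - Re α₀, which is at least 1 - Re α₀; at ∞ it is Re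
α₀ - Re α_k. The conditions of `expDomain` at the start say that these are positive. -/
theorem weight_leftNu_pos {α : ℕ → ℂ} (hη : η₀ = 1 ∨ η₀ = -1) (hα : α ∈ expDomain η₀ η₁ m) {k : ℕ}
    (hk : 1 ≤ k) (hkm : k ≤ m) : 0 < weight (fun i => leftNu η₀ i) α k := by
  unfold weight
  rcases hη with hη | hη
  · have h1 := hα.1 hη
    have h2 : ∀ i ∈ Finset.range k, ordOf ((leftNu η₀ (i + 1) : ℤ) : ℂ) = 1 := fun i _ => by
      simp [ordOf, leftNu, hη]
    rw [Finset.sum_congr rfl h2]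
    have h3 : (1 : ℝ) ≤ k := by exact_mod_cast hk
    have h4 : k ≠ 0 := by omega
    simp only [leftNu, hη, if_true, h4, if_false, Finset.sum_const, Finset.card_range,
      nsmul_eq_mul, mul_one, Int.cast_zero, Int.cast_one, zero_mul, Complex.zero_re, one_mul]
    linarith
  · have h1 := hα.2.1 hη k hk hkm
    have h2 : ∀ i ∈ Finset.range k, ordOf ((leftNu η₀ (i + 1) : ℤ) : ℂ) = 0 := fun i _ => by
      simp [ordOf, leftNu, hη]
    rw [Finset.sum_congr rfl h2]
    simp only [leftNu, hη]
    simp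
    linarith

/-- At a finite end the difference is Re α_m plus nonnegative orders of vanishing; at ∞ it is Re α_k
- Re α_m, the orders being zero. -/
theorem weight_rightNu_pos {α : ℕ → ℂ} (hη : η₁ = 1 ∨ η₁ = -1) (hα : α ∈ expDomain η₀ η₁ m) {k : ℕ}
    (hkm : k < m) : 0 < weight (fun i => rightNu η₁ m i) α m -
      weight (fun i => rightNu η₁ m i) α k := by
  unfold weight
  have h0 : ∀ i ∈ Finset.range m, 0 ≤ ordOf ((rightNu η₁ m (i + 1) : ℤ) : ℂ) := fun i _ => by
    unfold ordOf; split_ifs <;> norm_num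
  have h4 := Finset.sum_le_sum_of_subset_of_nonneg
    (Finset.range_subset_range.2 hkm.le) fun i hi _ => h0 i hi
  have h3 : ¬ m ≤ k := not_le.2 hkm
  rcases hη with hη | hη
  · have h1 := hα.2.2.1 hη
    simp only [rightNu, hη, if_true, le_refl, h3, if_false, Int.cast_one, one_mul, Int.cast_zero,
      zero_mul, Complex.zero_re] at h4 ⊢
    linarith
  · have h1 := hα.2.2.2 hη k hkm
    have h5 : ((-1 : ℤ) = 1) = False := by simp
    simp only [rightNu, hη, h5, if_false, Int.cast_neg, Int.cast_one, neg_mul, one_mul,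
      Complex.neg_re] at h4 ⊢
    linarith

end

/-! ### Families of configurations: uniform convergence and continuity in the parameters -/

section

variable {Θ : Type*} [TopologicalSpace Θ]

theorem exists_uniform_pos {N : ℕ} {f : ℕ → Θ → ℝ} {θ₀ : Θ}
    (hf : ∀ k < N, ContinuousAt (f k) θ₀) (hpos : ∀ k < N, 0 < f k θ₀) :
    ∃ δ > 0, ∀ᶠ θ in 𝓝 θ₀, ∀ k < N, 2 * δ ≤ f k θ := by
  induction N with
  | zero => exact ⟨1, one_pos, Eventually.of_forall fun _ k hk => absurd hk (Nat.not_lt_zero k)⟩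
  | succ N ih =>
    obtain ⟨δ, hδ, h⟩ := ih (fun k hk => hf k (hk.trans N.lt_succ_self))
      fun k hk => hpos k (hk.trans N.lt_succ_self)
    have h1 := hpos N N.lt_succ_self
    have h2 := (hf N N.lt_succ_self).eventually_const_lt (half_lt_self h1)
    refine ⟨min δ (f N θ₀ / 4), lt_min hδ (by linarith), ?_⟩
    filter_upwards [h, h2] with θ h3 h4 k hk
    rcases Nat.lt_succ_iff_lt_or_eq.1 hk with hk | rfl
    · linarith [h3 k hk, min_le_left δ (f N θ₀ / 4)]
    · linarith [min_le_right δ (f k θ₀ / 4)]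

/-- Points and exponents are indexed by all of ℕ but repeat after finitely many terms, so continuity
of each term gives a bound that is uniform in the index. -/
theorem exists_uniform_bound {N : ℕ} {f : Θ → ℕ → ℂ} {g : ℂ → ℂ} {θ₀ : Θ}
    (hf : ∀ k ≤ N, ContinuousAt (fun θ => g (f θ k)) θ₀)
    (hN : ∀ᶠ θ in 𝓝 θ₀, ∀ k, ∃ k' ≤ N, f θ k = f θ k') :
    ∃ C, ∀ᶠ θ in 𝓝 θ₀, ∀ k, ‖g (f θ k)‖ ≤ C := by
  have h : ∀ n ≤ N, ∃ C, ∀ᶠ θ in 𝓝 θ₀, ∀ k ≤ n, ‖g (f θ k)‖ ≤ C := by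
    intro n hn
    induction n with
    | zero =>
      refine ⟨‖g (f θ₀ 0)‖ + 1, ?_⟩
      filter_upwards [(hf 0 hn).norm.eventually_lt_const (lt_add_one _)] with θ h k hk
      rw [Nat.le_zero.1 hk]; exact h.le
    | succ n ih =>
      obtain ⟨C, hC⟩ := ih (by omega)
      refine ⟨max C (‖g (f θ₀ (n + 1))‖ + 1), ?_⟩
      filter_upwards [hC, (hf _ hn).norm.eventually_lt_const (lt_add_one _)] with θ h1 h2 k hk
      rcases Nat.le_succ_iff.1 hk with hk | rfl
      · exact (h1 k hk).trans (le_max_left _ _)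
      · exact h2.le.trans (le_max_right _ _)
  obtain ⟨C, hC⟩ := h N le_rfl
  refine ⟨C, ?_⟩
  filter_upwards [hC, hN] with θ h1 h2 k
  obtain ⟨k', hk', e⟩ := h2 k
  rw [e]; exact h1 k' hk'

/-- A continuous family of configurations over the open set `U`. -/
structure IsBetaFamily (γ : ℝ → ℂ) (y₀ y₁ : ℂ) (m : ℕ) (U : Set Θ)
    (z α : Θ → ℕ → ℂ) : Prop where
  isOpen : IsOpen U
  points : ∀ θ ∈ U, IsPointSeq γ y₀ y₁ m (z θ)
  tail : ∀ θ ∈ U, ∀ i, m < i → α θ i = 0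
  continuousOn_points : ∀ i, ContinuousOn (fun θ => z θ i) U
  continuousOn_exps : ∀ i, ContinuousOn (fun θ => α θ i) U

variable {S : Set ℝ} {γ : ℝ → ℂ} {y y₀ y₁ : ℂ} {η η₀ η₁ : ℤ} {K : ℝ}
  {ℓ₀ ℓ₁ : ℝ → ℂ} {m : ℕ} {U : Set Θ} {z α : Θ → ℕ → ℂ}

theorem continuousOn_param_logInt [FirstCountableTopology Θ] (hγ : IsRegularPath S γ) (hU : IsOpen U) {f : Θ → ℂ}
    (hf : ContinuousOn f U) (hfz : ∀ θ ∈ U, ∀ t ∈ Ioo (0 : ℝ) 1, γ t ≠ f θ) :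
    ContinuousOn (fun x : Θ × ℝ => logInt γ (f x.1) x.2) (U ×ˢ Ioo 0 1) := by
  have h1 : ContinuousOn (fun x : Θ × ℝ => (γ x.2 - f x.1)⁻¹) (U ×ˢ Ioo 0 1) :=
    ((hγ.continuousOn.comp continuousOn_snd fun x hx => hx.2).sub
      (hf.comp continuousOn_fst fun x hx => hx.1)).inv₀ fun x hx =>
        sub_ne_zero.2 (hfz x.1 hx.1 x.2 hx.2)
  refine (continuousOn_param_integral hγ.density hU (f := fun θ t => (γ t - f θ)⁻¹) h1
    half_mem_unit).congr fun x _ => ?_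
  simp only [logInt, smul_eq_mul, mul_comm]

theorem continuousOn_param_formCoeff [FirstCountableTopology Θ] (hγ : IsRegularPath S γ) (hU : IsOpen U)
    (hz : ∀ i, ContinuousOn (fun θ => z θ i) U)
    (hzγ : ∀ θ ∈ U, ∀ i, ∀ t ∈ Ioo (0 : ℝ) 1, γ t ≠ z θ i)
    (hα : ∀ i, ContinuousOn (fun θ => α θ i) U) (i : ℕ) :
    ContinuousOn (fun x : Θ × ℝ => formCoeff γ (z x.1) (α x.1) i x.2) (U ×ˢ Ioo 0 1) := by
  have hl := fun i => continuousOn_param_logInt hγ hU (hz i) fun θ hθ => hzγ θ hθ i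
  have ha : ∀ i, ContinuousOn (fun x : Θ × ℝ => α x.1 i) (U ×ˢ Ioo (0 : ℝ) 1) := fun i =>
    (hα i).comp continuousOn_fst fun x hx => hx.1
  refine (((ha i).neg.mul (hl i)).add ((ha (i + 1)).mul (hl (i + 1)))).cexp.mul ?_
  exact ((hγ.continuousOn.comp continuousOn_snd fun x hx => hx.2).sub
      ((hz (i + 1)).comp continuousOn_fst fun x hx => hx.1)).inv₀ fun x hx =>
        sub_ne_zero.2 (hzγ x.1 hx.1 (i + 1) x.2 hx.2)

theorem continuousOn_param_betaInt [FirstCountableTopology Θ] (hγ : IsRegularPath S γ) (hU : IsOpen U)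
    (hz : ∀ i, ContinuousOn (fun θ => z θ i) U)
    (hzγ : ∀ θ ∈ U, ∀ i, ∀ t ∈ Ioo (0 : ℝ) 1, γ t ≠ z θ i)
    (hα : ∀ i, ContinuousOn (fun θ => α θ i) U) (k m : ℕ) {a : ℝ} (ha : a ∈ Ioo (0 : ℝ) 1) :
    ContinuousOn (fun x : Θ × ℝ => betaInt γ (z x.1) (α x.1) k m a x.2) (U ×ˢ Ioo 0 1) :=
  continuousOn_param_iterInt hγ.density hU
    (ψ := fun i θ t => formCoeff γ (z θ) (α θ) (i + k) t)
    (fun i => continuousOn_param_formCoeff hγ hU hz hzγ hα (i + k)) m ha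

theorem isEndFamily_of_continuousOn [FirstCountableTopology Θ] (hγ : IsRegularPath S γ) (hη : η = 1 ∨ η = -1)
    (hF : IsBetaFamily γ y₀ y₁ m U z α)
    (hzγ : ∀ θ ∈ U, ∀ i, ∀ t ∈ Ioo (0 : ℝ) 1, γ t ≠ z θ i) {ν : ℕ → ℤ}
    (hν : ∀ θ ∈ U, ∀ i, endNu η y (z θ i) = ν i) {θ₀ : Θ} (hθ : θ₀ ∈ U) :
    IsEndFamily γ η y z α ν θ₀ := by
  have hUn := hF.isOpen.mem_nhds hθ
  have hlast : ∀ᶠ θ in 𝓝 θ₀, ∀ k, ∃ k' ≤ m, z θ k = z θ k' := by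
    filter_upwards [hUn] with θ hθ k
    rcases le_total k m with h | h
    · exact ⟨k, h, rfl⟩
    · exact ⟨m, le_rfl, by rw [(hF.points θ hθ).last k h, (hF.points θ hθ).last m le_rfl]⟩
  refine ⟨?_, ?_, ?_, ?_, ?_, ?_⟩
  · filter_upwards [hUn] with θ hθ using hzγ θ hθ
  · filter_upwards [hUn] with θ hθ using hν θ hθ
  · refine exists_uniform_bound (f := z) (g := endCoeff η y) (fun k _ => ?_) hlast
    have hzc := (hF.continuousOn_points k).continuousAt hUn
    rcases hη with rfl | rfl
    · simp only [endCoeff, if_true]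
      -- If the k-th point is the endpoint for θ₀, then ν k = 1 forces this on all of U, and the
      -- coefficient is constantly 0⁻¹ = 0.
      by_cases h0 : z θ₀ k = y
      · have h1 : ν k = 1 := by rw [← hν θ₀ hθ k]; simp [endNu, h0]
        refine (continuousAt_const (y := (0 : ℂ))).congr ?_
        filter_upwards [hUn] with θ hθ
        have h2 := hν θ hθ k
        rw [h1, endNu] at h2
        by_cases h3 : z θ k = y
        · simp [h3]
        · simp [h3] at h2
      · exact (continuousAt_const.sub hzc).inv₀ (sub_ne_zero.2 (Ne.symm h0))
    · have : ((-1 : ℤ) = 1) = False := by simp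
      simp only [endCoeff, this, if_false]
      exact continuousAt_const.sub hzc
  · intro c hc
    have h1 : ∀ k, ContinuousAt (fun θ => logInt γ (z θ k) c) θ₀ := fun k => by
      have h2 := continuousOn_param_logInt (f := fun θ => z θ k) hγ hF.isOpen
        (hF.continuousOn_points k) fun θ hθ => hzγ θ hθ k
      exact continuousAt_slice hF.isOpen (f := fun θ t => logInt γ (z θ k) t) h2 hθ hc
    exact exists_uniform_bound (f := z) (g := fun w => logInt γ w c) (fun k _ => h1 k) hlast
  · refine exists_uniform_bound (f := α) (g := fun w => w) (N := m + 1) (fun k _ =>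
      (hF.continuousOn_exps k).continuousAt hUn) ?_
    filter_upwards [hUn] with θ hθ k
    rcases le_or_gt k m with h | h
    · exact ⟨k, by omega, rfl⟩
    · exact ⟨m + 1, le_rfl, by rw [hF.tail θ hθ k h, hF.tail θ hθ _ m.lt_succ_self]⟩
  · intro a ha b hb k m
    exact continuousAt_slice hF.isOpen (f := fun θ t => betaInt γ (z θ) (α θ) k m a t)
      (continuousOn_param_betaInt hγ hF.isOpen hF.continuousOn_points hzγ hF.continuousOn_exps k m
        ha) hθ hb

variable {θ₀ : Θ}

theorem IsBetaPath.isEndFamily_left [FirstCountableTopology Θ] (h : IsBetaPath S γ y₀ y₁ η₀ η₁ K ℓ₀ ℓ₁)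
    (hF : IsBetaFamily γ y₀ y₁ m U z α) (hθ : θ₀ ∈ U) :
    IsEndFamily γ η₀ y₀ z α (leftNu η₀) θ₀ :=
  isEndFamily_of_continuousOn h.regular h.left.eta hF (fun θ hθ => h.ne_point (hF.points θ hθ))
    (fun θ hθ => h.endNu_left (hF.points θ hθ)) hθ

theorem IsBetaPath.isEndFamily_right [FirstCountableTopology Θ] (h : IsBetaPath S γ y₀ y₁ η₀ η₁ K ℓ₀ ℓ₁)
    (hF : IsBetaFamily γ y₀ y₁ m U z α) (hθ : θ₀ ∈ U) :
    IsEndFamily γ η₁ y₁ z α (rightNu η₁ m) θ₀ :=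
  isEndFamily_of_continuousOn h.regular h.right.eta hF (fun θ hθ => h.ne_point (hF.points θ hθ))
    (fun θ hθ => h.endNu_right (hF.points θ hθ)) hθ

theorem continuousAt_weight {Θ : Type*} [TopologicalSpace Θ] {θ₀ : Θ} {α : Θ → ℕ → ℂ} {ν : ℕ → ℂ}
    (hα : ∀ i, ContinuousAt (fun θ => α θ i) θ₀) (k : ℕ) :
    ContinuousAt (fun θ => weight ν (α θ) k) θ₀ := by
  have h1 : ∀ i, ContinuousAt (fun θ => (ν i * α θ i).re) θ₀ := fun i =>
    Complex.continuous_re.continuousAt.comp (continuousAt_const.mul (hα i))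
  exact ((h1 k).sub (h1 0)).add continuousAt_const

theorem IsBetaFamily.exists_weight_left (hF : IsBetaFamily γ y₀ y₁ m U z α) (hθ : θ₀ ∈ U)
    (hη : η₀ = 1 ∨ η₀ = -1) (hα : α θ₀ ∈ expDomain η₀ η₁ m) :
    ∃ δ > 0, ∀ᶠ θ in 𝓝 θ₀, ∀ k, 1 ≤ k → k ≤ m →
      2 * δ ≤ weight (fun i => leftNu η₀ i) (α θ) k := by
  obtain ⟨δ, hδ, hw⟩ := exists_uniform_pos (N := m)
    (f := fun k θ => weight (fun i => leftNu η₀ i) (α θ) (k + 1)) (θ₀ := θ₀)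
    (fun k _ => continuousAt_weight (fun i => (hF.continuousOn_exps i).continuousAt
      (hF.isOpen.mem_nhds hθ)) _)
    fun k hk => weight_leftNu_pos hη hα (by omega) (by omega)
  refine ⟨δ, hδ, hw.mono fun θ hθ k hk hkm => ?_⟩
  obtain ⟨k, rfl⟩ : ∃ l, k = l + 1 := ⟨k - 1, by omega⟩
  exact hθ k (by omega)

theorem IsBetaFamily.exists_weight_right (hF : IsBetaFamily γ y₀ y₁ m U z α) (hθ : θ₀ ∈ U)
    (hη : η₁ = 1 ∨ η₁ = -1) (hα : α θ₀ ∈ expDomain η₀ η₁ m) :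
    ∃ δ > 0, ∀ᶠ θ in 𝓝 θ₀, ∀ k < m, 2 * δ ≤ weight (fun i => rightNu η₁ m i) (α θ) m -
      weight (fun i => rightNu η₁ m i) (α θ) k :=
  exists_uniform_pos (fun _ _ => (continuousAt_weight (fun i =>
    (hF.continuousOn_exps i).continuousAt (hF.isOpen.mem_nhds hθ)) _).sub
      (continuousAt_weight (fun i => (hF.continuousOn_exps i).continuousAt
        (hF.isOpen.mem_nhds hθ)) _)) fun _ hk => weight_rightNu_pos hη hα hk

/-- Path composition at 1/2 writes the integral as a finite sum of products in which each factor
sees only one end of the path. -/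
theorem IsBetaPath.tendsto_betaInt_prod [FirstCountableTopology Θ] (h : IsBetaPath S γ y₀ y₁ η₀ η₁ K ℓ₀ ℓ₁)
    (hF : IsBetaFamily γ y₀ y₁ m U z α) (hθ : θ₀ ∈ U) (hα : α θ₀ ∈ expDomain η₀ η₁ m) :
    Tendsto (fun x : (ℝ × ℝ) × Θ => betaInt γ (z x.2) (α x.2) 0 m x.1.1 x.1.2)
      ((𝓝[>] (0 : ℝ) ×ˢ 𝓝[<] (1 : ℝ)) ×ˢ 𝓝 θ₀) (𝓝 (betaVal γ (z θ₀) (α θ₀) m)) := by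
  have hl : ∀ j ≤ m, ∃ w, Tendsto (fun x : ℝ × Θ => betaInt γ (z x.2) (α x.2) 0 j x.1 (1 / 2))
      (𝓝[>] (0 : ℝ) ×ˢ 𝓝 θ₀) (𝓝 w) := fun j hj =>
    (h.isEndFamily_left hF hθ).exists_tendsto_left h.regular h.left
      (hF.exists_weight_left hθ h.left.eta hα) half_mem_unit hj
  have hr : ∀ j ≤ m, ∃ w, Tendsto (fun x : ℝ × Θ =>
      betaInt γ (z x.2) (α x.2) j (m - j) (1 / 2) x.1) (𝓝[<] (1 : ℝ) ×ˢ 𝓝 θ₀) (𝓝 w) :=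
    fun j hj => (h.isEndFamily_right hF hθ).exists_tendsto_right h.regular h.right
      (hF.exists_weight_right hθ h.right.eta hα) half_mem_unit hj
  choose! u hu using hl
  choose! v hv using hr
  have key : Tendsto (fun x : (ℝ × ℝ) × Θ => betaInt γ (z x.2) (α x.2) 0 m x.1.1 x.1.2)
      ((𝓝[>] (0 : ℝ) ×ˢ 𝓝[<] (1 : ℝ)) ×ˢ 𝓝 θ₀) (𝓝 (∑ j ∈ Finset.range (m + 1), u j * v j)) := by
    have h1 : Tendsto (fun x : (ℝ × ℝ) × Θ => ∑ j ∈ Finset.range (m + 1),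
        betaInt γ (z x.2) (α x.2) 0 j x.1.1 (1 / 2) *
          betaInt γ (z x.2) (α x.2) j (m - j) (1 / 2) x.1.2)
        ((𝓝[>] (0 : ℝ) ×ˢ 𝓝[<] (1 : ℝ)) ×ˢ 𝓝 θ₀)
        (𝓝 (∑ j ∈ Finset.range (m + 1), u j * v j)) := by
      refine tendsto_finsetSum _ fun j hj => ?_
      have hj' : j ≤ m := Nat.lt_succ_iff.1 (Finset.mem_range.1 hj)
      have e1 : Tendsto (fun x : (ℝ × ℝ) × Θ => (x.1.1, x.2))
          ((𝓝[>] (0 : ℝ) ×ˢ 𝓝[<] (1 : ℝ)) ×ˢ 𝓝 θ₀) (𝓝[>] (0 : ℝ) ×ˢ 𝓝 θ₀) :=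
        (tendsto_fst.comp tendsto_fst).prodMk tendsto_snd
      have e2 : Tendsto (fun x : (ℝ × ℝ) × Θ => (x.1.2, x.2))
          ((𝓝[>] (0 : ℝ) ×ˢ 𝓝[<] (1 : ℝ)) ×ˢ 𝓝 θ₀) (𝓝[<] (1 : ℝ) ×ˢ 𝓝 θ₀) :=
        (tendsto_snd.comp tendsto_fst).prodMk tendsto_snd
      have e3 := (hu j hj').comp e1
      have e4 := (hv j hj').comp e2
      simp only [Function.comp_def] at e3 e4
      exact e3.mul e4
    refine h1.congr' ?_
    have hab : ((Ioo (0 : ℝ) 1 ×ˢ Ioo (0 : ℝ) 1 : Set (ℝ × ℝ))) ∈ 𝓝[>] (0 : ℝ) ×ˢ 𝓝[<] (1 : ℝ) :=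
      prod_mem_prod (Ioo_mem_nhdsGT (zero_lt_one' ℝ)) (Ioo_mem_nhdsLT (zero_lt_one' ℝ))
    filter_upwards [prod_mem_prod hab (hF.isOpen.mem_nhds hθ)] with x hx
    rw [betaInt_comp h.regular (h.ne_point (hF.points x.2 hx.2)) (α x.2) 0 m hx.1.1
      half_mem_unit hx.1.2]
    simp only [add_zero]
  have h2 : Tendsto (fun ab : ℝ × ℝ => betaInt γ (z θ₀) (α θ₀) 0 m ab.1 ab.2)
      (𝓝[>] (0 : ℝ) ×ˢ 𝓝[<] (1 : ℝ)) (𝓝 (∑ j ∈ Finset.range (m + 1), u j * v j)) := by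
    have := key.comp (tendsto_id.prodMk (tendsto_const_nhds (x := θ₀)
      (f := 𝓝[>] (0 : ℝ) ×ˢ 𝓝[<] (1 : ℝ))))
    simpa only [Function.comp_def, id] using this
  rwa [betaVal, h2.limUnder_eq]

theorem IsBetaPath.tendsto_betaInt (h : IsBetaPath S γ y₀ y₁ η₀ η₁ K ℓ₀ ℓ₁) {z α : ℕ → ℂ}
    (hz : IsPointSeq γ y₀ y₁ m z) (hα : α ∈ expDomain η₀ η₁ m) (h0 : ∀ i, m < i → α i = 0) :
    Tendsto (fun ab : ℝ × ℝ => betaInt γ z α 0 m ab.1 ab.2) (𝓝[>] (0 : ℝ) ×ˢ 𝓝[<] (1 : ℝ))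
      (𝓝 (betaVal γ z α m)) := by
  have hF : IsBetaFamily γ y₀ y₁ m (univ : Set ℂ) (fun _ => z) (fun _ => α) :=
    ⟨isOpen_univ, fun _ _ => hz, fun _ _ => h0, fun _ => continuousOn_const,
      fun _ => continuousOn_const⟩
  have := (h.tendsto_betaInt_prod (θ₀ := 0) hF (mem_univ _) hα).comp (tendsto_id.prodMk
    (tendsto_const_nhds (x := (0 : ℂ)) (f := 𝓝[>] (0 : ℝ) ×ˢ 𝓝[<] (1 : ℝ))))
  simpa only [Function.comp_def, id] using this

theorem continuousAt_of_tendsto_prod {ι : Type*} {𝓖 : Filter ι} [𝓖.NeBot] {F : ι → Θ → ℂ}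
    {f : Θ → ℂ} {θ₀ : Θ} (hF : Tendsto (fun x : ι × Θ => F x.1 x.2) (𝓖 ×ˢ 𝓝 θ₀) (𝓝 (f θ₀)))
    (hf : ∀ᶠ θ in 𝓝 θ₀, Tendsto (fun a => F a θ) 𝓖 (𝓝 (f θ))) : ContinuousAt f θ₀ := by
  rw [ContinuousAt, Metric.tendsto_nhds]
  intro ε hε
  have h1 := (Metric.tendsto_nhds.1 hF) (ε / 2) (half_pos hε)
  obtain ⟨pa, hpa, pb, hpb, hp⟩ := eventually_prod_iff.1 h1
  filter_upwards [hpb, hf] with θ h2 h3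
  have h4 : Tendsto (fun a => dist (F a θ) (f θ₀)) 𝓖 (𝓝 (dist (f θ) (f θ₀))) :=
    h3.dist tendsto_const_nhds
  have h5 : dist (f θ) (f θ₀) ≤ ε / 2 := le_of_tendsto h4 (hpa.mono fun a ha => (hp ha h2).le)
  linarith

theorem IsBetaPath.continuousOn_betaVal [FirstCountableTopology Θ] (h : IsBetaPath S γ y₀ y₁ η₀ η₁ K ℓ₀ ℓ₁)
    (hF : IsBetaFamily γ y₀ y₁ m U z α) (hα : ∀ θ ∈ U, α θ ∈ expDomain η₀ η₁ m) :
    ContinuousOn (fun θ => betaVal γ (z θ) (α θ) m) U := fun θ₀ hθ => by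
  refine (continuousAt_of_tendsto_prod (F := fun (ab : ℝ × ℝ) θ =>
    betaInt γ (z θ) (α θ) 0 m ab.1 ab.2) (h.tendsto_betaInt_prod hF hθ (hα _ hθ)) ?_).continuousWithinAt
  filter_upwards [hF.isOpen.mem_nhds hθ] with θ hθ
  exact h.tendsto_betaInt (hF.points θ hθ) (hα θ hθ) (hF.tail θ hθ)

end

/-! ### Meromorphic dependence on the exponents -/

theorem exp_logPeriod_mul_ne_one {N : ℕ} {x : ℂ} {k : ℤ} (hx : x = k / N) (h0 : k ≠ 0)
    (hk : |k| < N) : Complex.exp (logPeriod * x) - 1 ≠ 0 := by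
  intro h
  obtain ⟨j, hj⟩ := Complex.exp_eq_one_iff.1 (sub_eq_zero.1 h)
  have hN : (N : ℂ) ≠ 0 := by
    have : (0 : ℤ) < N := (abs_nonneg k).trans_lt hk
    exact_mod_cast this.ne'
  have h1 : x = j := by
    have h2 := Complex.two_pi_I_ne_zero
    rw [logPeriod, mul_comm] at hj
    exact mul_right_cancel₀ h2 hj
  have h2 : k = j * N := by
    rw [hx, div_eq_iff hN] at h1
    exact_mod_cast h1
  have hj0 : j ≠ 0 := by rintro rfl; simp at h2; exact h0 h2
  have h3 : 1 ≤ |j| := Int.one_le_abs hj0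
  rw [h2, abs_mul, Nat.abs_cast] at hk
  nlinarith [abs_nonneg j]

section

variable {E : Type*} [NormedAddCommGroup E] [NormedSpace ℂ E]
  {S : Set ℝ} {γ : ℝ → ℂ} {𝓕 : Filter ℝ} {y : ℂ} {η : ℤ} {K : ℝ} {ℓ : ℝ → ℂ}

theorem differentiable_betaInt (hγ : IsRegularPath S γ) {z : ℕ → ℂ}
    (hz : ∀ i, ∀ t ∈ Ioo (0 : ℝ) 1, γ t ≠ z i) {α : E → ℕ → ℂ}
    (hα : ∀ i, ContDiff ℂ 1 (fun θ => α θ i)) (k m : ℕ) {a b : ℝ} (ha : a ∈ Ioo (0 : ℝ) 1)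
    (hb : b ∈ Ioo (0 : ℝ) 1) : Differentiable ℂ (fun θ => betaInt γ z (α θ) k m a b) := by
  have hψ : ∀ i, JointC1 (univ : Set E) (fun θ t => formCoeff γ z (α θ) (i + k) t) := fun i =>
    ((((jointC1_of_contDiff ((hα (i + k)).neg)).mul
      (jointC1_of_continuousOn (continuousOn_logInt hγ (hz (i + k))))).add
      ((jointC1_of_contDiff (hα (i + k + 1))).mul
      (jointC1_of_continuousOn (continuousOn_logInt hγ (hz (i + k + 1)))))).cexp).mul
      (jointC1_of_continuousOn (hγ.continuousOn_inv (hz (i + k + 1))))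
  exact differentiableOn_univ.1
    ((JointC1.iterInt hγ.density isOpen_univ hψ m ha).differentiableOn hb)

theorem differentiable_prod_range {f : ℕ → E → ℂ} (hf : ∀ i, Differentiable ℂ (f i)) (m : ℕ) :
    Differentiable ℂ fun θ => ∏ i ∈ Finset.range m, f i θ := by
  induction m with
  | zero => simp
  | succ m ih => simpa only [Finset.prod_range_succ] using ih.fun_mul (hf m)

/-- Global data for a family with fixed points at one end of the path. -/
theorem IsEndChart.exists_global {E : Type*} [NormedAddCommGroup E] [𝓕.NeBot] (h : IsEndChart S γ 𝓕 y η K ℓ) {z : ℕ → ℂ}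
    {α : E → ℕ → ℂ} {ν : ℕ → ℤ} (hF : ∀ θ, IsEndFamily γ η y (fun _ => z) α ν θ) :
    ∃ M R : ℝ, 0 ≤ M ∧ R * Real.exp (-M) ≤ 1 / 2 ∧ (∀ i, ‖endCoeff η y (z i)‖ ≤ R) ∧
      ∃ I ∈ 𝓕, I.OrdConnected ∧ I ⊆ Ioo 0 1 ∧ (∀ t ∈ I, ℓ t ∈ halfStrip M K) ∧
      ∃ c ∈ I, ∀ θ, ∃ A : ℝ, 0 ≤ A ∧ ∀ i, ∀ v ∈ halfStrip M (K + 2 * Real.pi),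
        ‖endForm γ η y ℓ c z (α θ) i v‖ ≤ A * Real.exp
          ((weight (fun i => endNu η y (z i)) (α θ) (i + 1) -
            weight (fun i => endNu η y (z i)) (α θ) i) * v.re) := by
  obtain ⟨R, hR⟩ := (hF 0).coeff_le
  obtain ⟨-, hR⟩ := hR.exists
  obtain ⟨M, hM, hRM⟩ := exists_halfPlane_bound R
  obtain ⟨I, hI, hIc, hI01, hIM⟩ := h.exists_region M
  obtain ⟨c, hc⟩ := Filter.nonempty_of_mem hI
  obtain ⟨C, hC⟩ := (hF 0).log_le c (hI01 hc)
  obtain ⟨-, hC⟩ := hC.exists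
  have hR0 : 0 ≤ R := (norm_nonneg _).trans (hR 0)
  refine ⟨M, R, hM, hRM, hR, I, hI, hIc, hI01, hIM, c, hc, fun θ => ?_⟩
  obtain ⟨D, hD⟩ := (hF θ).exps_le
  refine ⟨growthConst (K + 2 * Real.pi) R (C + ‖ℓ c‖ + 1) D, growthConst_nonneg hR0,
    fun i v hv => ?_⟩
  refine norm_endForm_le h.eta hR0 hRM hR (fun i => ?_) hD.self_of_nhds i hv
  refine (norm_sub_le _ _).trans (add_le_add ((norm_sub_le _ _).trans
    (add_le_add (hC i) ?_)) ?_)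
  · rw [norm_mul, Complex.norm_intCast]
    refine (mul_le_mul_of_nonneg_right ?_ (norm_nonneg _)).trans_eq (one_mul _)
    exact_mod_cast abs_endNu_le h.eta y (z i)
  · exact norm_log_one_add_le_one (norm_mul_exp_le (hR i) hRM (hIM c hc).1)

/-- The monodromy relation is a recursion for the integrals from the end to c, with entire loop
integrals as coefficients. Composition with the entire integrals from c to 1/2 gives the statement
at 1/2. -/
theorem entireOn_left [𝓕.NeBot] (hγ : IsRegularPath S γ) (h : IsEndChart S γ 𝓕 y η K ℓ)
    {z : ℕ → ℂ} (hz : ∀ i, ∀ t ∈ Ioo (0 : ℝ) 1, γ t ≠ z i) {α : E → ℕ → ℂ}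
    (hα : ∀ i, ContDiff ℂ 1 (fun θ => α θ i)) {ν : ℕ → ℤ} (hν : ∀ i, endNu η y (z i) = ν i)
    (hF : ∀ θ, IsEndFamily γ η y (fun _ => z) α ν θ) {D : Set E} {m : ℕ}
    (hw : ∀ θ ∈ D, ∃ δ > 0, ∀ᶠ θ in 𝓝 θ, ∀ k, 1 ≤ k → k ≤ m →
      2 * δ ≤ weight (fun i => ν i) (α θ) k) :
    ∃ H : ℕ → E → ℂ, ∀ j ≤ m,
      (∀ θ ∈ D, Tendsto (fun a => betaInt γ z (α θ) 0 j a (1 / 2)) 𝓕 (𝓝 (H j θ))) ∧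
      EntireOn D (fun θ => H j θ * ∏ i ∈ Finset.range m,
        (Complex.exp (logPeriod * (ν (i + 1) * α θ (i + 1) - ν 0 * α θ 0)) - 1)) := by
  obtain ⟨M, R, hM, hRM, hR, I, hI, hIc, hI01, hIM, c, hc, hA⟩ := h.exists_global hF
  have hlim : ∀ j ≤ m, ∀ θ ∈ D, ∃ w, Tendsto (fun a => betaInt γ z (α θ) 0 j a c) 𝓕 (𝓝 w) := by
    intro j hj θ hθ
    obtain ⟨w, hw⟩ := (hF θ).exists_tendsto_left hγ h (hw θ hθ) (hI01 hc) hj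
    have := hw.comp (tendsto_id.prodMk (tendsto_const_nhds (x := θ) (f := 𝓕)))
    exact ⟨w, by simpa only [Function.comp_def, id] using this⟩
  choose! H hH using hlim
  have hent : ∀ j ≤ m, EntireOn D (fun θ => H j θ * ∏ i ∈ Finset.range m,
      (Complex.exp (logPeriod * (ν (i + 1) * α θ (i + 1) - ν 0 * α θ 0)) - 1)) := fun j hj => by
    have hd := fun i => (hα i).differentiable one_ne_zero
    refine entireOn_of_recursion (e := fun i θ => Complex.exp (logPeriod *
      (ν i * α θ i - ν 0 * α θ 0))) (c := fun k j θ => loopInt γ η y ℓ c M z (α θ) k (j - k))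
      (fun i => ((((hd i).const_mul _).sub ((hd 0).const_mul _)).const_mul _).cexp)
      (fun k j => differentiable_loopInt hR hRM hα (hIM c hc).1 k (j - k))
      (fun θ hθ => tendsto_nhds_unique (hH 0 (Nat.zero_le m) θ hθ) tendsto_const_nhds)
      (fun j _ hj θ hθ => ?_) hj
    obtain ⟨A, hA0, hA⟩ := hA θ
    obtain ⟨δ, hδ, hδw⟩ := hw θ hθ
    have := monodromy_left hγ h hz hI hIc hI01 hIM hM hR hRM hc hA0 hδ hA
      (m := m) (by simpa only [hν] using hδw.self_of_nhds) (fun j hj => hH j hj θ hθ) hj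
    simpa only [hν] using this
  refine ⟨fun j θ => ∑ k ∈ Finset.range (j + 1), H k θ * betaInt γ z (α θ) k (j - k) c (1 / 2),
    fun j hj => ⟨fun θ hθ => ?_, ?_⟩⟩
  · refine (tendsto_finsetSum (Finset.range (j + 1)) fun k hk => (hH k
      ((Nat.lt_succ_iff.1 (Finset.mem_range.1 hk)).trans hj) θ hθ).mul_const
        (betaInt γ z (α θ) k (j - k) c (1 / 2))).congr' ?_
    filter_upwards [hI] with a ha
    rw [betaInt_comp hγ hz (α θ) 0 j (hI01 ha) (hI01 hc) half_mem_unit]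
    simp only [add_zero]
  · refine (EntireOn.sum fun k hk => (hent k
      ((Nat.lt_succ_iff.1 (Finset.mem_range.1 hk)).trans hj)).mul (entireOn_of_differentiable
        (differentiable_betaInt hγ hz hα k (j - k) (hI01 hc) half_mem_unit))).congr fun θ _ => ?_
    simp only [Finset.sum_mul]
    exact Finset.sum_congr rfl fun k _ => by ring

theorem entireOn_right [𝓕.NeBot] (hγ : IsRegularPath S γ) (h : IsEndChart S γ 𝓕 y η K ℓ)
    {z : ℕ → ℂ} (hz : ∀ i, ∀ t ∈ Ioo (0 : ℝ) 1, γ t ≠ z i) {α : E → ℕ → ℂ}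
    (hα : ∀ i, ContDiff ℂ 1 (fun θ => α θ i)) {ν : ℕ → ℤ} (hν : ∀ i, endNu η y (z i) = ν i)
    (hF : ∀ θ, IsEndFamily γ η y (fun _ => z) α ν θ) {D : Set E} {m : ℕ}
    (hw : ∀ θ ∈ D, ∃ δ > 0, ∀ᶠ θ in 𝓝 θ, ∀ k < m,
      2 * δ ≤ weight (fun i => ν i) (α θ) m - weight (fun i => ν i) (α θ) k) :
    ∃ H : ℕ → E → ℂ, ∀ j ≤ m,
      (∀ θ ∈ D, Tendsto (fun a => betaInt γ z (α θ) j (m - j) (1 / 2) a) 𝓕 (𝓝 (H j θ))) ∧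
      EntireOn D (fun θ => H j θ * ∏ i ∈ Finset.range m, (Complex.exp (logPeriod *
        (ν m * α θ m - ν (m - (i + 1)) * α θ (m - (i + 1)))) - 1)) := by
  obtain ⟨M, R, hM, hRM, hR, I, hI, hIc, hI01, hIM, c, hc, hA⟩ := h.exists_global hF
  have hlim : ∀ j ≤ m, ∀ θ ∈ D,
      ∃ w, Tendsto (fun a => betaInt γ z (α θ) j (m - j) c a) 𝓕 (𝓝 w) := by
    intro j hj θ hθ
    obtain ⟨w, hw⟩ := (hF θ).exists_tendsto_right hγ h (hw θ hθ) (hI01 hc) hj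
    have := hw.comp (tendsto_id.prodMk (tendsto_const_nhds (x := θ) (f := 𝓕)))
    exact ⟨w, by simpa only [Function.comp_def, id] using this⟩
  choose! H hH using hlim
  have hd := fun i => (hα i).differentiable one_ne_zero
  have hfd : ∀ i, Differentiable ℂ fun θ => Complex.exp (logPeriod *
      (ν m * α θ m - ν i * α θ i)) := fun i =>
    ((((hd m).const_mul _).sub ((hd i).const_mul _)).const_mul _).cexp
  have hent' : ∀ i ≤ m, EntireOn D (fun θ => H (m - i) θ * ∏ i ∈ Finset.range m,
      (Complex.exp (logPeriod * (ν m * α θ m - ν (m - (i + 1)) * α θ (m - (i + 1)))) - 1)) := by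
    intro i hi
    -- At the upper end the number of forms left to integrate is m - j, so the recursion is run in
    -- the reversed index i = m - j.
    refine entireOn_of_recursion (H := fun i => H (m - i)) (e := fun i θ => Complex.exp (logPeriod *
      (ν m * α θ m - ν (m - i) * α θ (m - i))))
      (c := fun k i θ => -(Complex.exp (logPeriod * (ν m * α θ m - ν (m - k) * α θ (m - k))) *
        loopInt γ η y ℓ c M z (α θ) (m - i) (i - k)))
      (fun i => hfd (m - i)) (fun k j => ((hfd (m - k)).mul (differentiable_loopInt hR hRM hα
        (hIM c hc).1 (m - j) (j - k))).neg) (fun θ hθ => ?_) (fun i _ hi θ hθ => ?_) hi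
    · have := hH m le_rfl θ hθ
      simp only [Nat.sub_self] at this
      exact tendsto_nhds_unique this tendsto_const_nhds
    obtain ⟨A, hA0, hA⟩ := hA θ
    obtain ⟨δ, hδ, hδw⟩ := hw θ hθ
    have := monodromy_right hγ h hz hI hIc hI01 hIM hM hR hRM hc hA0 hδ hA
      (m := m) (by simpa only [hν] using hδw.self_of_nhds) (fun j hj => hH j hj θ hθ)
      (j := m - i) (Nat.sub_le m i)
    -- The summand with the empty loop is e * H (m - i); moving it to the left produces the factor e
    -- - 1. The rest of the sum is reversed to match the new index.
    rw [show m - (m - i) = i by omega, Finset.sum_range_succ', zero_add, loopInt, planeInt_zero,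
      one_mul, ← Finset.sum_range_reflect] at this
    simp only [hν] at this
    have e : ∀ k ∈ Finset.range i, loopInt γ η y ℓ c M z (α θ) (m - i) (i - 1 - k + 1) *
        (Complex.exp (logPeriod * (ν m * α θ m - ν (i - 1 - k + 1 + (m - i)) *
          α θ (i - 1 - k + 1 + (m - i)))) * H (i - 1 - k + 1 + (m - i)) θ) =
        -(H (m - k) θ * -(Complex.exp (logPeriod * (ν m * α θ m - ν (m - k) * α θ (m - k))) *
        loopInt γ η y ℓ c M z (α θ) (m - i) (i - k))) := fun k hk => by
      have hk' := Finset.mem_range.1 hk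
      rw [show i - 1 - k + 1 = i - k by omega, show i - k + (m - i) = m - k by omega]
      ring
    rw [Finset.sum_congr rfl e, Finset.sum_neg_distrib] at this
    linear_combination -this
  have hent : ∀ j ≤ m, EntireOn D (fun θ => H j θ * ∏ i ∈ Finset.range m,
      (Complex.exp (logPeriod * (ν m * α θ m - ν (m - (i + 1)) * α θ (m - (i + 1)))) - 1)) :=
    fun j hj => by
      have := hent' (m - j) (Nat.sub_le m j)
      rwa [show m - (m - j) = j by omega] at this
  refine ⟨fun j θ => ∑ k ∈ Finset.range (m - j + 1),
    betaInt γ z (α θ) j k (1 / 2) c * H (k + j) θ, fun j hj => ⟨fun θ hθ => ?_, ?_⟩⟩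
  · refine (tendsto_finsetSum (Finset.range (m - j + 1)) fun k hk => (hH (k + j)
      (by have := Finset.mem_range.1 hk; omega) θ hθ).const_mul
        (betaInt γ z (α θ) j k (1 / 2) c)).congr' ?_
    filter_upwards [hI] with a ha
    rw [betaInt_comp hγ hz (α θ) j (m - j) half_mem_unit (hI01 hc) (hI01 ha)]
    refine Finset.sum_congr rfl fun k hk => ?_
    rw [show m - j - k = m - (k + j) by omega]
  · refine (EntireOn.sum (s := Finset.range (m - j + 1)) fun k hk => (entireOn_of_differentiable
        (differentiable_betaInt hγ hz hα j k half_mem_unit (hI01 hc))).mul (hent (k + j)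
      (by have := Finset.mem_range.1 hk; omega))).congr fun θ _ => ?_
    simp only [Finset.sum_mul]
    exact Finset.sum_congr rfl fun k _ => by ring

variable {y₀ y₁ : ℂ} {η₀ η₁ : ℤ} {ℓ₀ ℓ₁ : ℝ → ℂ} {m : ℕ} {z : ℕ → ℂ}

/-- The complete iterated beta integral is the quotient of two entire functions of the
exponents. -/
theorem IsBetaPath.exists_entireOn (h : IsBetaPath S γ y₀ y₁ η₀ η₁ K ℓ₀ ℓ₁)
    (hz : IsPointSeq γ y₀ y₁ m z) {α : E → ℕ → ℂ} (hα : ∀ i, ContDiff ℂ 1 (fun θ => α θ i))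
    (h0 : ∀ θ, ∀ i, m < i → α θ i = 0) {θ₁ : E}
    (hθ₁ : ∀ i ≤ m, α θ₁ i = ((i + 1 : ℤ) : ℂ) / ((m + 2 : ℕ) : ℂ)) :
    ∃ e : E → ℂ, Differentiable ℂ e ∧ e θ₁ ≠ 0 ∧ EntireOn {θ | α θ ∈ expDomain η₀ η₁ m}
      (fun θ => betaVal γ z (α θ) m * e θ) := by
  have hF : IsBetaFamily γ y₀ y₁ m (univ : Set E) (fun _ => z) α :=
    ⟨isOpen_univ, fun _ _ => hz, fun θ _ => h0 θ, fun _ => continuousOn_const,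
      fun i => (hα i).continuous.continuousOn⟩
  have hzγ := h.ne_point hz
  set D := {θ | α θ ∈ expDomain η₀ η₁ m} with hD
  obtain ⟨H, hH⟩ := entireOn_left h.regular h.left hzγ hα (h.endNu_left hz)
    (fun θ => h.isEndFamily_left hF (mem_univ θ)) (D := D) (m := m) fun θ hθ =>
      hF.exists_weight_left (mem_univ θ) h.left.eta hθ
  obtain ⟨T, hT⟩ := entireOn_right h.regular h.right hzγ hα (h.endNu_right hz)
    (fun θ => h.isEndFamily_right hF (mem_univ θ)) (D := D) (m := m) fun θ hθ =>
      hF.exists_weight_right (mem_univ θ) h.right.eta hθ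
  have hd := fun i => (hα i).differentiable one_ne_zero
  set e₀ : E → ℂ := fun θ => ∏ i ∈ Finset.range m, (Complex.exp (logPeriod *
    (leftNu η₀ (i + 1) * α θ (i + 1) - leftNu η₀ 0 * α θ 0)) - 1) with he₀
  set e₁ : E → ℂ := fun θ => ∏ i ∈ Finset.range m, (Complex.exp (logPeriod *
    (rightNu η₁ m m * α θ m - rightNu η₁ m (m - (i + 1)) * α θ (m - (i + 1)))) - 1) with he₁
  have hd₀ : Differentiable ℂ e₀ := differentiable_prod_range (fun i =>
    ((((hd (i + 1)).const_mul _).sub ((hd 0).const_mul _)).const_mul _).cexp.sub_const _) m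
  have hd₁ : Differentiable ℂ e₁ := differentiable_prod_range (fun i =>
    ((((hd m).const_mul _).sub ((hd (m - (i + 1))).const_mul _)).const_mul _).cexp.sub_const _) m
  refine ⟨fun θ => e₀ θ * e₁ θ, hd₀.mul hd₁, mul_ne_zero ?_ ?_, ?_⟩
  -- With the exponents (i+1)/(m+2), the argument of each exponential is 2πi times a nonzero
  -- fraction of absolute value below 1 with denominator m + 2.
  · refine Finset.prod_ne_zero_iff.2 fun i hi => ?_
    have hi' := Finset.mem_range.1 hi
    rw [hθ₁ (i + 1) (by omega), hθ₁ 0 (by omega)]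
    rcases h.left.eta with hη | hη
    · exact exp_logPeriod_mul_ne_one (N := m + 2) (k := -1) (by simp [leftNu, hη]; ring)
        (by norm_num) (by norm_num; omega)
    · exact exp_logPeriod_mul_ne_one (N := m + 2) (k := -((i : ℤ) + 1))
        (by simp [leftNu, hη]; ring) (by omega) (by rw [abs_neg, abs_of_nonneg] <;> omega)
  · refine Finset.prod_ne_zero_iff.2 fun i hi => ?_
    have hi' := Finset.mem_range.1 hi
    rw [hθ₁ m le_rfl, hθ₁ (m - (i + 1)) (by omega)]
    rcases h.right.eta with hη | hη
    · exact exp_logPeriod_mul_ne_one (N := m + 2) (k := m + 1)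
        (by simp [rightNu, hη, show ¬ m ≤ m - (i + 1) by omega])
        (by omega) (by rw [abs_of_nonneg] <;> omega)
    · exact exp_logPeriod_mul_ne_one (N := m + 2) (k := -((i : ℤ) + 1))
        (by
          rw [Nat.cast_sub (by omega : i + 1 ≤ m)]
          simp [rightNu, hη]; ring) (by omega) (by rw [abs_neg, abs_of_nonneg] <;> omega)
  · refine (EntireOn.sum (s := Finset.range (m + 1)) fun j hj =>
      (hH j (Nat.lt_succ_iff.1 (Finset.mem_range.1 hj))).2.mul
        (hT j (Nat.lt_succ_iff.1 (Finset.mem_range.1 hj))).2).congr fun θ hθ => ?_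
    have key : betaVal γ z (α θ) m = ∑ j ∈ Finset.range (m + 1), H j θ * T j θ := by
      refine tendsto_nhds_unique (h.tendsto_betaInt hz hθ (h0 θ)) ?_
      have h1 : Tendsto (fun x : ℝ × ℝ => ∑ j ∈ Finset.range (m + 1),
          betaInt γ z (α θ) 0 j x.1 (1 / 2) * betaInt γ z (α θ) j (m - j) (1 / 2) x.2)
          (𝓝[>] (0 : ℝ) ×ˢ 𝓝[<] (1 : ℝ)) (𝓝 (∑ j ∈ Finset.range (m + 1), H j θ * T j θ)) := by
        refine tendsto_finsetSum _ fun j hj => ?_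
        have hj' : j ≤ m := Nat.lt_succ_iff.1 (Finset.mem_range.1 hj)
        have e1 := ((hH j hj').1 θ hθ).comp
          (tendsto_fst (f := 𝓝[>] (0 : ℝ)) (g := 𝓝[<] (1 : ℝ)))
        have e2 := ((hT j hj').1 θ hθ).comp
          (tendsto_snd (f := 𝓝[>] (0 : ℝ)) (g := 𝓝[<] (1 : ℝ)))
        simp only [Function.comp_def] at e1 e2
        exact e1.mul e2
      refine h1.congr' ?_
      filter_upwards [prod_mem_prod (Ioo_mem_nhdsGT (zero_lt_one' ℝ))
        (Ioo_mem_nhdsLT (zero_lt_one' ℝ))] with x hx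
      rw [betaInt_comp h.regular hzγ (α θ) 0 m hx.1 half_mem_unit hx.2]
      simp only [add_zero]
    simp only [key, Finset.sum_mul, he₀, he₁]
    exact Finset.sum_congr rfl fun j _ => by ring

end

/-! ### Dependence on the first inner point -/

section

variable {S : Set ℝ} {γ : ℝ → ℂ} {z α : ℕ → ℂ} {a t : ℝ}

theorem betaInt_succ (γ : ℝ → ℂ) (z α : ℕ → ℂ) (k m : ℕ) (a t : ℝ) :
    betaInt γ z α k (m + 1) a t =
      ∫ s in a..t, betaInt γ z α k m a s * formCoeff γ z α (m + k) s * deriv γ s := by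
  simp only [betaInt, iterInt_succ, mul_assoc]

theorem betaInt_zero (γ : ℝ → ℂ) (z α : ℕ → ℂ) (k : ℕ) (a t : ℝ) : betaInt γ z α k 0 a t = 1 := rfl

theorem betaInt_self (γ : ℝ → ℂ) (z α : ℕ → ℂ) (k m : ℕ) (a : ℝ) :
    betaInt γ z α k (m + 1) a a = 0 := iterInt_succ_self _ m a

theorem continuousOn_betaInt (h : IsRegularPath S γ)
    (hz : ∀ i, ∀ t ∈ Ioo (0 : ℝ) 1, γ t ≠ z i) (α : ℕ → ℂ) (k m : ℕ) (ha : a ∈ Ioo (0 : ℝ) 1) :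
    ContinuousOn (fun t => betaInt γ z α k m a t) (Ioo 0 1) :=
  continuousOn_iterInt (fun i => isDensity_form h hz α (i + k)) m ha

theorem hasDerivAt_betaInt (h : IsRegularPath S γ)
    (hz : ∀ i, ∀ t ∈ Ioo (0 : ℝ) 1, γ t ≠ z i) (α : ℕ → ℂ) (k m : ℕ) (ha : a ∈ Ioo (0 : ℝ) 1)
    (ht : t ∈ Ioo (0 : ℝ) 1) (hS : t ∉ S) :
    HasDerivAt (fun t => betaInt γ z α k (m + 1) a t)
      (betaInt γ z α k m a t * (formCoeff γ z α (m + k) t * deriv γ t)) t :=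
  hasDerivAt_iterInt (fun i => isDensity_form h hz α (i + k)) m ha ht hS

theorem hasDerivAt_formCoeff (h : IsRegularPath S γ)
    (hz : ∀ i, ∀ t ∈ Ioo (0 : ℝ) 1, γ t ≠ z i) (α : ℕ → ℂ) (i : ℕ)
    (ht : t ∈ Ioo (0 : ℝ) 1) (hS : t ∉ S) :
    HasDerivAt (formCoeff γ z α i) (formCoeff γ z α i t * (-α i * (γ t - z i)⁻¹ +
      (α (i + 1) - 1) * (γ t - z (i + 1))⁻¹) * deriv γ t) t := by
  have h1 := (((hasDerivAt_logInt h (hz i) ht hS).const_mul (-α i)).add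
    ((hasDerivAt_logInt h (hz (i + 1)) ht hS).const_mul (α (i + 1)))).cexp.mul
      (((h.hasDerivAt t ht hS).sub_const (z (i + 1))).fun_inv (sub_ne_zero.2 (hz (i + 1) t ht)))
  refine h1.congr_deriv ?_
  have := sub_ne_zero.2 (hz (i + 1) t ht)
  have := sub_ne_zero.2 (hz i t ht)
  simp only [formCoeff, Pi.add_apply]
  field_simp
  ring

theorem jointC1_of_hasDerivAt {U : Set ℂ} {f f' : ℂ → ℝ → ℂ}
    (hf : ContinuousOn (fun p : ℂ × ℝ => f p.1 p.2) (U ×ˢ Ioo (0 : ℝ) 1))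
    (hf' : ContinuousOn (fun p : ℂ × ℝ => f' p.1 p.2) (U ×ˢ Ioo (0 : ℝ) 1))
    (hd : ∀ w ∈ U, ∀ t ∈ Ioo (0 : ℝ) 1, HasDerivAt (fun w => f w t) (f' w t) w) :
    JointC1 U f :=
  ⟨hf, fun w t => f' w t • ContinuousLinearMap.id ℂ ℂ, hf'.smul continuousOn_const,
    fun w hw t ht => (hd w hw t ht).hasFDerivAt.congr_fderiv (by ext; simp)⟩

/-- Differentiate under the integral sign, then evaluate the integral of the derivative by an
explicit primitive R in the path variable. This reduces each differential equation below to an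
identity of rational functions. -/
theorem JointC1.hasDerivAt_integral {ρ : ℝ → ℂ} (hS : S.Countable) (hρ : IsDensity S ρ) {U : Set ℂ}
    (hU : IsOpen U) {f : ℂ → ℝ → ℂ} (hf : JointC1 U f) {w : ℂ} (hw : w ∈ U)
    (ha : a ∈ Ioo (0 : ℝ) 1) (ht : t ∈ Ioo (0 : ℝ) 1) {g R : ℝ → ℂ}
    (hg : ∀ s ∈ Ioo (0 : ℝ) 1, HasDerivAt (fun w => f w s) (g s) w)
    (hR : ContinuousOn R (Ioo 0 1)) (hRa : R a = 0)
    (hR' : ∀ s ∈ Ioo (0 : ℝ) 1, s ∉ S → HasDerivAt R (g s * ρ s) s) :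
    HasDerivAt (fun w => ∫ s in a..t, f w s * ρ s) (R t) w := by
  obtain ⟨cf, f', cf', df⟩ := hf
  have h1 := (hasFDerivAt_param_integral hρ hU cf cf' df ha ht hw).hasDerivAt
  have hsub := uIcc_subset_unit ha ht
  have e : ∀ s ∈ Ioo (0 : ℝ) 1, g s = f' w s 1 := fun s hs =>
    (hg s hs).unique (df w hw s hs).hasDerivAt
  have hgc : ContinuousOn g (Ioo 0 1) :=
    ((continuousOn_slice hU cf' hw).clm_apply continuousOn_const).congr e
  have h2 := integral_eq_sub_of_hasDerivAt_off hS ha ht hR hR'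
    ((hρ.continuousOn_mul hgc).integrable a ha t ht)
  rw [hRa, sub_zero] at h2
  have h3 : (fun w => ∫ s in a..t, f w s * ρ s) = fun w => ∫ s in a..t, ρ s • f w s := by
    ext w
    exact intervalIntegral.integral_congr fun s _ => by simp [mul_comm]
  rw [h3]
  refine h1.congr_deriv ?_
  rw [ContinuousLinearMap.intervalIntegral_apply
    (intervalIntegrable_smul hρ (continuousOn_slice hU cf' hw) ha ht), ← h2]
  refine intervalIntegral.integral_congr fun s hs => ?_
  simp [e s (hsub hs), mul_comm]

theorem jointC1_inv (hγ : IsRegularPath S γ) :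
    JointC1 (avoidSet γ) (fun w t => (γ t - w)⁻¹) := by
  have h1 : ContinuousOn (fun p : ℂ × ℝ => γ p.2 - p.1) (avoidSet γ ×ˢ Ioo (0 : ℝ) 1) :=
    (hγ.continuousOn.comp continuousOn_snd fun x hx => hx.2).sub continuousOn_fst
  have h2 : ∀ p ∈ avoidSet γ ×ˢ Ioo (0 : ℝ) 1, γ p.2 - p.1 ≠ 0 := fun p hp =>
    sub_ne_zero.2 (ne_of_mem_avoidSet hp.1 p.2 hp.2)
  have h3 : ContinuousOn (fun p : ℂ × ℝ => (γ p.2 - p.1)⁻¹) (avoidSet γ ×ˢ Ioo (0 : ℝ) 1) :=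
    h1.inv₀ h2
  have h4 : ContinuousOn (fun p : ℂ × ℝ => ((γ p.2 - p.1) ^ 2)⁻¹) (avoidSet γ ×ˢ Ioo (0 : ℝ) 1) :=
    (h1.pow 2).inv₀ fun p hp => pow_ne_zero 2 (h2 p hp)
  refine jointC1_of_hasDerivAt (f := fun w t => (γ t - w)⁻¹) (f' := fun w t => ((γ t - w) ^ 2)⁻¹)
    h3 h4 fun w hw t ht => ?_
  have h5 : γ t - w ≠ 0 := sub_ne_zero.2 (ne_of_mem_avoidSet hw t ht)
  have h6 : HasDerivAt (fun w : ℂ => γ t - w) (-1) w := (hasDerivAt_id w).const_sub (γ t)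
  exact (h6.fun_inv h5).congr_deriv (by simp)

theorem jointC1_logInt (hγ : IsRegularPath S γ) :
    JointC1 (avoidSet γ) (fun w t => logInt γ w t) :=
  (jointC1_inv hγ).integral hγ.density (isOpen_avoidSet γ) half_mem_unit

/-- The integral of dγ/(γ-w)² is elementary; the term at 1/2 comes from normalizing the logarithm
there. In return the logarithm is a single-valued function of w off the path. -/
theorem hasDerivAt_logInt_param (hγ : IsRegularPath S γ) {w : ℂ} (hw : w ∈ avoidSet γ)
    (ht : t ∈ Ioo (0 : ℝ) 1) :
    HasDerivAt (fun w => logInt γ w t) ((γ (1 / 2) - w)⁻¹ - (γ t - w)⁻¹) w := by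
  have hne := ne_of_mem_avoidSet hw
  refine (jointC1_inv hγ).hasDerivAt_integral hγ.countable hγ.density (isOpen_avoidSet γ) hw
    half_mem_unit ht (g := fun t => ((γ t - w) ^ 2)⁻¹)
    (R := fun t => (γ (1 / 2) - w)⁻¹ - (γ t - w)⁻¹) (fun s hs => ?_)
    (continuousOn_const.sub (hγ.continuousOn_inv hne)) (sub_self _) fun s hs hS => ?_
  · exact (((hasDerivAt_id w).const_sub (γ s)).fun_inv (sub_ne_zero.2 (hne s hs))).congr_deriv (by simp)
  · refine ((((hγ.hasDerivAt s hs hS).sub_const w).fun_inv (sub_ne_zero.2 (hne s hs))).const_sub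
      (γ (1 / 2) - w)⁻¹).congr_deriv ?_
    rw [div_eq_mul_inv]; ring

theorem update_ne_path (hz : ∀ i, ∀ t ∈ Ioo (0 : ℝ) 1, γ t ≠ z i) {w : ℂ} (hw : w ∈ avoidSet γ) :
    ∀ i, ∀ t ∈ Ioo (0 : ℝ) 1, γ t ≠ Function.update z 1 w i := fun i t ht => by
  rcases eq_or_ne i 1 with rfl | hi
  · rw [Function.update_self]; exact ne_of_mem_avoidSet hw t ht
  · rw [Function.update_of_ne hi]; exact hz i t ht

theorem jointC1_formCoeff_update (hγ : IsRegularPath S γ)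
    (hz : ∀ i, ∀ t ∈ Ioo (0 : ℝ) 1, γ t ≠ z i) (α : ℕ → ℂ) (i : ℕ) :
    JointC1 (avoidSet γ) (fun w t => formCoeff γ (Function.update z 1 w) α i t) := by
  have hl : ∀ i, JointC1 (avoidSet γ) (fun w t => logInt γ (Function.update z 1 w i) t) := by
    intro i
    rcases eq_or_ne i 1 with rfl | hi
    · simp only [Function.update_self]; exact jointC1_logInt hγ
    · simp only [Function.update_of_ne hi]
      exact jointC1_of_continuousOn (continuousOn_logInt hγ (hz i))
  have hi : ∀ i, JointC1 (avoidSet γ) (fun w t => (γ t - Function.update z 1 w i)⁻¹) := by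
    intro i
    rcases eq_or_ne i 1 with rfl | hi
    · simp only [Function.update_self]; exact jointC1_inv hγ
    · simp only [Function.update_of_ne hi]
      exact jointC1_of_continuousOn (hγ.continuousOn_inv (hz i))
  exact (((jointC1_of_continuousOn continuousOn_const).mul (hl i)).add
    ((jointC1_of_continuousOn continuousOn_const).mul (hl (i + 1)))).cexp.mul (hi (i + 1))

theorem jointC1_betaInt_update (hγ : IsRegularPath S γ)
    (hz : ∀ i, ∀ t ∈ Ioo (0 : ℝ) 1, γ t ≠ z i) (α : ℕ → ℂ) (k m : ℕ) (ha : a ∈ Ioo (0 : ℝ) 1) :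
    JointC1 (avoidSet γ) (fun w t => betaInt γ (Function.update z 1 w) α k m a t) :=
  JointC1.iterInt hγ.density (isOpen_avoidSet γ)
    (fun i => jointC1_formCoeff_update hγ hz α (i + k)) m ha

/-- The sequence `u` with its `j`-th term removed. -/
def skip (j : ℕ) (u : ℕ → ℂ) (i : ℕ) : ℂ := if i < j then u i else u (i + 1)

theorem hasDerivAt_formCoeff_zero (hγ : IsRegularPath S γ) {w : ℂ} (hw : w ∈ avoidSet γ)
    (z α : ℕ → ℂ) (ht : t ∈ Ioo (0 : ℝ) 1) :
    HasDerivAt (fun w => formCoeff γ (Function.update z 1 w) α 0 t)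
      (formCoeff γ (Function.update z 1 w) α 0 t *
        (α 1 * ((γ (1 / 2) - w)⁻¹ - (γ t - w)⁻¹) + (γ t - w)⁻¹)) w := by
  have hne := sub_ne_zero.2 (ne_of_mem_avoidSet hw t ht)
  have h1 := (((hasDerivAt_logInt_param hγ hw ht).const_mul (α 1)).const_add
    (-α 0 * logInt γ (z 0) t)).cexp.mul (((hasDerivAt_id w).const_sub (γ t)).fun_inv hne)
  have e : ∀ w, formCoeff γ (Function.update z 1 w) α 0 t =
      Complex.exp (-α 0 * logInt γ (z 0) t + α 1 * logInt γ w t) * (γ t - w)⁻¹ := fun w => by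
    simp [formCoeff]
  simp only [e]
  refine h1.congr_deriv ?_
  simp only [id]
  field_simp

theorem hasDerivAt_formCoeff_one (hγ : IsRegularPath S γ) {w : ℂ} (hw : w ∈ avoidSet γ)
    (z α : ℕ → ℂ) (ht : t ∈ Ioo (0 : ℝ) 1) :
    HasDerivAt (fun w => formCoeff γ (Function.update z 1 w) α 1 t)
      (formCoeff γ (Function.update z 1 w) α 1 t *
        (-α 1 * ((γ (1 / 2) - w)⁻¹ - (γ t - w)⁻¹))) w := by
  have h1 := (((hasDerivAt_logInt_param hγ hw ht).const_mul (-α 1)).add_const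
    (α 2 * logInt γ (z 2) t)).cexp.mul_const (γ t - z 2)⁻¹
  have e : ∀ w, formCoeff γ (Function.update z 1 w) α 1 t =
      Complex.exp (-α 1 * logInt γ w t + α 2 * logInt γ (z 2) t) * (γ t - z 2)⁻¹ := fun w => by
    simp [formCoeff]
  simp only [e]
  exact h1.congr_deriv (by ring)

theorem formCoeff_update_of_le (γ : ℝ → ℂ) (z α : ℕ → ℂ) (w : ℂ) {i : ℕ} (hi : 2 ≤ i) :
    formCoeff γ (Function.update z 1 w) α i = formCoeff γ z α i := by
  ext t
  simp only [formCoeff, Function.update_of_ne (show i ≠ 1 by omega),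
    Function.update_of_ne (show i + 1 ≠ 1 by omega)]

theorem formCoeff_skip_of_le (γ : ℝ → ℂ) (z α : ℕ → ℂ) {i j : ℕ} (hi : j ≤ i) :
    formCoeff γ (skip j z) (skip j α) i = formCoeff γ z α (i + 1) := by
  ext t
  simp only [formCoeff, skip, not_lt.2 hi, not_lt.2 (show j ≤ i + 1 by omega), if_false]

variable {w : ℂ}

/-- The w-derivative of the first form is a multiple of this form plus the differential of (γ - z₀)
times its coefficient, divided by z₀ - w. Integration leaves the boundary terms at t and a. -/
theorem hasDerivAt_betaInt_one (hγ : IsRegularPath S γ)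
    (hz : ∀ i, ∀ t ∈ Ioo (0 : ℝ) 1, γ t ≠ z i) (α : ℕ → ℂ) (hw : w ∈ avoidSet γ) (h0 : z 0 ≠ w)
    (ha : a ∈ Ioo (0 : ℝ) 1) (ht : t ∈ Ioo (0 : ℝ) 1) :
    HasDerivAt (fun w => betaInt γ (Function.update z 1 w) α 0 1 a t)
      ((α 1 * (γ (1 / 2) - w)⁻¹ + (α 0 - α 1) / (z 0 - w)) *
          betaInt γ (Function.update z 1 w) α 0 1 a t +
        ((γ t - z 0) * formCoeff γ (Function.update z 1 w) α 0 t -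
          (γ a - z 0) * formCoeff γ (Function.update z 1 w) α 0 a) / (z 0 - w)) w := by
  have hu := update_ne_path hz hw
  set u := Function.update z 1 w with hu_def
  have e : ∀ w, betaInt γ (Function.update z 1 w) α 0 1 a t =
      ∫ s in a..t, formCoeff γ (Function.update z 1 w) α 0 s * deriv γ s := fun w => by
    simp [betaInt_succ, betaInt_zero]
  rw [funext e]
  refine (jointC1_formCoeff_update hγ hz α 0).hasDerivAt_integral hγ.countable hγ.density
    (isOpen_avoidSet γ) hw ha ht
    (R := fun t => (α 1 * (γ (1 / 2) - w)⁻¹ + (α 0 - α 1) / (z 0 - w)) * betaInt γ u α 0 1 a t +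
        ((γ t - z 0) * formCoeff γ u α 0 t - (γ a - z 0) * formCoeff γ u α 0 a) / (z 0 - w))
    (fun s hs => hasDerivAt_formCoeff_zero hγ hw z α hs) ?_ ?_ fun s hs hS => ?_
  · exact (continuousOn_const.mul (continuousOn_betaInt hγ hu α 0 1 ha)).add
      ((((hγ.continuousOn.sub continuousOn_const).mul (continuousOn_formCoeff hγ hu α 0)).sub
        continuousOn_const).div_const _)
  · simp [betaInt_self]
  · have h1 := ((hasDerivAt_betaInt hγ hu α 0 0 ha hs hS).const_mul
      (α 1 * (γ (1 / 2) - w)⁻¹ + (α 0 - α 1) / (z 0 - w))).add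
      (((((hγ.hasDerivAt s hs hS).sub_const (z 0)).mul
        (hasDerivAt_formCoeff hγ hu α 0 hs hS)).sub_const
          ((γ a - z 0) * formCoeff γ u α 0 a)).div_const (z 0 - w))
    refine h1.congr_deriv ?_
    have hu0 : u 0 = z 0 := by simp [hu_def]
    have hu1 : u 1 = w := by simp [hu_def]
    have n1 := sub_ne_zero.2 h0
    have n2 := sub_ne_zero.2 (hz 0 s hs)
    have n3 := sub_ne_zero.2 (ne_of_mem_avoidSet hw s hs)
    have n4 := sub_ne_zero.2 (ne_of_mem_avoidSet hw _ half_mem_unit)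
    simp only [betaInt_zero, zero_add, hu0, hu1, one_mul]
    generalize formCoeff γ u α 0 s = A
    generalize deriv γ s = ρ
    generalize γ (1 / 2) = g at *
    field_simp
    ring

/-- The second form also depends on w, through the opposite power, so the normalization terms
α₁/(γ(1/2) - w) cancel. The boundary term at t of the first integral merges with the second form,
which produces the integral without z₁ and a new boundary term at z₂. -/
theorem hasDerivAt_betaInt_two (hγ : IsRegularPath S γ)
    (hz : ∀ i, ∀ t ∈ Ioo (0 : ℝ) 1, γ t ≠ z i) (α : ℕ → ℂ) (hw : w ∈ avoidSet γ) (h0 : z 0 ≠ w)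
    (h2 : z 2 ≠ w) (ha : a ∈ Ioo (0 : ℝ) 1) (ht : t ∈ Ioo (0 : ℝ) 1) :
    HasDerivAt (fun w => betaInt γ (Function.update z 1 w) α 0 2 a t)
      (((α 0 - α 1) / (z 0 - w) + (α 1 - α 2) / (z 2 - w)) *
          betaInt γ (Function.update z 1 w) α 0 2 a t +
        ((z 0 - w)⁻¹ - (z 2 - w)⁻¹) * betaInt γ (skip 1 z) (skip 1 α) 0 1 a t -
        (γ a - z 0) * formCoeff γ (Function.update z 1 w) α 0 a / (z 0 - w) *
          betaInt γ (Function.update z 1 w) α 1 1 a t +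
        betaInt γ (Function.update z 1 w) α 0 1 a t * ((γ t - z 2) *
          formCoeff γ (Function.update z 1 w) α 1 t) / (z 2 - w)) w := by
  have hu := update_ne_path hz hw
  set u := Function.update z 1 w with hu_def
  have hsk : ∀ i, ∀ t ∈ Ioo (0 : ℝ) 1, γ t ≠ skip 1 z i := fun i t ht => by
    unfold skip; split_ifs <;> exact hz _ t ht
  simp only [betaInt_succ _ _ _ 0 1]
  rw [← betaInt_succ _ _ _ 0 1]
  have hcont : ∀ k, ContinuousOn (fun t => (γ t - z k) * formCoeff γ u α 1 t) (Ioo 0 1) :=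
    fun k => (hγ.continuousOn.sub continuousOn_const).mul (continuousOn_formCoeff hγ hu α 1)
  refine ((jointC1_betaInt_update hγ hz α 0 1 ha).mul
    (jointC1_formCoeff_update hγ hz α 1)).hasDerivAt_integral hγ.countable hγ.density
    (isOpen_avoidSet γ) hw ha ht
    (R := fun t => ((α 0 - α 1) / (z 0 - w) + (α 1 - α 2) / (z 2 - w)) * betaInt γ u α 0 2 a t +
        ((z 0 - w)⁻¹ - (z 2 - w)⁻¹) * betaInt γ (skip 1 z) (skip 1 α) 0 1 a t -
        (γ a - z 0) * formCoeff γ u α 0 a / (z 0 - w) * betaInt γ u α 1 1 a t +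
        betaInt γ u α 0 1 a t * ((γ t - z 2) * formCoeff γ u α 1 t) / (z 2 - w))
    (fun s hs => (hasDerivAt_betaInt_one hγ hz α hw h0 ha hs).mul
      (hasDerivAt_formCoeff_one hγ hw z α hs)) ?_ ?_ fun s hs hS => ?_
  · exact (((continuousOn_const.mul (continuousOn_betaInt hγ hu α 0 2 ha)).add
      (continuousOn_const.mul (continuousOn_betaInt hγ hsk _ 0 1 ha))).sub
      (continuousOn_const.mul (continuousOn_betaInt hγ hu α 1 1 ha))).add
      (((continuousOn_betaInt hγ hu α 0 1 ha).mul (hcont 2)).div_const _)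
  · simp [betaInt_self]
  · have h1 := ((((hasDerivAt_betaInt hγ hu α 0 1 ha hs hS).const_mul
      ((α 0 - α 1) / (z 0 - w) + (α 1 - α 2) / (z 2 - w))).add
      ((hasDerivAt_betaInt hγ hsk (skip 1 α) 0 0 ha hs hS).const_mul
        ((z 0 - w)⁻¹ - (z 2 - w)⁻¹))).sub
      ((hasDerivAt_betaInt hγ hu α 1 0 ha hs hS).const_mul
        ((γ a - z 0) * formCoeff γ u α 0 a / (z 0 - w)))).add
      (((hasDerivAt_betaInt hγ hu α 0 0 ha hs hS).mul
        (((hγ.hasDerivAt s hs hS).sub_const (z 2)).mul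
        (hasDerivAt_formCoeff hγ hu α 1 hs hS))).div_const (z 2 - w))
    refine h1.congr_deriv ?_
    have hu0 : u 0 = z 0 := by simp [hu_def]
    have hu1 : u 1 = w := by simp [hu_def]
    have hu2 : u 2 = z 2 := by simp [hu_def]
    have n1 := sub_ne_zero.2 h0
    have n1' := sub_ne_zero.2 h2
    have n2 := sub_ne_zero.2 (hz 0 s hs)
    have n2' := sub_ne_zero.2 (hz 2 s hs)
    have n3 := sub_ne_zero.2 (ne_of_mem_avoidSet hw s hs)
    have n4 := sub_ne_zero.2 (ne_of_mem_avoidSet hw _ half_mem_unit)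
    -- In the product of two neighbouring forms the powers of γ - w cancel; what remains is the form
    -- that joins z₀ directly to z₂.
    have e3 : formCoeff γ (skip 1 z) (skip 1 α) 0 s =
        formCoeff γ u α 0 s * (γ s - w) * formCoeff γ u α 1 s := by
      simp only [formCoeff, skip, Nat.lt_one_iff, zero_add, if_true, one_ne_zero, if_false, hu0,
        hu1, hu2, one_add_one_eq_two]
      rw [mul_assoc (Complex.exp _) (γ s - w)⁻¹, inv_mul_cancel₀ n3, mul_one, ← mul_assoc,
        ← Complex.exp_add]
      congr 2
      ring
    simp only [betaInt_zero, zero_add, add_zero, one_add_one_eq_two, hu1, hu2, one_mul, e3,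
      Pi.mul_apply]
    generalize formCoeff γ u α 0 s = A
    generalize formCoeff γ u α 1 s = B
    generalize formCoeff γ u α 0 a = C
    generalize betaInt γ u α 0 1 a s = J
    generalize deriv γ s = ρ
    generalize γ (1 / 2) = g at *
    field_simp
    ring

end

/-! ### The differential equation of the complete integral in the first inner point -/

section

variable {S : Set ℝ} {γ : ℝ → ℂ} {z α : ℕ → ℂ} {a t : ℝ} {w : ℂ}

/-- From the third one on, the forms do not involve z₁, so a derivative formula is just integrated
against the next form. Each integral becomes one form longer, and the remainder E is replaced by its
primitive Q. -/
theorem hasDerivAt_betaInt_step (hγ : IsRegularPath S γ)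
    (hz : ∀ i, ∀ t ∈ Ioo (0 : ℝ) 1, γ t ≠ z i) (α : ℕ → ℂ) (hw : w ∈ avoidSet γ)
    (ha : a ∈ Ioo (0 : ℝ) 1) (ht : t ∈ Ioo (0 : ℝ) 1) {N : ℕ} {c κ C : ℂ} {E Q : ℝ → ℂ}
    (hD : ∀ s ∈ Ioo (0 : ℝ) 1, HasDerivAt
      (fun w => betaInt γ (Function.update z 1 w) α 0 (N + 2) a s)
      (c * betaInt γ (Function.update z 1 w) α 0 (N + 2) a s +
        κ * betaInt γ (skip 1 z) (skip 1 α) 0 (N + 1) a s -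
        C * betaInt γ (Function.update z 1 w) α 1 (N + 1) a s + E s) w)
    (hQ : ContinuousOn Q (Ioo 0 1)) (hQa : Q a = 0) (hQ' : ∀ s ∈ Ioo (0 : ℝ) 1, s ∉ S →
      HasDerivAt Q (E s * formCoeff γ z α (N + 2) s * deriv γ s) s) :
    HasDerivAt (fun w => betaInt γ (Function.update z 1 w) α 0 (N + 3) a t)
      (c * betaInt γ (Function.update z 1 w) α 0 (N + 3) a t +
        κ * betaInt γ (skip 1 z) (skip 1 α) 0 (N + 2) a t -
        C * betaInt γ (Function.update z 1 w) α 1 (N + 2) a t + Q t) w := by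
  have hu := update_ne_path hz hw
  have hA : ∀ w, formCoeff γ (Function.update z 1 w) α (N + 2) = formCoeff γ z α (N + 2) :=
    fun w => formCoeff_update_of_le γ z α w (by omega)
  have hsk : ∀ i, ∀ t ∈ Ioo (0 : ℝ) 1, γ t ≠ skip 1 z i := fun i t ht => by
    unfold skip; split_ifs <;> exact hz _ t ht
  have e : ∀ w, betaInt γ (Function.update z 1 w) α 0 (N + 3) a t =
      ∫ s in a..t, betaInt γ (Function.update z 1 w) α 0 (N + 2) a s *
        formCoeff γ z α (N + 2) s * deriv γ s := fun w => by
    rw [betaInt_succ, add_zero, hA]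
  rw [show (fun w => betaInt γ (Function.update z 1 w) α 0 (N + 3) a t) = _ from funext e]
  refine ((jointC1_betaInt_update hγ hz α 0 (N + 2) ha).mul (jointC1_of_continuousOn
    (continuousOn_formCoeff hγ hz α (N + 2)))).hasDerivAt_integral hγ.countable hγ.density
    (isOpen_avoidSet γ) hw ha ht
    (R := fun t => c * betaInt γ (Function.update z 1 w) α 0 (N + 3) a t +
        κ * betaInt γ (skip 1 z) (skip 1 α) 0 (N + 2) a t -
        C * betaInt γ (Function.update z 1 w) α 1 (N + 2) a t + Q t)
    (fun s hs => (hD s hs).mul_const _) ?_ ?_ fun s hs hS => ?_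
  · exact (((continuousOn_const.mul (continuousOn_betaInt hγ hu α 0 (N + 3) ha)).add
      (continuousOn_const.mul (continuousOn_betaInt hγ hsk _ 0 (N + 2) ha))).sub
      (continuousOn_const.mul (continuousOn_betaInt hγ hu α 1 (N + 2) ha))).add hQ
  · simp [betaInt_self, hQa]
  · have h1 := ((((hasDerivAt_betaInt hγ hu α 0 (N + 2) ha hs hS).const_mul c).add
      ((hasDerivAt_betaInt hγ hsk (skip 1 α) 0 (N + 1) ha hs hS).const_mul κ)).sub
      ((hasDerivAt_betaInt hγ hu α 1 (N + 1) ha hs hS).const_mul C)).add (hQ' s hs hS)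
    refine h1.congr_deriv ?_
    rw [add_zero, add_zero, formCoeff_skip_of_le γ z α (show 1 ≤ N + 1 by omega), add_assoc N 1 1,
      hA]
    ring

theorem hasDerivAt_betaInt_add_three (hγ : IsRegularPath S γ)
    (hz : ∀ i, ∀ t ∈ Ioo (0 : ℝ) 1, γ t ≠ z i) (α : ℕ → ℂ) (hw : w ∈ avoidSet γ) (h0 : z 0 ≠ w)
    (h2 : z 2 ≠ w) (ha : a ∈ Ioo (0 : ℝ) 1) (ht : t ∈ Ioo (0 : ℝ) 1) (N : ℕ) :
    HasDerivAt (fun w => betaInt γ (Function.update z 1 w) α 0 (N + 3) a t)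
      (((α 0 - α 1) / (z 0 - w) + (α 1 - α 2) / (z 2 - w)) *
          betaInt γ (Function.update z 1 w) α 0 (N + 3) a t +
        ((z 0 - w)⁻¹ - (z 2 - w)⁻¹) * betaInt γ (skip 1 z) (skip 1 α) 0 (N + 2) a t -
        (γ a - z 0) * formCoeff γ (Function.update z 1 w) α 0 a / (z 0 - w) *
          betaInt γ (Function.update z 1 w) α 1 (N + 2) a t +
        betaInt γ (skip 2 (Function.update z 1 w)) (skip 2 α) 0 (N + 2) a t / (z 2 - w)) w := by
  have hu := update_ne_path hz hw
  have hsk : ∀ i, ∀ t ∈ Ioo (0 : ℝ) 1, γ t ≠ skip 2 (Function.update z 1 w) i := fun i t ht => by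
    unfold skip; split_ifs <;> exact hu _ t ht
  have hQ : ∀ N, ContinuousOn (fun t => betaInt γ (skip 2 (Function.update z 1 w)) (skip 2 α) 0
      (N + 2) a t / (z 2 - w)) (Ioo 0 1) := fun N =>
    (continuousOn_betaInt hγ hsk (skip 2 α) 0 (N + 2) ha).div_const _
  have hQa : ∀ N, betaInt γ (skip 2 (Function.update z 1 w)) (skip 2 α) 0
      (N + 2) a a / (z 2 - w) = 0 := fun N => by rw [betaInt_self, zero_div]
  induction N generalizing t with
  | zero =>
    refine hasDerivAt_betaInt_step hγ hz α hw ha ht (N := 0)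
      (fun s hs => hasDerivAt_betaInt_two hγ hz α hw h0 h2 ha hs) (hQ 0) (hQa 0) fun s hs hS => ?_
    refine ((hasDerivAt_betaInt hγ hsk (skip 2 α) 0 1 ha hs hS).div_const _).congr_deriv ?_
    have e1 : betaInt γ (skip 2 (Function.update z 1 w)) (skip 2 α) 0 1 a s =
        betaInt γ (Function.update z 1 w) α 0 1 a s :=
      iterInt_congr 1 fun i hi t _ => by
        obtain rfl : i = 0 := by omega
        simp [formCoeff, skip]
    -- The boundary term at t merges with the next form: the powers of γ - z₂ cancel, which deletes
    -- z₂.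
    have e2 : formCoeff γ (skip 2 (Function.update z 1 w)) (skip 2 α) 1 s =
        (γ s - z 2) * formCoeff γ (Function.update z 1 w) α 1 s * formCoeff γ z α 2 s := by
      have n2 := sub_ne_zero.2 (hz 2 s hs)
      have hu1 : Function.update z 1 w 1 = w := by simp
      have hu2 : Function.update z 1 w 2 = z 2 := by simp
      have hu3 : Function.update z 1 w 3 = z 3 := by simp
      simp only [formCoeff, skip, Nat.one_lt_ofNat, if_true, one_add_one_eq_two, lt_irrefl, if_false,
        Nat.reduceAdd, hu1, hu2, hu3]
      rw [mul_comm (γ s - z 2), mul_assoc (Complex.exp _) _ (γ s - z 2), inv_mul_cancel₀ n2, mul_one,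
        ← mul_assoc, ← Complex.exp_add]
      congr 2
      ring
    rw [e1, add_zero, e2]
    ring
  | succ N ih =>
    refine hasDerivAt_betaInt_step hγ hz α hw ha ht (N := N + 1)
      (fun s hs => ih hs) (hQ (N + 1)) (hQa (N + 1)) fun s hs hS => ?_
    refine ((hasDerivAt_betaInt hγ hsk (skip 2 α) 0 (N + 2) ha hs hS).div_const _).congr_deriv ?_
    rw [add_zero, formCoeff_skip_of_le _ _ _ (by omega), formCoeff_update_of_le _ _ _ _ (by omega)]
    ring_nf

variable {y₀ y₁ : ℂ} {η₀ η₁ : ℤ} {K : ℝ} {ℓ₀ ℓ₁ : ℝ → ℂ} {m : ℕ}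

theorem IsPointSeq.skip {j : ℕ} (hz : IsPointSeq γ y₀ y₁ (m + 1) z) (h1 : 1 ≤ j) (h2 : j ≤ m) :
    IsPointSeq γ y₀ y₁ m (skip j z) where
  pos := h1.trans h2
  zero := by simp [BetaIntegral.skip, hz.zero, show 0 < j by omega]
  last i hi := by
    simp [BetaIntegral.skip, show ¬ i < j by omega, hz.last (i + 1) (by omega)]
  mid i hi him := by
    unfold BetaIntegral.skip
    split_ifs
    · exact hz.mid i hi (by omega)
    · exact hz.mid (i + 1) (by omega) (by omega)

theorem skip_mem_expDomain {j : ℕ} (hα : α ∈ expDomain η₀ η₁ (m + 1)) (h1 : 1 ≤ j) (h2 : j ≤ m) :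
    skip j α ∈ expDomain η₀ η₁ m := by
  have e0 : skip j α 0 = α 0 := by simp [skip, show 0 < j by omega]
  have em : skip j α m = α (m + 1) := by simp [skip, show ¬ m < j by omega]
  refine ⟨fun h => ?_, fun h k hk hkm => ?_, fun h => ?_, fun h k hk => ?_⟩
  · rw [e0]; exact hα.1 h
  · rw [e0]
    unfold skip
    split_ifs
    · exact hα.2.1 h k hk (by omega)
    · exact hα.2.1 h (k + 1) (by omega) (by omega)
  · rw [em]; exact hα.2.2.1 h
  · rw [em]
    unfold skip
    split_ifs
    · exact hα.2.2.2 h k (by omega)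
    · exact hα.2.2.2 h (k + 1) (by omega)

theorem skip_tail {j : ℕ} (h0 : ∀ i, m + 1 < i → α i = 0) (h2 : j ≤ m) :
    ∀ i, m < i → skip j α i = 0 := fun i hi => by
  simp [skip, show ¬ i < j by omega, h0 (i + 1) (by omega)]

theorem IsPointSeq.update (hz : IsPointSeq γ y₀ y₁ m z) (hm : 2 ≤ m) (hw : w ∈ avoidSet γ) :
    IsPointSeq γ y₀ y₁ m (Function.update z 1 w) where
  pos := hz.pos
  zero := by simp [hz.zero]
  last i hi := by rw [Function.update_of_ne (by omega)]; exact hz.last i hi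
  mid i hi him := by
    rcases eq_or_ne i 1 with rfl | h
    · rwa [Function.update_self]
    · rw [Function.update_of_ne h]; exact hz.mid i hi him

theorem IsPointSeq.isBetaFamily_update (hz : IsPointSeq γ y₀ y₁ m z) (hm : 2 ≤ m)
    (h0 : ∀ i, m < i → α i = 0) :
    IsBetaFamily γ y₀ y₁ m (avoidSet γ) (fun w => Function.update z 1 w) (fun _ => α) where
  isOpen := isOpen_avoidSet γ
  points w hw := hz.update hm hw
  tail _ _ := h0
  continuousOn_points i := by
    rcases eq_or_ne i 1 with rfl | h
    · simp only [Function.update_self]; exact continuousOn_id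
    · simp only [Function.update_of_ne h]; exact continuousOn_const
  continuousOn_exps _ := continuousOn_const

/-- The joint limit and the continuity of the limit function amount to locally uniform convergence.
By Weierstrass the limit is then holomorphic, and the derivatives converge to its derivative. -/
theorem IsBetaPath.tendstoLocallyUniformlyOn (h : IsBetaPath S γ y₀ y₁ η₀ η₁ K ℓ₀ ℓ₁)
    (hz : IsPointSeq γ y₀ y₁ m z) (hm : 2 ≤ m) (hα : α ∈ expDomain η₀ η₁ m)
    (h0 : ∀ i, m < i → α i = 0) :
    TendstoLocallyUniformlyOn
      (fun (ab : ℝ × ℝ) w => betaInt γ (Function.update z 1 w) α 0 m ab.1 ab.2)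
      (fun w => betaVal γ (Function.update z 1 w) α m) (𝓝[>] (0 : ℝ) ×ˢ 𝓝[<] (1 : ℝ))
      (avoidSet γ) := by
  have hF := hz.isBetaFamily_update hm h0
  rw [(isOpen_avoidSet γ).tendstoLocallyUniformlyOn_iff_forall_tendsto]
  intro w hw
  have h1 := h.tendsto_betaInt_prod hF hw hα
  have h2 : Tendsto (fun x : (ℝ × ℝ) × ℂ => betaVal γ (Function.update z 1 x.2) α m)
      ((𝓝[>] (0 : ℝ) ×ˢ 𝓝[<] (1 : ℝ)) ×ˢ 𝓝 w) (𝓝 (betaVal γ (Function.update z 1 w) α m)) :=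
    (((h.continuousOn_betaVal hF fun _ _ => hα).continuousAt
      ((isOpen_avoidSet γ).mem_nhds hw)).tendsto).comp tendsto_snd
  exact (h2.prodMk_nhds h1).mono_right (nhds_le_uniformity _)

theorem eventually_differentiableOn_betaInt (hγ : IsRegularPath S γ)
    (hz : ∀ i, ∀ t ∈ Ioo (0 : ℝ) 1, γ t ≠ z i) (α : ℕ → ℂ) (m : ℕ) :
    ∀ᶠ ab : ℝ × ℝ in 𝓝[>] (0 : ℝ) ×ˢ 𝓝[<] (1 : ℝ), DifferentiableOn ℂ
      (fun w => betaInt γ (Function.update z 1 w) α 0 m ab.1 ab.2) (avoidSet γ) := by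
  filter_upwards [prod_mem_prod (Ioo_mem_nhdsGT (zero_lt_one' ℝ))
        (Ioo_mem_nhdsLT (zero_lt_one' ℝ))] with ab hab
  exact (jointC1_betaInt_update hγ hz α 0 m hab.1).differentiableOn hab.2

/-- The complete integral is a holomorphic function of the first inner point. -/
theorem IsBetaPath.differentiableOn_betaVal (h : IsBetaPath S γ y₀ y₁ η₀ η₁ K ℓ₀ ℓ₁)
    (hz : IsPointSeq γ y₀ y₁ m z) (hm : 2 ≤ m) (hα : α ∈ expDomain η₀ η₁ m)
    (h0 : ∀ i, m < i → α i = 0) :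
    DifferentiableOn ℂ (fun w => betaVal γ (Function.update z 1 w) α m) (avoidSet γ) :=
  (h.tendstoLocallyUniformlyOn hz hm hα h0).differentiableOn
    (eventually_differentiableOn_betaInt h.regular (h.ne_point hz) α m) (isOpen_avoidSet γ)

theorem IsBetaPath.hasDerivAt_betaVal_of_tendsto (h : IsBetaPath S γ y₀ y₁ η₀ η₁ K ℓ₀ ℓ₁)
    (hz : IsPointSeq γ y₀ y₁ m z) (hm : 2 ≤ m) (hα : α ∈ expDomain η₀ η₁ m)
    (h0 : ∀ i, m < i → α i = 0) (hw : w ∈ avoidSet γ) {D : ℝ → ℝ → ℂ} {d : ℂ}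
    (hD : ∀ a ∈ Ioo (0 : ℝ) 1, ∀ b ∈ Ioo (0 : ℝ) 1,
      HasDerivAt (fun w => betaInt γ (Function.update z 1 w) α 0 m a b) (D a b) w)
    (hd : Tendsto (fun ab : ℝ × ℝ => D ab.1 ab.2) (𝓝[>] (0 : ℝ) ×ˢ 𝓝[<] (1 : ℝ)) (𝓝 d)) :
    HasDerivAt (fun w => betaVal γ (Function.update z 1 w) α m) d w := by
  have h1 := h.tendstoLocallyUniformlyOn hz hm hα h0
  have h2 := eventually_differentiableOn_betaInt h.regular (h.ne_point hz) α m
  have h3 := (h1.deriv h2 (isOpen_avoidSet γ)).tendsto_at hw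
  have h4 : deriv (fun w => betaVal γ (Function.update z 1 w) α m) w = d := by
    refine tendsto_nhds_unique h3 (hd.congr' ?_)
    filter_upwards [prod_mem_prod (Ioo_mem_nhdsGT (zero_lt_one' ℝ))
        (Ioo_mem_nhdsLT (zero_lt_one' ℝ))] with ab hab
    exact (hD ab.1 hab.1 ab.2 hab.2).deriv.symm
  rw [← h4]
  exact ((h.differentiableOn_betaVal hz hm hα h0).differentiableAt
    ((isOpen_avoidSet γ).mem_nhds hw)).hasDerivAt

theorem IsBetaPath.tendsto_boundary_left (h : IsBetaPath S γ y₀ y₁ η₀ η₁ K ℓ₀ ℓ₁)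
    (hz : IsPointSeq γ y₀ y₁ (m + 1) z) (hα : α ∈ expDomain η₀ η₁ (m + 1))
    (h0 : ∀ i, m + 1 < i → α i = 0) :
    Tendsto (fun ab : ℝ × ℝ => (γ ab.1 - y₀) * formCoeff γ z α 0 ab.1 *
      betaInt γ z α 1 m ab.1 ab.2) (𝓝[>] (0 : ℝ) ×ˢ 𝓝[<] (1 : ℝ)) (𝓝 0) := by
  have hF : IsBetaFamily γ y₀ y₁ (m + 1) (univ : Set ℂ) (fun _ => z) (fun _ => α) :=
    ⟨isOpen_univ, fun _ _ => hz, fun _ _ => h0, fun _ => continuousOn_const,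
      fun _ => continuousOn_const⟩
  have hl : ∀ j ≤ m, Tendsto (fun ab : ℝ × ℝ => (γ ab.1 - y₀) * formCoeff γ z α 0 ab.1 *
      betaInt γ z α 1 j ab.1 (1 / 2)) (𝓝[>] (0 : ℝ) ×ˢ 𝓝[<] (1 : ℝ)) (𝓝 0) := fun j hj => by
    have := (h.isEndFamily_left hF (mem_univ 0)).tendsto_boundary_left h.regular h.left
      (hF.exists_weight_left (mem_univ 0) h.left.eta hα) half_mem_unit (j := j) (by omega)
    simpa only [Function.comp_def] using
      this.comp (tendsto_fst (f := 𝓝[>] (0 : ℝ)) (g := 𝓝[<] (1 : ℝ)))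
  have hr : ∀ j ≤ m, ∃ v, Tendsto (fun ab : ℝ × ℝ => betaInt γ z α (j + 1) (m - j) (1 / 2) ab.2)
      (𝓝[>] (0 : ℝ) ×ˢ 𝓝[<] (1 : ℝ)) (𝓝 v) := fun j hj => by
    obtain ⟨v, hv⟩ := (h.isEndFamily_right hF (mem_univ 0)).exists_tendsto_right h.regular h.right
      (hF.exists_weight_right (mem_univ 0) h.right.eta hα) half_mem_unit (k := j + 1) (by omega)
    have := hv.comp ((tendsto_snd (f := 𝓝[>] (0 : ℝ)) (g := 𝓝[<] (1 : ℝ))).prodMk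
      (tendsto_const_nhds (x := (0 : ℂ))))
    refine ⟨v, ?_⟩
    rw [show m - j = m + 1 - (j + 1) by omega]
    simpa only [Function.comp_def] using this
  choose! v hv using hr
  have key := tendsto_finsetSum (Finset.range (m + 1)) fun j hj =>
    (hl j (Nat.lt_succ_iff.1 (Finset.mem_range.1 hj))).mul
      (hv j (Nat.lt_succ_iff.1 (Finset.mem_range.1 hj)))
  simp only [zero_mul, Finset.sum_const_zero] at key
  refine key.congr' ?_
  filter_upwards [prod_mem_prod (Ioo_mem_nhdsGT (zero_lt_one' ℝ))
    (Ioo_mem_nhdsLT (zero_lt_one' ℝ))] with ab hab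
  rw [betaInt_comp h.regular (h.ne_point hz) α 1 m hab.1 half_mem_unit hab.2, Finset.mul_sum]
  exact Finset.sum_congr rfl fun j _ => by ring

theorem IsBetaPath.tendsto_boundary_right (h : IsBetaPath S γ y₀ y₁ η₀ η₁ K ℓ₀ ℓ₁)
    (hz : IsPointSeq γ y₀ y₁ 2 z) (hα : α ∈ expDomain η₀ η₁ 2) (h0 : ∀ i, 2 < i → α i = 0) :
    Tendsto (fun ab : ℝ × ℝ => betaInt γ z α 0 1 ab.1 ab.2 *
      ((γ ab.2 - y₁) * formCoeff γ z α 1 ab.2)) (𝓝[>] (0 : ℝ) ×ˢ 𝓝[<] (1 : ℝ)) (𝓝 0) := by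
  have hF : IsBetaFamily γ y₀ y₁ 2 (univ : Set ℂ) (fun _ => z) (fun _ => α) :=
    ⟨isOpen_univ, fun _ _ => hz, fun _ _ => h0, fun _ => continuousOn_const,
      fun _ => continuousOn_const⟩
  have hr : ∀ k ≤ 1, Tendsto (fun ab : ℝ × ℝ => (γ ab.2 - y₁) * formCoeff γ z α 1 ab.2 *
      betaInt γ z α k (1 - k) (1 / 2) ab.2) (𝓝[>] (0 : ℝ) ×ˢ 𝓝[<] (1 : ℝ)) (𝓝 0) := fun k hk => by
    have := (h.isEndFamily_right hF (mem_univ 0)).tendsto_boundary_right h.regular h.right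
      (hF.exists_weight_right (mem_univ 0) h.right.eta hα) half_mem_unit hk
    simpa only [Function.comp_def] using
      this.comp (tendsto_snd (f := 𝓝[>] (0 : ℝ)) (g := 𝓝[<] (1 : ℝ)))
  obtain ⟨v, hv⟩ := (h.isEndFamily_left hF (mem_univ 0)).exists_tendsto_left h.regular h.left
    (hF.exists_weight_left (mem_univ 0) h.left.eta hα) half_mem_unit (show 1 ≤ 2 by omega)
  have hv' := hv.comp ((tendsto_fst (f := 𝓝[>] (0 : ℝ)) (g := 𝓝[<] (1 : ℝ))).prodMk
    (tendsto_const_nhds (x := (0 : ℂ))))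
  simp only [Function.comp_def] at hv'
  have key := (hr 0 zero_le_one).add (hv'.mul (hr 1 le_rfl))
  rw [mul_zero, add_zero] at key
  refine key.congr' ?_
  filter_upwards [prod_mem_prod (Ioo_mem_nhdsGT (zero_lt_one' ℝ))
    (Ioo_mem_nhdsLT (zero_lt_one' ℝ))] with ab hab
  rw [betaInt_comp h.regular (h.ne_point hz) α 0 1 hab.1 half_mem_unit hab.2,
    Finset.sum_range_succ, Finset.sum_range_one]
  simp only [betaInt_zero, Nat.sub_zero, Nat.sub_self, zero_add, one_mul, mul_one]
  ring

/-- The differential equation in the first inner point, in the case of one inner point. -/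
theorem IsBetaPath.hasDerivAt_betaVal_two (h : IsBetaPath S γ y₀ y₁ η₀ η₁ K ℓ₀ ℓ₁)
    (hz : IsPointSeq γ y₀ y₁ 2 z) (hα : α ∈ expDomain η₀ η₁ 2) (h0 : ∀ i, 2 < i → α i = 0)
    (hw : w ∈ avoidSet γ) (hw0 : z 0 ≠ w) (hw2 : z 2 ≠ w) :
    HasDerivAt (fun w => betaVal γ (Function.update z 1 w) α 2)
      (((α 0 - α 1) / (z 0 - w) + (α 1 - α 2) / (z 2 - w)) *
          betaVal γ (Function.update z 1 w) α 2 +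
        ((z 0 - w)⁻¹ - (z 2 - w)⁻¹) * betaVal γ (skip 1 z) (skip 1 α) 1) w := by
  have hzu := hz.update le_rfl hw
  refine h.hasDerivAt_betaVal_of_tendsto hz le_rfl hα h0 hw (fun a ha b hb =>
    hasDerivAt_betaInt_two h.regular (h.ne_point hz) α hw hw0 hw2 ha hb) ?_
  have t1 := h.tendsto_betaInt hzu hα h0
  have t2 := h.tendsto_betaInt (hz.skip (m := 1) le_rfl le_rfl) (skip_mem_expDomain hα le_rfl le_rfl)
    (skip_tail h0 le_rfl)
  have t3 := h.tendsto_boundary_left (m := 1) hzu hα h0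
  have t4 := h.tendsto_boundary_right hzu hα h0
  have key := (((t1.const_mul ((α 0 - α 1) / (z 0 - w) + (α 1 - α 2) / (z 2 - w))).add
    (t2.const_mul ((z 0 - w)⁻¹ - (z 2 - w)⁻¹))).sub (t3.div_const (z 0 - w))).add
    (t4.div_const (z 2 - w))
  rw [zero_div, zero_div, sub_zero, add_zero] at key
  refine key.congr fun ab => ?_
  rw [hz.zero, hz.last 2 le_rfl]
  ring

/-- The differential equation in the first inner point, in the case of several inner points. -/
theorem IsBetaPath.hasDerivAt_betaVal_add_three (h : IsBetaPath S γ y₀ y₁ η₀ η₁ K ℓ₀ ℓ₁) {N : ℕ}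
    (hz : IsPointSeq γ y₀ y₁ (N + 3) z) (hα : α ∈ expDomain η₀ η₁ (N + 3))
    (h0 : ∀ i, N + 3 < i → α i = 0)
    (hw : w ∈ avoidSet γ) (hw0 : z 0 ≠ w) (hw2 : z 2 ≠ w) :
    HasDerivAt (fun w => betaVal γ (Function.update z 1 w) α (N + 3))
      (((α 0 - α 1) / (z 0 - w) + (α 1 - α 2) / (z 2 - w)) *
          betaVal γ (Function.update z 1 w) α (N + 3) +
        ((z 0 - w)⁻¹ - (z 2 - w)⁻¹) * betaVal γ (skip 1 z) (skip 1 α) (N + 2) +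
        betaVal γ (skip 2 (Function.update z 1 w)) (skip 2 α) (N + 2) / (z 2 - w)) w := by
  have hzu := hz.update (by omega) hw
  refine h.hasDerivAt_betaVal_of_tendsto hz (by omega) hα h0 hw (fun a ha b hb =>
    hasDerivAt_betaInt_add_three h.regular (h.ne_point hz) α hw hw0 hw2 ha hb N) ?_
  have t1 := h.tendsto_betaInt hzu hα h0
  have t2 := h.tendsto_betaInt (hz.skip (m := N + 2) (j := 1) (by omega) (by omega))
    (skip_mem_expDomain (m := N + 2) (j := 1) hα (by omega) (by omega))
    (skip_tail (m := N + 2) (j := 1) h0 (by omega))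
  have t3 := h.tendsto_boundary_left (m := N + 2) hzu hα h0
  have t4 := h.tendsto_betaInt (hzu.skip (m := N + 2) (j := 2) (by omega) (by omega))
    (skip_mem_expDomain (m := N + 2) (j := 2) hα (by omega) (by omega))
    (skip_tail (m := N + 2) (j := 2) h0 (by omega))
  have key := (((t1.const_mul ((α 0 - α 1) / (z 0 - w) + (α 1 - α 2) / (z 2 - w))).add
    (t2.const_mul ((z 0 - w)⁻¹ - (z 2 - w)⁻¹))).sub (t3.div_const (z 0 - w))).add
    (t4.div_const (z 2 - w))
  rw [zero_div, sub_zero] at key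
  refine key.congr fun ab => ?_
  rw [hz.zero]
  ring

end

/-! ### Connectedness and the identity theorem on the Riemann sphere -/

theorem isPreconnected_norm_gt {R : ℝ} (hR : 0 < R) : IsPreconnected {w : ℂ | R < ‖w‖} := by
  have h : {w : ℂ | R < ‖w‖} = Complex.exp '' {s : ℂ | Real.log R < s.re} := by
    ext w
    simp only [mem_ofPred_eq, mem_image]
    constructor
    · intro hw
      have hw0 : w ≠ 0 := norm_pos_iff.1 (hR.trans hw)
      refine ⟨Complex.log w, ?_, Complex.exp_log hw0⟩
      rw [Complex.log_re]
      exact Real.log_lt_log hR hw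
    · rintro ⟨s, hs, rfl⟩
      rw [Complex.norm_exp]
      exact (Real.log_lt_iff_lt_exp hR).1 hs
  rw [h]
  exact ((convex_halfSpace_re_gt _).isPreconnected).image _ Complex.continuous_exp.continuousOn

theorem exists_norm_gt_subset {O : Set (OnePoint ℂ)} (hO : O ∈ 𝓝 OnePoint.infty) :
    ∃ R > 0, ∀ w : ℂ, R < ‖w‖ → (w : OnePoint ℂ) ∈ O := by
  have h : ∀ᶠ w : ℂ in coclosedCompact ℂ, (w : OnePoint ℂ) ∈ O := by
    rw [← OnePoint.comap_coe_nhds_infty]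
    exact preimage_mem_comap hO
  rw [coclosedCompact_eq_cocompact, ← Metric.cobounded_eq_cocompact] at h
  obtain ⟨R, -, hR⟩ := (hasBasis_cobounded_norm (E := ℂ)).mem_iff.1 h
  exact ⟨max R 1, lt_of_lt_of_le one_pos (le_max_right _ _), fun w hw =>
    hR ((le_max_left _ _).trans hw.le)⟩

theorem norm_gt_mem_cocompact (R : ℝ) : {w : ℂ | R < ‖w‖} ∈ cocompact ℂ := by
  rw [← Metric.cobounded_eq_cocompact]
  exact (hasBasis_cobounded_norm (E := ℂ)).mem_iff.2 ⟨R + 1, trivial, fun w hw => by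
    have : R + 1 ≤ ‖w‖ := hw
    show R < ‖w‖
    linarith⟩

/-- W is a disc around a finite point, and the exterior of a disc if the point is ∞. The point ∞
itself is left out of W because functions are given on ℂ only; it remains in the closure. -/
theorem exists_preconnected_nhds {O : Set (OnePoint ℂ)} (hO : IsOpen O) {y : OnePoint ℂ}
    (hy : y ∈ O) : ∃ W : Set ℂ, IsOpen W ∧ IsPreconnected W ∧ (∀ w ∈ W, (w : OnePoint ℂ) ∈ O) ∧
      (fun w : ℂ => (w : OnePoint ℂ)) '' W ∪ {y} ∈ 𝓝 y ∧ (∀ w : ℂ, (w : OnePoint ℂ) = y → w ∈ W) ∧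
      y ∈ closure ((fun w : ℂ => (w : OnePoint ℂ)) '' W) := by
  induction y using OnePoint.rec with
  | infty =>
    obtain ⟨R, hR, h⟩ := exists_norm_gt_subset (hO.mem_nhds hy)
    refine ⟨{w | R < ‖w‖}, isOpen_lt continuous_const continuous_norm, isPreconnected_norm_gt hR,
      fun w hw => h w hw, ?_, fun w hw => absurd hw (OnePoint.coe_ne_infty w), ?_⟩
    · rw [OnePoint.nhds_infty_eq, coclosedCompact_eq_cocompact]
      refine mem_sup.2 ⟨?_, mem_pure.2 (Or.inr rfl)⟩
      exact mem_map.2 (mem_of_superset (norm_gt_mem_cocompact R) fun w hw => Or.inl ⟨w, hw, rfl⟩)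
    · rw [mem_closure_iff_nhds]
      intro t ht
      have h1 : (fun w : ℂ => (w : OnePoint ℂ)) ⁻¹' t ∈ cocompact ℂ := by
        rw [← coclosedCompact_eq_cocompact, ← OnePoint.comap_coe_nhds_infty]
        exact preimage_mem_comap ht
      obtain ⟨w, hw1, hw2⟩ := Filter.nonempty_of_mem (inter_mem h1 (norm_gt_mem_cocompact R))
      exact ⟨w, hw1, w, hw2, rfl⟩
  | coe y =>
    have h1 : (fun w : ℂ => (w : OnePoint ℂ)) ⁻¹' O ∈ 𝓝 y :=
      OnePoint.continuous_coe.continuousAt.preimage_mem_nhds (hO.mem_nhds hy)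
    obtain ⟨r, hr, hrO⟩ := Metric.mem_nhds_iff.1 h1
    refine ⟨Metric.ball y r, Metric.isOpen_ball, (convex_ball y r).isPreconnected,
      fun w hw => hrO hw, ?_, fun w hw => ?_, subset_closure ⟨y, Metric.mem_ball_self hr, rfl⟩⟩
    · rw [OnePoint.nhds_coe_eq]
      exact mem_map.2 (mem_of_superset (Metric.ball_mem_nhds y hr) fun w hw => Or.inl ⟨w, hw, rfl⟩)
    · rw [OnePoint.coe_eq_coe.1 hw]; exact Metric.mem_ball_self hr

/-- Adding y to W gives a neighbourhood that lies between a connected set and its closure, hence is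
connected and stays in the component. -/
theorem isOpen_connectedComponentIn_onePoint {O : Set (OnePoint ℂ)} (hO : IsOpen O)
    (x : OnePoint ℂ) : IsOpen (connectedComponentIn O x) := by
  rw [isOpen_iff_mem_nhds]
  intro y hy
  have hyO := connectedComponentIn_subset O x hy
  obtain ⟨W, -, hWc, hWO, hWn, -, hcl⟩ := exists_preconnected_nhds hO hyO
  refine mem_of_superset hWn ?_
  rw [connectedComponentIn_eq hy]
  refine IsPreconnected.subset_connectedComponentIn ?_ (Or.inr rfl) ?_
  · refine (hWc.image _ OnePoint.continuous_coe.continuousOn).subset_closure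
      subset_union_left (union_subset subset_closure (singleton_subset_iff.2 hcl))
  · rintro _ (⟨w, hw, rfl⟩ | rfl)
    · exact hWO w hw
    · exact hyO

/-- Identity theorem on a connected open subset of the Riemann sphere. -/
theorem eq_zero_of_eventually_eq_zero {C : Set (OnePoint ℂ)} (hC : IsOpen C)
    (hCc : IsPreconnected C) {g : ℂ → ℂ} (hg : AnalyticOnNhd ℂ g {w | (w : OnePoint ℂ) ∈ C})
    {y : OnePoint ℂ} (hy : y ∈ C) (hgy : ∀ᶠ y' in 𝓝 y, ∀ w : ℂ, (w : OnePoint ℂ) = y' → g w = 0)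
    {w : ℂ} (hw : (w : OnePoint ℂ) ∈ C) : g w = 0 := by
  -- The open sets u, near whose points g vanishes, and v, the exterior of u, are disjoint. They
  -- cover C because g vanishes on all of a connected W that meets u.
  set u : Set (OnePoint ℂ) := {y | ∀ᶠ y' in 𝓝 y, ∀ w : ℂ, (w : OnePoint ℂ) = y' → g w = 0} with hu
  set v : Set (OnePoint ℂ) := {y | ∀ᶠ y' in 𝓝 y, y' ∉ u} with hv
  have hsub : C ⊆ u ∪ v := by
    intro y hy
    by_contra hyn
    have hyu : y ∉ u := fun h => hyn (Or.inl h)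
    have hyv : y ∉ v := fun h => hyn (Or.inr h)
    obtain ⟨W, hWo, hWc, hWC, hWn, hWy, -⟩ := exists_preconnected_nhds hC hy
    have h1 : ∃ᶠ y' in 𝓝 y, y' ∈ u := fun h => hyv h
    obtain ⟨y', hy'u, hy'W⟩ := (h1.and_eventually hWn).exists
    rcases hy'W with ⟨w, hw, rfl⟩ | rfl
    · have h2 : g =ᶠ[𝓝 w] 0 :=
        (OnePoint.continuous_coe.tendsto w).eventually hy'u |>.mono fun w' h => h w' rfl
      have h3 := AnalyticOnNhd.eqOn_zero_of_preconnected_of_eventuallyEq_zero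
        (hg.mono fun w hw => hWC w hw) hWc hw h2
      refine hyu (mem_of_superset hWn ?_)
      rintro _ (⟨w, hw, rfl⟩ | rfl) w' hw'
      · rw [OnePoint.coe_eq_coe.1 hw']; exact h3 hw
      · exact h3 (hWy w' hw')
    · exact hyu hy'u
  have huo : IsOpen u := isOpen_iff_mem_nhds.2 fun y hy => eventually_eventually_nhds.2 hy
  have hvo : IsOpen v := isOpen_iff_mem_nhds.2 fun y hy => eventually_eventually_nhds.2 hy
  have hdisj : Disjoint u v := Set.disjoint_left.2 fun y hyu hyv => (hyv.self_of_nhds) hyu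
  have := hCc.subset_left_of_subset_union huo hvo hdisj hsub ⟨y, hy, hgy⟩ hw
  exact this.self_of_nhds w rfl

/-! ### Holomorphic solutions of first order equations near a regular singular point -/

/-- If g is not zero, write g = (w - y)^n u with u(y) ≠ 0. Comparing the leading terms of the
equation gives A = -n, which is excluded. -/
theorem eventually_eq_zero_of_regular_singular {g k : ℂ → ℂ} {y A : ℂ} (hg : AnalyticAt ℂ g y)
    (hk : ContinuousAt k y) (hA : ∀ n : ℤ, A ≠ n)
    (h : ∀ᶠ w in 𝓝[≠] y, (y - w) * deriv g w = (A + (y - w) * k w) * g w) :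
    ∀ᶠ w in 𝓝 y, g w = 0 := by
  by_contra hne
  obtain ⟨n, u, hu, huy, hgu⟩ := (hg.exists_eventuallyEq_pow_smul_nonzero_iff).2 hne
  have h1 : ∀ᶠ w in 𝓝[≠] y, -(n : ℂ) * u w + (y - w) * deriv u w = (A + (y - w) * k w) * u w := by
    have h2 : ∀ᶠ w in 𝓝[≠] y, ∀ᶠ w' in 𝓝 w, g w' = (w' - y) ^ n • u w' :=
      (eventually_eventually_nhds.2 hgu).filter_mono nhdsWithin_le_nhds
    have h3 : ∀ᶠ w in 𝓝[≠] y, AnalyticAt ℂ u w :=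
      hu.eventually_analyticAt.filter_mono nhdsWithin_le_nhds
    filter_upwards [h, h2, h3, self_mem_nhdsWithin] with w h4 h5 h6 h7
    have h8 : w - y ≠ 0 := sub_ne_zero.2 h7
    have h9 : HasDerivAt (fun w => (w - y) ^ n * u w)
        (n * (w - y) ^ (n - 1) * 1 * u w + (w - y) ^ n * deriv u w) w :=
      (((hasDerivAt_id w).sub_const y).pow n).mul h6.differentiableAt.hasDerivAt
    have h10 : deriv g w = n * (w - y) ^ (n - 1) * 1 * u w + (w - y) ^ n * deriv u w := by
      rw [EventuallyEq.deriv_eq (f := fun w => (w - y) ^ n * u w) (h5.mono fun _ h => h), h9.deriv]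
    rw [h10, h5.self_of_nhds, smul_eq_mul] at h4
    have h11 : (n : ℂ) * (w - y) ^ (n - 1) * (y - w) = -n * (w - y) ^ n := by
      rcases Nat.eq_zero_or_pos n with rfl | hn
      · simp
      · obtain ⟨l, rfl⟩ : ∃ l, n = l + 1 := ⟨n - 1, by omega⟩
        rw [Nat.add_sub_cancel, pow_succ]; ring
    have h12 : (w - y) ^ n ≠ 0 := pow_ne_zero n h8
    refine mul_left_cancel₀ h12 ?_
    linear_combination h4 - u w * h11
  have hyw : Tendsto (fun w => y - w) (𝓝[≠] y) (𝓝 (y - y)) :=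
    (tendsto_const_nhds.sub tendsto_id).mono_left nhdsWithin_le_nhds
  have hu1 : Tendsto u (𝓝[≠] y) (𝓝 (u y)) := hu.continuousAt.tendsto.mono_left nhdsWithin_le_nhds
  have hu2 : Tendsto (deriv u) (𝓝[≠] y) (𝓝 (deriv u y)) :=
    hu.deriv.continuousAt.tendsto.mono_left nhdsWithin_le_nhds
  have hk' : Tendsto k (𝓝[≠] y) (𝓝 (k y)) := hk.tendsto.mono_left nhdsWithin_le_nhds
  have h13 := tendsto_nhds_unique_of_eventuallyEq ((hu1.const_mul (-(n : ℂ))).add (hyw.mul hu2))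
    (((hyw.mul hk').const_add A).mul hu1) h1
  rw [sub_self, zero_mul, zero_mul, add_zero, add_zero] at h13
  have h14 := mul_right_cancel₀ huy h13
  refine hA (-n) ?_
  rw [← h14]; simp

/-- The product (w - x₀)^A (w - x₁)^B g is constant in the coordinate s with w = exp s. As g is
single-valued, s + 2πi multiplies this constant by exp(2πi(A + B)) ≠ 1, so the constant is zero. -/
theorem eventually_eq_zero_of_regular_singular_infty {g : ℂ → ℂ} {x₀ x₁ A B : ℂ} {R : ℝ}
    (hR : 0 < R) (hx₀ : ‖x₀‖ ≤ R) (hx₁ : ‖x₁‖ ≤ R)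
    (hg : ∀ w, R < ‖w‖ → HasDerivAt g ((A / (x₀ - w) + B / (x₁ - w)) * g w) w)
    (hAB : ∀ n : ℤ, A + B ≠ n) {w : ℂ} (hw : R < ‖w‖) : g w = 0 := by
  set H : Set ℂ := {s | Real.log R < s.re} with hH
  have hHn : ∀ s ∈ H, R < ‖Complex.exp s‖ := fun s hs => by
    rw [Complex.norm_exp]; exact (Real.log_lt_iff_lt_exp hR).1 hs
  have hlog : ∀ x, ‖x‖ ≤ R → ∀ s ∈ H, 1 - x * Complex.exp (-s) ∈ Complex.slitPlane := by
    intro x hx s hs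
    left
    have h1 : ‖x * Complex.exp (-s)‖ < 1 := by
      rw [norm_mul, Complex.exp_neg, norm_inv, ← div_eq_mul_inv, div_lt_one (hR.trans (hHn s hs))]
      exact hx.trans_lt (hHn s hs)
    have h2 := (abs_le.1 (Complex.abs_re_le_norm (x * Complex.exp (-s)))).2
    rw [Complex.sub_re, Complex.one_re]
    linarith
  have hdl : ∀ x, ‖x‖ ≤ R → ∀ s ∈ H, HasDerivAt (fun s => Complex.log (1 - x * Complex.exp (-s)))
      (x * Complex.exp (-s) / (1 - x * Complex.exp (-s))) s := fun x hx s hs => by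
    have h1 := (((((hasDerivAt_id s).fun_neg).cexp).const_mul x).const_sub 1).clog (hlog x hx s hs)
    exact h1.congr_deriv (by simp)
  set G : ℂ → ℂ := fun s => Complex.exp ((A + B) * s + A * Complex.log (1 - x₀ * Complex.exp (-s)) +
    B * Complex.log (1 - x₁ * Complex.exp (-s))) * g (Complex.exp s) with hG
  have hGd : ∀ s ∈ H, HasDerivAt G 0 s := fun s hs => by
    have h1 := ((((hasDerivAt_id s).const_mul (A + B)).add ((hdl x₀ hx₀ s hs).const_mul A)).add
      ((hdl x₁ hx₁ s hs).const_mul B)).cexp.mul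
      ((hg _ (hHn s hs)).comp s (Complex.hasDerivAt_exp s))
    refine h1.congr_deriv ?_
    have n0 := Complex.slitPlane_ne_zero (hlog x₀ hx₀ s hs)
    have n1 := Complex.slitPlane_ne_zero (hlog x₁ hx₁ s hs)
    have e : ∀ x, 1 - x * Complex.exp (-s) ≠ 0 → x - Complex.exp s ≠ 0 ∧
        x * Complex.exp (-s) / (1 - x * Complex.exp (-s)) =
          -1 - Complex.exp s / (x - Complex.exp s) := fun x hx => by
      have hs0 := Complex.exp_ne_zero s
      have h2 : x - Complex.exp s ≠ 0 := fun h => hx (by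
        rw [sub_eq_zero.1 h, ← Complex.exp_add, add_neg_cancel, Complex.exp_zero, sub_self])
      refine ⟨h2, ?_⟩
      rw [Complex.exp_neg] at hx ⊢
      have h3 : Complex.exp s - x ≠ 0 := fun h => h2 (by linear_combination -h)
      have h4 : 1 - x * (Complex.exp s)⁻¹ = (Complex.exp s - x) / Complex.exp s := by field_simp
      rw [h4]
      field_simp
      ring
    rw [(e x₀ n0).2, (e x₁ n1).2]
    simp only [Function.comp_apply]
    ring
  have hzero : ∀ s ∈ H, G s = 0 := fun s hs => by
    have hs' : s + logPeriod ∈ H := by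
      rw [hH, mem_ofPred_eq, Complex.add_re, logPeriod_re, add_zero]; exact hs
    have hconst : G (s + logPeriod) = G s :=
      eqOn_of_hasDerivAt (convex_halfSpace_re_gt _) hGd (fun w _ => hasDerivAt_const w (G s)) hs rfl hs'
    have hper : G (s + logPeriod) = Complex.exp (logPeriod * (A + B)) * G s := by
      have e1 : Complex.exp (s + logPeriod) = Complex.exp s := Complex.exp_periodic s
      have e2 : Complex.exp (-(s + logPeriod)) = Complex.exp (-s) := by
        rw [Complex.exp_neg, e1, Complex.exp_neg]
      simp only [hG, e1, e2]
      rw [← mul_assoc, ← Complex.exp_add]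
      congr 2
      ring
    rw [hconst] at hper
    by_contra hne
    have h1 : Complex.exp (logPeriod * (A + B)) = 1 := by
      have : (Complex.exp (logPeriod * (A + B)) - 1) * G s = 0 := by linear_combination -hper
      exact sub_eq_zero.1 ((mul_eq_zero.1 this).resolve_right hne)
    obtain ⟨n, hn⟩ := Complex.exp_eq_one_iff.1 h1
    refine hAB n (mul_right_cancel₀ Complex.two_pi_I_ne_zero ?_)
    rw [← hn, logPeriod]; ring
  have hw0 : w ≠ 0 := norm_pos_iff.1 (hR.trans hw)
  have h1 := hzero (Complex.log w) (by
    rw [hH, mem_ofPred_eq, Complex.log_re]; exact Real.log_lt_log hR hw)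
  simp only [hG, Complex.exp_log hw0] at h1
  exact (mul_eq_zero.1 h1).resolve_left (Complex.exp_ne_zero _)

/-! ### Translation invariance on the domain of convergence -/

/-- The outer exponents. -/
def outer (m : ℕ) (α : ℕ → ℂ) (i : ℕ) : ℂ := if i = 0 then α 0 else if i = 1 then α m else 0

/-- Simultaneous translation of the first `m + 1` exponents. -/
def shift (lam : ℂ) (m : ℕ) (α : ℕ → ℂ) (i : ℕ) : ℂ := if i ≤ m then α i + lam else 0

/-- The point sequence without inner points. -/
def endPoints (y₀ y₁ : ℂ) (i : ℕ) : ℂ := if i = 0 then y₀ else y₁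

/-- Translation invariance of the normalized integral with `m - 1` inner points in `C`. -/
def IsInvariant (γ : ℝ → ℂ) (y₀ y₁ : ℂ) (η₀ η₁ : ℤ) (C : Set (OnePoint ℂ)) (m : ℕ) : Prop :=
  ∀ (z α : ℕ → ℂ) (lam : ℂ), IsPointSeq γ y₀ y₁ m z →
    (∀ i, 1 ≤ i → i < m → (z i : OnePoint ℂ) ∈ C) → (∀ i, m < i → α i = 0) →
    α ∈ expDomain η₀ η₁ m → shift lam m α ∈ expDomain η₀ η₁ m →
    betaVal γ z α m * betaVal γ (endPoints y₀ y₁) (outer m (shift lam m α)) 1 =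
      betaVal γ z (shift lam m α) m * betaVal γ (endPoints y₀ y₁) (outer m α) 1

section

variable {S : Set ℝ} {γ : ℝ → ℂ} {z α : ℕ → ℂ} {w lam : ℂ} {y₀ y₁ : ℂ} {η₀ η₁ : ℤ} {K : ℝ}
  {ℓ₀ ℓ₁ : ℝ → ℂ} {m : ℕ} {C : Set (OnePoint ℂ)}

theorem isPointSeq_endPoints (γ : ℝ → ℂ) (y₀ y₁ : ℂ) :
    IsPointSeq γ y₀ y₁ 1 (endPoints y₀ y₁) where
  pos := le_rfl
  zero := rfl
  last i hi := by simp [endPoints, show i ≠ 0 by omega]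
  mid i h1 h2 := by omega

theorem outer_mem_expDomain (hm : 1 ≤ m) (hα : α ∈ expDomain η₀ η₁ m) :
    outer m α ∈ expDomain η₀ η₁ 1 := by
  refine ⟨fun h => hα.1 h, fun h k hk hk1 => ?_, fun h => hα.2.2.1 h, fun h k hk => ?_⟩
  · obtain rfl : k = 1 := by omega
    exact hα.2.1 h m hm le_rfl
  · obtain rfl : k = 0 := by omega
    exact hα.2.2.2 h 0 (by omega)

theorem outer_tail (m : ℕ) (α : ℕ → ℂ) : ∀ i, 1 < i → outer m α i = 0 := fun i hi => by
  simp [outer, show i ≠ 0 by omega, show i ≠ 1 by omega]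

theorem shift_tail (lam : ℂ) (m : ℕ) (α : ℕ → ℂ) : ∀ i, m < i → shift lam m α i = 0 :=
  fun i hi => by simp [shift, not_le.2 hi]

theorem skip_shift {j : ℕ} (hj : j ≤ m) :
    skip j (shift lam (m + 1) α) = shift lam m (skip j α) := by
  ext i
  by_cases hi : i < j
  · simp [skip, shift, hi, show i ≤ m + 1 by omega, show i ≤ m by omega]
  · simp [skip, shift, hi]

theorem outer_skip {j : ℕ} (h1 : 1 ≤ j) (hj : j ≤ m) :
    outer m (skip j α) = outer (m + 1) α := by
  ext i
  simp [outer, skip, show 0 < j by omega, show ¬ m < j by omega]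

theorem IsInvariant.one (γ : ℝ → ℂ) (y₀ y₁ : ℂ) (η₀ η₁ : ℤ) (C : Set (OnePoint ℂ)) :
    IsInvariant γ y₀ y₁ η₀ η₁ C 1 := by
  intro z α lam hz _ h0 _ _
  have e : ∀ α : ℕ → ℂ, (∀ i, 1 < i → α i = 0) → outer 1 α = α := fun α h => by
    ext i
    unfold outer
    split_ifs with h1 h2
    · rw [h1]
    · rw [h2]
    · exact (h i (by omega)).symm
  have ez : z = endPoints y₀ y₁ := by
    ext i
    unfold endPoints
    split_ifs with h1
    · rw [h1, hz.zero]
    · exact hz.last i (by omega)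
  rw [e _ (shift_tail lam 1 α), e _ h0, ez, mul_comm]

theorem shift_sub {i j : ℕ} (hi : i ≤ m) (hj : j ≤ m) :
    shift lam m α i - shift lam m α j = α i - α j := by
  simp [shift, hi, hj]

/-- The coefficients of the differential equation depend only on differences of exponents, hence are
the same for α and α + λ. The inhomogeneous terms have one inner point less and cancel by the
induction hypothesis. -/
theorem IsInvariant.hasDerivAt (h : IsBetaPath S γ y₀ y₁ η₀ η₁ K ℓ₀ ℓ₁)
    (hCa : ∀ w : ℂ, (w : OnePoint ℂ) ∈ C → w ∈ avoidSet γ) {N : ℕ}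
    (ih : IsInvariant γ y₀ y₁ η₀ η₁ C (N + 1)) (hz : IsPointSeq γ y₀ y₁ (N + 2) z)
    (hzC : ∀ i, 1 ≤ i → i < N + 2 → (z i : OnePoint ℂ) ∈ C) (h0 : ∀ i, N + 2 < i → α i = 0)
    (hα : α ∈ expDomain η₀ η₁ (N + 2)) (hβ : shift lam (N + 2) α ∈ expDomain η₀ η₁ (N + 2))
    (hw : (w : OnePoint ℂ) ∈ C) (hw0 : z 0 ≠ w) (hw2 : z 2 ≠ w) :
    HasDerivAt (fun w => betaVal γ (Function.update z 1 w) α (N + 2) *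
        betaVal γ (endPoints y₀ y₁) (outer (N + 2) (shift lam (N + 2) α)) 1 -
        betaVal γ (Function.update z 1 w) (shift lam (N + 2) α) (N + 2) *
          betaVal γ (endPoints y₀ y₁) (outer (N + 2) α) 1)
      (((α 0 - α 1) / (z 0 - w) + (α 1 - α 2) / (z 2 - w)) *
        (betaVal γ (Function.update z 1 w) α (N + 2) *
          betaVal γ (endPoints y₀ y₁) (outer (N + 2) (shift lam (N + 2) α)) 1 -
        betaVal γ (Function.update z 1 w) (shift lam (N + 2) α) (N + 2) *
          betaVal γ (endPoints y₀ y₁) (outer (N + 2) α) 1)) w := by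
  have hwa := hCa w hw
  have hs1 : betaVal γ (skip 1 z) (skip 1 α) (N + 1) *
      betaVal γ (endPoints y₀ y₁) (outer (N + 2) (shift lam (N + 2) α)) 1 =
      betaVal γ (skip 1 z) (skip 1 (shift lam (N + 2) α)) (N + 1) *
      betaVal γ (endPoints y₀ y₁) (outer (N + 2) α) 1 := by
    have := ih (skip 1 z) (skip 1 α) lam (hz.skip le_rfl (by omega)) (fun i h1 h2 => by
      simpa [skip, show i ≠ 0 by omega] using hzC (i + 1) (by omega) (by omega))
      (skip_tail (m := N + 1) (j := 1) h0 (by omega))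
      (skip_mem_expDomain (m := N + 1) (j := 1) hα le_rfl (by omega))
      (by rw [← skip_shift (by omega)]
          exact skip_mem_expDomain (m := N + 1) (j := 1) hβ le_rfl (by omega))
    rwa [← skip_shift (by omega), outer_skip le_rfl (by omega), outer_skip le_rfl (by omega)] at this
  have d1 := shift_sub (lam := lam) (α := α) (m := N + 2) (i := 0) (j := 1) (by omega) (by omega)
  have d2 := shift_sub (lam := lam) (α := α) (m := N + 2) (i := 1) (j := 2) (by omega) (by omega)
  rcases N with _ | N
  · have e1 := h.hasDerivAt_betaVal_two hz hα h0 hwa hw0 hw2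
    have e2 := h.hasDerivAt_betaVal_two hz hβ (shift_tail lam 2 α) hwa hw0 hw2
    rw [zero_add] at d1 d2 hs1
    refine ((e1.mul_const _).sub (e2.mul_const _)).congr_deriv ?_
    rw [d1, d2]
    linear_combination ((z 0 - w)⁻¹ - (z 2 - w)⁻¹) * hs1
  · have hzu := hz.update (by omega) hwa
    have hs2 : betaVal γ (skip 2 (Function.update z 1 w)) (skip 2 α) (N + 2) *
        betaVal γ (endPoints y₀ y₁) (outer (N + 3) (shift lam (N + 3) α)) 1 =
        betaVal γ (skip 2 (Function.update z 1 w)) (skip 2 (shift lam (N + 3) α)) (N + 2) *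
        betaVal γ (endPoints y₀ y₁) (outer (N + 3) α) 1 := by
      have := ih (skip 2 (Function.update z 1 w)) (skip 2 α) lam
        (hzu.skip (by omega) (by omega)) (fun i h1 h2 => by
        unfold skip
        split_ifs with h3
        · obtain rfl : i = 1 := by omega
          rwa [Function.update_self]
        · rw [Function.update_of_ne (by omega)]
          exact hzC (i + 1) (by omega) (by omega))
        (skip_tail (m := N + 2) (j := 2) h0 (by omega))
        (skip_mem_expDomain (m := N + 2) (j := 2) hα (by omega) (by omega))
        (by rw [← skip_shift (by omega)]
            exact skip_mem_expDomain (m := N + 2) (j := 2) hβ (by omega) (by omega))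
      rwa [← skip_shift (by omega), outer_skip (by omega) (by omega),
        outer_skip (by omega) (by omega)] at this
    have e1 := h.hasDerivAt_betaVal_add_three hz hα h0 hwa hw0 hw2
    have e2 := h.hasDerivAt_betaVal_add_three hz hβ (shift_tail lam (N + 3) α) hwa hw0 hw2
    refine ((e1.mul_const _).sub (e2.mul_const _)).congr_deriv ?_
    rw [d1, d2]
    linear_combination ((z 0 - w)⁻¹ - (z 2 - w)⁻¹) * hs1 + (z 2 - w)⁻¹ * hs2

/-- The exponent at the singular point is A or B, or A + B if the two singular points coincide; this
is why all three have to be non-integral. -/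
theorem eventually_eq_zero_of_center {g : ℂ → ℂ} {x₀ x₁ y A B : ℂ}
    (hC : IsOpen C) (hyC : (y : OnePoint ℂ) ∈ C) (hga : AnalyticAt ℂ g y)
    (hg : ∀ w : ℂ, (w : OnePoint ℂ) ∈ C → x₀ ≠ w → x₁ ≠ w →
      HasDerivAt g ((A / (x₀ - w) + B / (x₁ - w)) * g w) w)
    (hA : ∀ n : ℤ, A ≠ n) (hB : ∀ n : ℤ, B ≠ n) (hAB : ∀ n : ℤ, A + B ≠ n)
    (hy : y = x₀ ∨ y = x₁) : ∀ᶠ w in 𝓝 y, g w = 0 := by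
  have hCn : ∀ᶠ w : ℂ in 𝓝[≠] y, (w : OnePoint ℂ) ∈ C :=
    (OnePoint.continuous_coe.continuousAt.preimage_mem_nhds (hC.mem_nhds hyC) :
      (fun w : ℂ => (w : OnePoint ℂ)) ⁻¹' C ∈ 𝓝 y) |> fun h => nhdsWithin_le_nhds h
  have hne : ∀ x, ∀ᶠ w in 𝓝[≠] y, x ≠ w := fun x => by
    rcases eq_or_ne x y with rfl | hxy
    · filter_upwards [self_mem_nhdsWithin] with w hw using Ne.symm hw
    · exact nhdsWithin_le_nhds (mem_of_superset (isOpen_ne.mem_nhds (Ne.symm hxy))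
        fun w hw => Ne.symm hw)
  by_cases h01 : x₀ = x₁
  · subst h01
    refine eventually_eq_zero_of_regular_singular (k := fun _ => 0) hga continuousAt_const hAB ?_
    filter_upwards [hCn, hne x₀] with w h1 h2
    obtain rfl : y = x₀ := by tauto
    have := sub_ne_zero.2 h2
    rw [(hg w h1 h2 h2).deriv]
    field_simp
    ring
  · rcases hy with rfl | rfl
    · refine eventually_eq_zero_of_regular_singular (k := fun w => B / (x₁ - w)) hga
        (continuousAt_const.div (continuousAt_const.sub continuousAt_id)
          (sub_ne_zero.2 (Ne.symm h01))) hA ?_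
      filter_upwards [hCn, hne y, hne x₁] with w h1 h2 h3
      have := sub_ne_zero.2 h2
      have := sub_ne_zero.2 h3
      rw [(hg w h1 h2 h3).deriv]
      field_simp
    · refine eventually_eq_zero_of_regular_singular (k := fun w => A / (x₀ - w)) hga
        (continuousAt_const.div (continuousAt_const.sub continuousAt_id)
          (sub_ne_zero.2 h01)) hB ?_
      filter_upwards [hCn, hne x₀, hne y] with w h1 h2 h3
      have := sub_ne_zero.2 h2
      have := sub_ne_zero.2 h3
      rw [(hg w h1 h2 h3).deriv]
      field_simp
      ring

theorem IsInvariant.succ_of_generic (h : IsBetaPath S γ y₀ y₁ η₀ η₁ K ℓ₀ ℓ₁) (hC : IsOpen C)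
    (hCc : IsPreconnected C) (hCa : ∀ w : ℂ, (w : OnePoint ℂ) ∈ C → w ∈ avoidSet γ)
    (hx : (y₀ : OnePoint ℂ) ∈ C ∨ (y₁ : OnePoint ℂ) ∈ C ∨ OnePoint.infty ∈ C) {N : ℕ}
    (ih : IsInvariant γ y₀ y₁ η₀ η₁ C (N + 1)) (hz : IsPointSeq γ y₀ y₁ (N + 2) z)
    (hzC : ∀ i, 1 ≤ i → i < N + 2 → (z i : OnePoint ℂ) ∈ C) (h0 : ∀ i, N + 2 < i → α i = 0)
    (hα : α ∈ expDomain η₀ η₁ (N + 2)) (hβ : shift lam (N + 2) α ∈ expDomain η₀ η₁ (N + 2))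
    (h01 : ∀ n : ℤ, α 0 - α 1 ≠ n) (h12 : ∀ n : ℤ, α 1 - α 2 ≠ n)
    (h02 : ∀ n : ℤ, α 0 - α 2 ≠ n) :
    betaVal γ z α (N + 2) * betaVal γ (endPoints y₀ y₁) (outer (N + 2) (shift lam (N + 2) α)) 1 =
      betaVal γ z (shift lam (N + 2) α) (N + 2) *
        betaVal γ (endPoints y₀ y₁) (outer (N + 2) α) 1 := by
  set g : ℂ → ℂ := fun w => betaVal γ (Function.update z 1 w) α (N + 2) *
        betaVal γ (endPoints y₀ y₁) (outer (N + 2) (shift lam (N + 2) α)) 1 -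
        betaVal γ (Function.update z 1 w) (shift lam (N + 2) α) (N + 2) *
          betaVal γ (endPoints y₀ y₁) (outer (N + 2) α) 1 with hg_def
  have hode : ∀ w : ℂ, (w : OnePoint ℂ) ∈ C → z 0 ≠ w → z 2 ≠ w → HasDerivAt g
      (((α 0 - α 1) / (z 0 - w) + (α 1 - α 2) / (z 2 - w)) * g w) w := fun w hw hw0 hw2 =>
    ih.hasDerivAt h hCa hz hzC h0 hα hβ hw hw0 hw2
  have hga : AnalyticOnNhd ℂ g (avoidSet γ) :=
    (((h.differentiableOn_betaVal hz (by omega) hα h0).mul_const _).sub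
      ((h.differentiableOn_betaVal hz (by omega) hβ
        (shift_tail lam (N + 2) α)).mul_const _)).analyticOnNhd (isOpen_avoidSet γ)
  have h02' : ∀ n : ℤ, α 0 - α 1 + (α 1 - α 2) ≠ n := fun n => by
    rw [sub_add_sub_cancel]; exact h02 n
  have hfin : ∀ y : ℂ, (y : OnePoint ℂ) ∈ C → y = z 0 ∨ y = z 2 → ∃ y' ∈ C,
      ∀ᶠ y'' in 𝓝 y', ∀ w : ℂ, (w : OnePoint ℂ) = y'' → g w = 0 := fun y hy hyz => by
    refine ⟨y, hy, ?_⟩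
    have := eventually_eq_zero_of_center hC hy (hga y (hCa y hy)) hode h01 h12 h02' hyz
    rw [OnePoint.nhds_coe_eq, eventually_map]
    filter_upwards [this] with w hw w' hw'
    rw [OnePoint.coe_eq_coe.1 hw', hw]
  -- With one inner point the singular points of the equation are y₀, y₁ and ∞, and by hypothesis
  -- one of them lies in C. With more inner points z₂ is itself a singular point in C.
  have hcenter : ∃ y' ∈ C, ∀ᶠ y'' in 𝓝 y', ∀ w : ℂ, (w : OnePoint ℂ) = y'' → g w = 0 := by
    rcases N with _ | N
    · rcases hx with hx | hx | hx
      · exact hfin y₀ hx (Or.inl hz.zero.symm)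
      · exact hfin y₁ hx (Or.inr (hz.last 2 le_rfl).symm)
      · obtain ⟨R, hR, hRC⟩ := exists_norm_gt_subset (hC.mem_nhds hx)
        set R' := max R (max ‖z 0‖ ‖z 2‖) with hR'
        have hRR' : R ≤ R' := le_max_left _ _
        have h3 : ‖z 0‖ ≤ R' := (le_max_left _ _).trans (le_max_right _ _)
        have h4 : ‖z 2‖ ≤ R' := (le_max_right _ _).trans (le_max_right _ _)
        have hzero : ∀ w : ℂ, R' < ‖w‖ → g w = 0 := fun w hw =>
          eventually_eq_zero_of_regular_singular_infty (hR.trans_le hRR') h3 h4 (fun w hw =>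
            hode w (hRC w (hRR'.trans_lt hw)) (fun e => by rw [← e] at hw; linarith)
              (fun e => by rw [← e] at hw; linarith)) h02' hw
        refine ⟨_, hx, ?_⟩
        rw [OnePoint.nhds_infty_eq, coclosedCompact_eq_cocompact, eventually_sup]
        refine ⟨eventually_map.2 ?_, fun w hw => absurd hw (OnePoint.coe_ne_infty w)⟩
        filter_upwards [norm_gt_mem_cocompact R'] with w hw w' hw'
        rw [OnePoint.coe_eq_coe.1 hw', hzero w hw]
    · exact hfin (z 2) (hzC 2 (by omega) (by omega)) (Or.inr rfl)
  obtain ⟨y, hy, hgy⟩ := hcenter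
  have := eq_zero_of_eventually_eq_zero hC hCc (hga.mono fun w hw => hCa w hw) hy hgy
    (hzC 1 le_rfl (by omega))
  simp only [hg_def, Function.update_eq_self] at this
  exact sub_eq_zero.1 this

theorem isOpen_preimage_expDomain {Θ : Type*} [TopologicalSpace Θ] {α : Θ → ℕ → ℂ}
    (hα : ∀ i, Continuous fun θ => α θ i) (η₀ η₁ : ℤ) (m : ℕ) :
    IsOpen {θ | α θ ∈ expDomain η₀ η₁ m} := by
  have hre : ∀ i, Continuous fun θ => (α θ i).re := fun i => Complex.continuous_re.comp (hα i)
  have himp : ∀ {P : Prop} {s : Set Θ}, IsOpen s → IsOpen {θ | P → θ ∈ s} := fun {P s} hs => by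
    by_cases hP : P <;> simp [hP, hs]
  have hall : ∀ {P : ℕ → Prop} {s : ℕ → Set Θ}, (∀ k, IsOpen (s k)) → (∀ k, P k → k ≤ m) →
      IsOpen {θ | ∀ k, P k → θ ∈ s k} := fun {P s} hs hP => by
    have : {θ | ∀ k, P k → θ ∈ s k} = ⋂ k ∈ {k | P k}, s k := by ext; simp
    rw [this]
    exact ((Set.finite_Iic m).subset fun k hk => hP k hk).isOpen_biInter fun k _ => hs k
  have e : {θ | α θ ∈ expDomain η₀ η₁ m} = {θ | η₀ = 1 → θ ∈ {θ | (α θ 0).re < 1}} ∩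
      ({θ | η₀ = -1 → θ ∈ {θ | ∀ k, (1 ≤ k ∧ k ≤ m) → θ ∈ {θ | 0 < (α θ 0).re - (α θ k).re}}} ∩
      ({θ | η₁ = 1 → θ ∈ {θ | 0 < (α θ m).re}} ∩
      {θ | η₁ = -1 → θ ∈ {θ | ∀ k, k < m → θ ∈ {θ | 0 < (α θ k).re - (α θ m).re}}})) := by
    ext θ
    simp [expDomain]
  rw [e]
  refine (himp (isOpen_lt (hre 0) continuous_const)).inter ((himp (hall (fun k =>
    isOpen_lt continuous_const ((hre 0).sub (hre k))) fun k hk => hk.2)).inter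
    ((himp (isOpen_lt continuous_const (hre m))).inter (himp (hall (fun k =>
    isOpen_lt continuous_const ((hre k).sub (hre m))) fun k hk => hk.le))))

theorem IsBetaPath.continuousOn_betaVal_exps {Θ : Type*} [TopologicalSpace Θ]
    [FirstCountableTopology Θ] (h : IsBetaPath S γ y₀ y₁ η₀ η₁ K ℓ₀ ℓ₁)
    (hz : IsPointSeq γ y₀ y₁ m z) {α : Θ → ℕ → ℂ} (hα : ∀ i, Continuous fun θ => α θ i)
    (h0 : ∀ θ, ∀ i, m < i → α θ i = 0) :
    ContinuousOn (fun θ => betaVal γ z (α θ) m) {θ | α θ ∈ expDomain η₀ η₁ m} :=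
  h.continuousOn_betaVal ⟨isOpen_preimage_expDomain hα η₀ η₁ m, fun _ _ => hz, fun θ _ => h0 θ,
    fun _ => continuousOn_const, fun i => (hα i).continuousOn⟩ fun _ hθ => hθ

theorem countable_affine_int {x c : ℂ} (hc : c ≠ 0) : {ε : ℂ | ∃ n : ℤ, x + ε * c = n}.Countable := by
  refine (countable_range fun n : ℤ => ((n : ℂ) - x) / c).mono ?_
  rintro ε ⟨n, hn⟩
  exact ⟨n, by simp only [← hn]; field_simp; ring⟩

/-- Genericity is reached by arbitrarily small perturbations of the exponents, since the exceptional
parameters are countable; both sides are continuous on the open domain. -/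
theorem IsInvariant.succ (h : IsBetaPath S γ y₀ y₁ η₀ η₁ K ℓ₀ ℓ₁) (hC : IsOpen C)
    (hCc : IsPreconnected C) (hCa : ∀ w : ℂ, (w : OnePoint ℂ) ∈ C → w ∈ avoidSet γ)
    (hx : (y₀ : OnePoint ℂ) ∈ C ∨ (y₁ : OnePoint ℂ) ∈ C ∨ OnePoint.infty ∈ C) {N : ℕ}
    (ih : IsInvariant γ y₀ y₁ η₀ η₁ C (N + 1)) : IsInvariant γ y₀ y₁ η₀ η₁ C (N + 2) := by
  intro z α lam hz hzC h0 hα hβ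
  -- Moving α₁ by ε and α₂ by 3ε changes α₀-α₁, α₁-α₂ and α₀-α₂ at the rates -1, -2 and -3, all
  -- nonzero.
  set v : ℕ → ℂ := fun i => if i = 1 then 1 else if i = 2 then 3 else 0 with hv
  set A : ℂ → ℕ → ℂ := fun ε i => α i + ε * v i with hA
  have hA0 : A 0 = α := by ext i; simp [hA]
  have hAt : ∀ ε, ∀ i, N + 2 < i → A ε i = 0 := fun ε i hi => by
    simp [hA, hv, h0 i hi, show i ≠ 1 by omega, show i ≠ 2 by omega]
  have hAc : ∀ i, Continuous fun ε => A ε i := fun i => by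
    simp only [hA]; fun_prop
  have hBc : ∀ i, Continuous fun ε => shift lam (N + 2) (A ε) i := fun i => by
    unfold shift
    split_ifs
    · exact (hAc i).add continuous_const
    · exact continuous_const
  have hOc : ∀ {B : ℂ → ℕ → ℂ}, (∀ i, Continuous fun ε => B ε i) →
      ∀ i, Continuous fun ε => outer (N + 2) (B ε) i := fun {B} hB i => by
    unfold outer
    split_ifs
    · exact hB 0
    · exact hB (N + 2)
    · exact continuous_const
  set U : Set ℂ := {ε | A ε ∈ expDomain η₀ η₁ (N + 2)} ∩
    {ε | shift lam (N + 2) (A ε) ∈ expDomain η₀ η₁ (N + 2)} with hU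
  have hUo : IsOpen U := (isOpen_preimage_expDomain hAc η₀ η₁ _).inter
    (isOpen_preimage_expDomain hBc η₀ η₁ _)
  have h0U : (0 : ℂ) ∈ U := ⟨by rw [mem_ofPred_eq, hA0]; exact hα, by rw [mem_ofPred_eq, hA0]; exact hβ⟩
  have hze := isPointSeq_endPoints γ y₀ y₁
  have hf : ContinuousOn (fun ε => betaVal γ z (A ε) (N + 2) *
      betaVal γ (endPoints y₀ y₁) (outer (N + 2) (shift lam (N + 2) (A ε))) 1 -
      betaVal γ z (shift lam (N + 2) (A ε)) (N + 2) *
        betaVal γ (endPoints y₀ y₁) (outer (N + 2) (A ε)) 1) U := by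
    have hU1 : U ⊆ {ε | A ε ∈ expDomain η₀ η₁ (N + 2)} := fun ε hε => hε.1
    have hU2 : U ⊆ {ε | shift lam (N + 2) (A ε) ∈ expDomain η₀ η₁ (N + 2)} := fun ε hε => hε.2
    have c1 := (h.continuousOn_betaVal_exps hz hAc hAt).mono hU1
    have c2 := (h.continuousOn_betaVal_exps hz hBc fun ε => shift_tail _ _ _).mono hU2
    have c3 := (h.continuousOn_betaVal_exps hze (hOc hAc) fun ε => outer_tail _ _).mono
      fun ε hε => outer_mem_expDomain (by omega) (hU1 hε)
    have c4 := (h.continuousOn_betaVal_exps hze (hOc hBc) fun ε => outer_tail _ _).mono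
      fun ε hε => outer_mem_expDomain (by omega) (hU2 hε)
    exact (c1.mul c4).sub (c2.mul c3)
  have hdense : Dense ({ε : ℂ | ∃ n : ℤ, α 0 - α 1 + ε * (-1) = n} ∪
      ({ε : ℂ | ∃ n : ℤ, α 1 - α 2 + ε * (-2) = n} ∪
        {ε : ℂ | ∃ n : ℤ, α 0 - α 2 + ε * (-3) = n}))ᶜ :=
    ((countable_affine_int (by norm_num)).union ((countable_affine_int (by norm_num)).union
      (countable_affine_int (by norm_num)))).dense_compl ℂ
  by_contra hne
  have hV := (hf.continuousAt (hUo.mem_nhds h0U)).eventually_ne (y := 0)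
    (by simp only [hA0]; exact sub_ne_zero.2 hne)
  obtain ⟨ε, hε, hε1, hε2⟩ := hdense.inter_nhds_nonempty (hV.and (hUo.mem_nhds h0U))
  simp only [mem_compl_iff, mem_union, mem_ofPred_eq, not_or, not_exists] at hε
  have a0 : A ε 0 = α 0 := by simp [hA, hv]
  have a1 : A ε 1 = α 1 + ε := by simp [hA, hv]
  have a2 : A ε 2 = α 2 + ε * 3 := by simp [hA, hv]
  refine hε1 (sub_eq_zero.2 (IsInvariant.succ_of_generic h hC hCc hCa hx ih hz hzC (hAt ε) hε2.1
    hε2.2 (fun n hn => hε.1 n ?_) (fun n hn => hε.2.1 n ?_) fun n hn => hε.2.2 n ?_))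
  · rw [← hn, a0, a1]; ring
  · rw [← hn, a1, a2]; ring
  · rw [← hn, a0, a2]; ring

theorem IsBetaPath.isInvariant (h : IsBetaPath S γ y₀ y₁ η₀ η₁ K ℓ₀ ℓ₁) (hC : IsOpen C)
    (hCc : IsPreconnected C) (hCa : ∀ w : ℂ, (w : OnePoint ℂ) ∈ C → w ∈ avoidSet γ)
    (hx : (y₀ : OnePoint ℂ) ∈ C ∨ (y₁ : OnePoint ℂ) ∈ C ∨ OnePoint.infty ∈ C) :
    ∀ N, IsInvariant γ y₀ y₁ η₀ η₁ C (N + 1)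
  | 0 => .one γ y₀ y₁ η₀ η₁ C
  | N + 1 => .succ h hC hCc hCa hx (h.isInvariant hC hCc hCa hx N)

end

/-! ### The hypotheses on the path -/

open Classical in
/-- The exponent of the local coordinate at an endpoint of the path. -/
noncomputable def endSign (p : OnePoint ℂ) : ℤ :=
  if p = OnePoint.infty then -1 else 1

theorem endSign_infty : endSign OnePoint.infty = -1 := by simp [endSign]

theorem endSign_of_ne {p : OnePoint ℂ} (hp : p ≠ OnePoint.infty) : endSign p = 1 := by
  simp [endSign, hp]

theorem endSign_eq_one_iff {p : OnePoint ℂ} : endSign p = 1 ↔ p ≠ OnePoint.infty := by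
  unfold endSign
  split_ifs with h <;> simp [h]

theorem endSign_eq_neg_one_iff {p : OnePoint ℂ} : endSign p = -1 ↔ p = OnePoint.infty := by
  unfold endSign
  split_ifs with h <;> simp [h]

/-- The logarithm of γ - y, with the sign changed at ∞, has real part tending to -∞ at either kind
of endpoint. -/
theorem IsRegularPath.isEndChart {S : Set ℝ} {γ : ℝ → ℂ} (h : IsRegularPath S γ) {𝓕 : Filter ℝ}
    (hF : ∀ U ∈ 𝓕, ∃ I ∈ 𝓕, I ⊆ U ∧ I.OrdConnected ∧ I ⊆ Ioo 0 1) {y : ℂ} {p : OnePoint ℂ}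
    (hp : p = y ∨ p = OnePoint.infty) (hlim : Tendsto (fun t => (γ t : OnePoint ℂ)) 𝓕 (𝓝 p))
    (hy : ∀ t ∈ Ioo (0 : ℝ) 1, γ t ≠ y) {L : ℝ → ℂ} (hLc : ContinuousOn L (Ioo 0 1))
    (hL : ∀ t ∈ Ioo (0 : ℝ) 1, Complex.exp (L t) = γ t - y) {K : ℝ}
    (hK : ∀ᶠ t in 𝓕, |(L t).im| ≤ K) :
    IsEndChart S γ 𝓕 y (endSign p) K (fun t => endSign p * L t) := by
  have hη : endSign p = 1 ∨ endSign p = -1 := by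
    rw [endSign_eq_one_iff, endSign_eq_neg_one_iff]; tauto
  obtain ⟨I, hIF, -, -, hI⟩ := hF univ univ_mem
  have hre : (fun t => Real.exp (L t).re) =ᶠ[𝓕] fun t => ‖γ t - y‖ := by
    filter_upwards [hIF] with t ht
    rw [← hL t (hI ht), Complex.norm_exp]
  refine ⟨hη, hF, hy, continuousOn_const.mul hLc, fun t ht hS => ?_, fun t ht => ?_, ?_, ?_⟩
  · have hd : HasDerivAt L ((γ t - y)⁻¹ * deriv γ t) t := by
      refine ((hasDerivAt_logInt h hy ht hS).add_const (L (1 / 2))).congr_of_eventuallyEq ?_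
      filter_upwards [Ioo_mem_nhds ht.1 ht.2] with s hs
      exact eq_logInt_add_of_exp_eq h hy hLc hL hs
    simpa only [mul_assoc] using hd.const_mul (endSign p : ℂ)
  · rw [Complex.exp_int_mul, hL t ht]
  · rcases hp with rfl | rfl
    · have h0 : Tendsto γ 𝓕 (𝓝 y) := OnePoint.isOpenEmbedding_coe.tendsto_nhds_iff.2 hlim
      have h1 : Tendsto (fun t => ‖γ t - y‖) 𝓕 (𝓝 0) := by
        simpa using (h0.sub_const y).norm
      rw [endSign_of_ne (OnePoint.coe_ne_infty y)]
      simpa using Real.tendsto_exp_comp_nhds_zero.1 (h1.congr' hre.symm)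
    · have h0 : Tendsto γ 𝓕 (cocompact ℂ) := by
        rw [← coclosedCompact_eq_cocompact, ← OnePoint.comap_coe_nhds_infty, tendsto_comap_iff]
        exact hlim
      have h1 : Tendsto (fun t => ‖γ t - y‖) 𝓕 atTop := by
        refine tendsto_atTop_mono (fun t => norm_sub_norm_le (γ t) y) ?_
        exact tendsto_atTop_add_const_right _ _ ((tendsto_norm_cocompact_atTop).comp h0)
      rw [endSign_infty]
      simpa using Real.tendsto_exp_comp_atTop.1 (h1.congr' hre.symm)
  · filter_upwards [hK] with t ht
    rcases hη with h | h <;> simpa [h] using ht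

section

variable {n : ℕ} {z : Fin (n + 2) → ℂ} {p q : OnePoint ℂ} {γ : ℝ → ℂ}
  {L : Fin (n + 2) → ℝ → ℂ}

theorem IsPathBetween.exists_isBetaPath (hγ : IsPathBetween z p q γ) (hL : IsLogBranch z γ L)
    (hwell : IsWellBehaved L) (hz : z 0 ≠ z (Fin.last (n + 1))) :
    ∃ S K, IsBetaPath S γ (z 0) (z (Fin.last (n + 1))) (endSign p) (endSign q) K
      (fun t => endSign p * L 0 t) (fun t => endSign q * L (Fin.last (n + 1)) t) := by
  obtain ⟨S, hS⟩ := hγ.exists_isRegularPath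
  obtain ⟨⟨K₀, hK₀⟩, K₁, hK₁⟩ := hwell
  refine ⟨S, max K₀ K₁, hS, ?_, ?_, hz⟩
  · refine (hS.isEndChart (fun U hU => ?_) hγ.start_mem hγ.tendsto_start
      (fun t ht => hγ.avoids t ht 0) (hL 0).1 (hL 0).2 hK₀).mono (le_max_left _ _)
    obtain ⟨u, hu, hU⟩ := mem_nhdsGT_iff_exists_Ioo_subset.1 hU
    have hu : 0 < u := hu
    exact ⟨Ioo 0 (min u 1), Ioo_mem_nhdsGT (lt_min hu one_pos),
      (Ioo_subset_Ioo_right (min_le_left _ _)).trans hU, ordConnected_Ioo,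
      Ioo_subset_Ioo_right (min_le_right _ _)⟩
  · refine (hS.isEndChart (fun U hU => ?_) hγ.end_mem hγ.tendsto_end
      (fun t ht => hγ.avoids t ht _) (hL _).1 (hL _).2 hK₁).mono (le_max_right _ _)
    obtain ⟨u, hu, hU⟩ := mem_nhdsLT_iff_exists_Ioo_subset.1 hU
    have hu : u < 1 := hu
    exact ⟨Ioo (max u 0) 1, Ioo_mem_nhdsLT (max_lt hu one_pos),
      (Ioo_subset_Ioo_left (le_max_left _ _)).trans hU, ordConnected_Ioo,
      Ioo_subset_Ioo_left (le_max_right _ _)⟩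

/-- With its endpoints the path extends continuously to [0,1] in the sphere, so the trace is
compact. -/
theorem IsPathBetween.isClosed_trace (hγ : IsPathBetween z p q γ) : IsClosed (trace p q γ) := by
  have hc : ContinuousOn (fun t => (γ t : OnePoint ℂ)) (Ioo 0 1) :=
    OnePoint.continuous_coe.comp_continuousOn hγ.continuousOn
  have h01 : (0 : ℝ) < 1 := one_pos
  set g : ℝ → OnePoint ℂ := extendFrom (Ioo 0 1) (fun t => (γ t : OnePoint ℂ)) with hg
  have he : ContinuousOn g (Icc 0 1) :=
    continuousOn_Icc_extendFrom_Ioo hc hγ.tendsto_start hγ.tendsto_end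
  have g0 : g 0 = p := eq_lim_at_left_extendFrom_Ioo h01 hγ.tendsto_start
  have g1 : g 1 = q := eq_lim_at_right_extendFrom_Ioo h01 hγ.tendsto_end
  have gi : EqOn g (fun t => (γ t : OnePoint ℂ)) (Ioo 0 1) := fun t ht =>
    extendFrom_eq (subset_closure ht) (hc t ht)
  have e : trace p q γ = g '' Icc 0 1 := by
    rw [← Ioo_union_both h01.le, image_union, image_pair, g0, g1, union_comm, trace,
      gi.image_eq]
  rw [e]
  exact (isCompact_Icc.image_of_continuousOn he).isClosed

theorem IsPathBetween.mem_avoidSet (hγ : IsPathBetween z p q γ) {w : ℂ}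
    (hw : (w : OnePoint ℂ) ∈ (trace p q γ)ᶜ) : w ∈ avoidSet γ := by
  have : ∀ᶠ v : ℂ in 𝓝 w, (v : OnePoint ℂ) ∈ (trace p q γ)ᶜ :=
    OnePoint.continuous_coe.continuousAt.preimage_mem_nhds
      (hγ.isClosed_trace.isOpen_compl.mem_nhds hw)
  obtain ⟨r, hr, hball⟩ := Metric.eventually_nhds_iff.1 this
  refine ⟨r, hr, fun t ht => not_lt.1 fun hlt => ?_⟩
  exact hball (by rwa [dist_eq_norm]) (Or.inr ⟨t, ht, rfl⟩)

theorem IsPathBetween.exists_component (hγ : IsPathBetween z p q γ)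
    (hcomp : InSpecialComponent z p q γ) :
    ∃ C : Set (OnePoint ℂ), IsOpen C ∧ IsPreconnected C ∧
      (∀ w : ℂ, (w : OnePoint ℂ) ∈ C → w ∈ avoidSet γ) ∧
      ((z 0 : OnePoint ℂ) ∈ C ∨ (z (Fin.last (n + 1)) : OnePoint ℂ) ∈ C ∨ OnePoint.infty ∈ C) ∧
      ∀ i, i ≠ 0 → i ≠ Fin.last (n + 1) → (z i : OnePoint ℂ) ∈ C := by
  obtain ⟨x, ⟨hx, hxpq⟩, hi⟩ := hcomp
  -- The point x is not an endpoint by assumption, and the interior of the path is finite and avoids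
  -- all z i.
  have hxt : x ∈ (trace p q γ)ᶜ := by
    rintro (h | ⟨t, ht, h⟩)
    · exact hxpq h
    · rcases hx with rfl | rfl | rfl
      · exact hγ.avoids t ht _ (OnePoint.coe_eq_coe.1 h)
      · exact hγ.avoids t ht _ (OnePoint.coe_eq_coe.1 h)
      · exact OnePoint.coe_ne_infty _ h
  have hxC := mem_connectedComponentIn hxt
  refine ⟨_, isOpen_connectedComponentIn_onePoint hγ.isClosed_trace.isOpen_compl x,
    isPreconnected_connectedComponentIn,
    fun w hw => hγ.mem_avoidSet (connectedComponentIn_subset _ _ hw), ?_, hi⟩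
  rcases hx with rfl | rfl | rfl
  · exact Or.inl hxC
  · exact Or.inr (Or.inl hxC)
  · exact Or.inr (Or.inr hxC)

end

/-! ### Entire functions -/

section

variable {E : Type*} [NormedAddCommGroup E] [NormedSpace ℂ E]

/-- Restrict f to the complex lines through x and use the identity theorem in one variable. -/
theorem eq_zero_of_differentiable_of_eventually {f : E → ℂ} (hf : Differentiable ℂ f) {x : E}
    (hx : ∀ᶠ y in 𝓝 x, f y = 0) : f = 0 := by
  ext y
  have hl : Differentiable ℂ fun t : ℂ => x + t • (y - x) := by fun_prop
  have hd : Differentiable ℂ fun t : ℂ => f (x + t • (y - x)) := hf.comp hl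
  have h0 : ∀ᶠ t : ℂ in 𝓝 0, f (x + t • (y - x)) = 0 :=
    (hl.continuous.tendsto' 0 x (by simp)).eventually hx
  have := AnalyticOnNhd.eq_of_eventuallyEq (f := fun t : ℂ => f (x + t • (y - x)))
    (g := fun _ => 0) (fun t _ => hd.analyticAt t) (fun t _ => analyticAt_const) h0
  simpa using congrFun this 1

theorem eq_zero_or_eq_zero_of_eventually_mul {f g : E → ℂ} (hf : Differentiable ℂ f)
    (hg : Differentiable ℂ g) {x : E} (hx : ∀ᶠ y in 𝓝 x, f y * g y = 0) : f = 0 ∨ g = 0 := by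
  have h := eq_zero_of_differentiable_of_eventually (hf.mul hg) hx
  by_contra! hne
  obtain ⟨y, hy⟩ := Function.ne_iff.1 hne.1
  refine hne.2 (eq_zero_of_differentiable_of_eventually hg (x := y) ?_)
  filter_upwards [hf.continuous.continuousAt.eventually_ne hy] with w hw
  exact (mul_eq_zero.1 (congrFun h w)).resolve_left hw

/-- Two functions on an open set that become entire after multiplication by entire functions,
the second not identically zero, and whose quotient is invariant under a translation. -/
structure IsQuotientPair (D : Set E) (b c e f N M : E → ℂ) : Prop where
  isOpen : IsOpen D
  cont_num : ContinuousOn b D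
  cont_den : ContinuousOn c D
  ne : ∃ x ∈ D, c x ≠ 0
  diff_e : Differentiable ℂ e
  diff_f : Differentiable ℂ f
  diff_N : Differentiable ℂ N
  diff_M : Differentiable ℂ M
  ne_e : e ≠ 0
  ne_f : f ≠ 0
  num : ∀ x ∈ D, b x * e x = N x
  den : ∀ x ∈ D, c x * f x = M x

namespace IsQuotientPair

variable {D : Set E} {b c e f N M P Q : E → ℂ}

theorem ne_M (h : IsQuotientPair D b c e f N M) : M ≠ 0 := by
  rintro hM
  obtain ⟨x, hx, hcx⟩ := h.ne
  refine h.ne_f (eq_zero_of_differentiable_of_eventually h.diff_f (x := x) ?_)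
  have hD := h.isOpen.mem_nhds hx
  filter_upwards [hD, (h.cont_den.continuousAt hD).eventually_ne hcx] with y hy hcy
  have := h.den y hy
  rw [hM, Pi.zero_apply, mul_eq_zero] at this
  exact this.resolve_left hcy

theorem exists_quotient (h : IsQuotientPair D b c e f N M) :
    ∃ P Q : E → ℂ, Differentiable ℂ P ∧ Differentiable ℂ Q ∧ (∃ x, Q x ≠ 0) ∧
      ∀ x ∈ D, Q x * b x = P x * c x := by
  -- Formally b/c = (N/e)/(M/f) = (N f)/(M e).
  refine ⟨N * f, M * e, h.diff_N.mul h.diff_f, h.diff_M.mul h.diff_e, ?_, fun x hx => ?_⟩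
  · by_contra! h0
    exact (eq_zero_or_eq_zero_of_eventually_mul h.diff_M h.diff_e (x := 0)
      (Eventually.of_forall h0)).elim h.ne_M h.ne_e
  · simp only [Pi.mul_apply, ← h.num x hx, ← h.den x hx]
    ring

/-- Clear denominators: Q(x-v) N f - P(x-v) M e is entire, and after multiplication by M(x-v) it
vanishes on the nonempty open set of x with x and x - v in D. So it vanishes identically. On D one
then divides by e f, which is nonzero on a dense set, and uses continuity. -/
theorem quotient_translate (h : IsQuotientPair D b c e f N M) (hP : Differentiable ℂ P)
    (hQ : Differentiable ℂ Q) (hPQ : ∀ x ∈ D, Q x * b x = P x * c x) {v : E}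
    (hv : ∃ x ∈ D, x - v ∈ D)
    (hinv : ∀ x ∈ D, x - v ∈ D → b (x - v) * c x = b x * c (x - v)) :
    ∀ x ∈ D, Q (x - v) * b x = P (x - v) * c x := by
  have hs : Differentiable ℂ fun x : E => x - v := by fun_prop
  have hP' : Differentiable ℂ fun x => P (x - v) := hP.comp hs
  have hQ' : Differentiable ℂ fun x => Q (x - v) := hQ.comp hs
  have hM' : Differentiable ℂ fun x => M (x - v) := h.diff_M.comp hs
  have hF : Differentiable ℂ
      fun x => Q (x - v) * (N x * f x) - P (x - v) * (M x * e x) :=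
    (hQ'.mul (h.diff_N.mul h.diff_f)).sub (hP'.mul (h.diff_M.mul h.diff_e))
  have hM0 : (fun x => M (x - v)) ≠ 0 := fun h0 => h.ne_M <| by
    ext x
    simpa using congrFun h0 (x + v)
  obtain ⟨y, hy, hyv⟩ := hv
  have hzero : (fun x => Q (x - v) * (N x * f x) - P (x - v) * (M x * e x)) = 0 := by
    refine (eq_zero_or_eq_zero_of_eventually_mul hF hM' (x := y) ?_).resolve_right hM0
    filter_upwards [h.isOpen.mem_nhds hy, hs.continuous.continuousAt.preimage_mem_nhds
      (h.isOpen.mem_nhds hyv)] with x hx hxv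
    have hxv : x - v ∈ D := hxv
    rw [← h.num x hx, ← h.den x hx, ← h.den _ hxv]
    linear_combination e x * f x * f (x - v) * (c x * hPQ _ hxv - Q (x - v) * hinv x hx hxv)
  have hcont : ContinuousOn (fun x => Q (x - v) * b x - P (x - v) * c x) D :=
    (hQ'.continuous.continuousOn.mul h.cont_num).sub (hP'.continuous.continuousOn.mul h.cont_den)
  intro x hx
  by_contra hne
  have hD := h.isOpen.mem_nhds hx
  refine (eq_zero_or_eq_zero_of_eventually_mul h.diff_e h.diff_f (x := x) ?_).elim h.ne_e h.ne_f
  filter_upwards [hD, (hcont.continuousAt hD).eventually_ne (sub_ne_zero.2 hne)] with w hw hw0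
  have := congrFun hzero w
  simp only [Pi.zero_apply, ← h.num w hw, ← h.den w hw] at this
  refine (mul_eq_zero.1 ?_).resolve_left hw0
  linear_combination this

end IsQuotientPair

end

/-! ### Nontriviality of the denominator -/

section

variable {n : ℕ} {z : Fin (n + 2) → ℂ} {p q : OnePoint ℂ} {γ : ℝ → ℂ}
  {L : Fin (n + 2) → ℝ → ℂ}

theorem hasBeta_one_of_primitive {S : Set ℝ} (hS : S.Countable) {L : Fin 2 → ℝ → ℂ}
    {α : Fin 2 → ℂ} {F g : ℝ → ℂ} (hF : ContinuousOn F (Ioo 0 1))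
    (hg : ∀ t ∈ Ioo (0 : ℝ) 1, betaForm γ L α 0 t = g t)
    (hd : ∀ t ∈ Ioo (0 : ℝ) 1, t ∉ S → HasDerivAt F (g t) t)
    (hgi : ∀ a ∈ Ioo (0 : ℝ) 1, ∀ b ∈ Ioo (0 : ℝ) 1, IntervalIntegrable g volume a b)
    {A B : ℂ} (hA : Tendsto F (𝓝[>] 0) (𝓝 A)) (hB : Tendsto F (𝓝[<] 1) (𝓝 B)) :
    HasBeta γ L α (B - A) := by
  refine ((hB.comp tendsto_snd).sub (hA.comp tendsto_fst)).congr' ?_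
  filter_upwards [prod_mem_prod (Ioo_mem_nhdsGT one_pos) (Ioo_mem_nhdsLT one_pos)]
    with ab ⟨ha, hb⟩
  rw [iteratedIntegral]
  refine (integral_eq_sub_of_hasDerivAt_off hS ha hb hF hd (hgi _ ha _ hb)).symm.trans ?_
  refine intervalIntegral.integral_congr fun t ht => ?_
  rw [← hg t (uIcc_subset_unit ha hb ht)]
  simp [iteratedIntegral]

theorem tendsto_inv_sub_of_tendsto_infty {𝓕 : Filter ℝ}
    (h : Tendsto (fun t => (γ t : OnePoint ℂ)) 𝓕 (𝓝 OnePoint.infty)) (y : ℂ) :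
    Tendsto (fun t => (γ t - y)⁻¹) 𝓕 (𝓝 0) := by
  have h0 : Tendsto γ 𝓕 (cocompact ℂ) := by
    rw [← coclosedCompact_eq_cocompact, ← OnePoint.comap_coe_nhds_infty, tendsto_comap_iff]
    exact h
  have h1 : Tendsto (fun t => ‖γ t - y‖) 𝓕 atTop :=
    tendsto_atTop_mono (fun t => norm_sub_norm_le (γ t) y)
      (tendsto_atTop_add_const_right _ _ (tendsto_norm_cocompact_atTop.comp h0))
  exact tendsto_inv₀_cobounded.comp (tendsto_norm_atTop_iff_cobounded.1 h1)

theorem tendsto_of_tendsto_coe {𝓕 : Filter ℝ} {y : ℂ}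
    (h : Tendsto (fun t => (γ t : OnePoint ℂ)) 𝓕 (𝓝 (y : OnePoint ℂ))) : Tendsto γ 𝓕 (𝓝 y) :=
  OnePoint.isOpenEmbedding_coe.tendsto_nhds_iff.2 h

theorem IsRegularPath.hasDerivAt_neg_inv {S : Set ℝ} (h : IsRegularPath S γ) {y : ℂ}
    (hy : ∀ t ∈ Ioo (0 : ℝ) 1, γ t ≠ y) {t : ℝ} (ht : t ∈ Ioo (0 : ℝ) 1) (htS : t ∉ S) :
    HasDerivAt (fun t => -(γ t - y)⁻¹) ((γ t - y)⁻¹ ^ 2 * deriv γ t) t := by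
  have h0 := sub_ne_zero.2 (hy t ht)
  refine (((h.hasDerivAt t ht htS).sub_const y).fun_inv h0).fun_neg.congr_deriv ?_
  field_simp

/-- For p ≠ q there are exponents for which the outer form is dγ or dγ/(γ - y)² with y an outer
point off the trace or at no singular end. Its elementary primitive has different limits at p and q.
Only p = q = ∞ needs the assumption of nontriviality. -/
theorem IsPathBetween.exists_hasOuterBeta_ne_zero (hγ : IsPathBetween z p q γ)
    (hL : IsLogBranch z γ L) (hz : z 0 ≠ z (Fin.last (n + 1)))
    (hpq : p = q → ∃ β ∈ convDomain n p q, ∃ c : ℂ, c ≠ 0 ∧ HasOuterBeta γ L β c) :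
    ∃ β ∈ convDomain n p q, ∃ c : ℂ, c ≠ 0 ∧ HasOuterBeta γ L β c := by
  by_cases hne : p = q
  · exact hpq hne
  obtain ⟨S, hS⟩ := hγ.exists_isRegularPath
  have hl : Fin.last (n + 1) ≠ 0 := (Fin.last_pos).ne'
  have hp0 : ∀ t ∈ Ioo (0 : ℝ) 1, γ t ≠ z 0 := fun t ht => hγ.avoids t ht 0
  have hp1 : ∀ t ∈ Ioo (0 : ℝ) 1, γ t ≠ z (Fin.last (n + 1)) := fun t ht => hγ.avoids t ht _
  have hi2 : ∀ y : ℂ, (∀ t ∈ Ioo (0 : ℝ) 1, γ t ≠ y) → ∀ a ∈ Ioo (0 : ℝ) 1,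
      ∀ b ∈ Ioo (0 : ℝ) 1,
      IntervalIntegrable (fun t => (γ t - y)⁻¹ ^ 2 * deriv γ t) volume a b :=
    fun y hy a ha b hb => (hS.density.continuousOn_mul
      ((hS.continuousOn_inv hy).pow 2)).integrable a ha b hb
  have he : ∀ (i : Fin (n + 2)) (t : ℝ), t ∈ Ioo (0 : ℝ) 1 →
      Complex.exp (-2 * L i t) = (γ t - z i)⁻¹ ^ 2 := fun i t ht => by
    rw [← (hL i).2 t ht, ← Complex.exp_neg, ← Complex.exp_nat_mul]
    congr 1
    push_cast
    ring
  rcases hγ.start_mem with rfl | rfl <;> rcases hγ.end_mem with rfl | rfl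
  · refine ⟨fun i => if i = 0 then 0 else 1, ⟨by simp, by simp, by simp [hl], by simp⟩,
      z (Fin.last (n + 1)) - z 0, sub_ne_zero.2 hz.symm, ?_⟩
    exact hasBeta_one_of_primitive (g := deriv γ) hS.countable hS.continuousOn
      (fun t ht => by simp [betaForm, hl]) hS.hasDerivAt
      (fun a ha b hb => hS.density.integrable a ha b hb)
      (tendsto_of_tendsto_coe hγ.tendsto_start) (tendsto_of_tendsto_coe hγ.tendsto_end)
  · refine ⟨fun i => if i = Fin.last (n + 1) then -1 else 0,
      ⟨by simp [hl.symm], by simp, by simp, fun _ i hi => by simp [hi]⟩,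
      -0 - -(z 0 - z (Fin.last (n + 1)))⁻¹, by simpa [sub_eq_zero] using hz, ?_⟩
    exact hasBeta_one_of_primitive hS.countable (hS.continuousOn_inv hp1).neg
      (fun t ht => by
        rw [← he _ t ht]
        simp [betaForm, hl.symm]
        norm_num)
      (fun t ht htS => hS.hasDerivAt_neg_inv hp1 ht htS) (hi2 _ hp1)
      (((tendsto_of_tendsto_coe hγ.tendsto_start).sub_const _).inv₀ (sub_ne_zero.2 hz)).neg
      (tendsto_inv_sub_of_tendsto_infty hγ.tendsto_end _).neg
  · refine ⟨fun i => if i = 0 then 2 else 1,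
      ⟨by simp, fun _ i hi => by norm_num [hi], by simp [hl], by simp⟩,
      -(z (Fin.last (n + 1)) - z 0)⁻¹ - -0, by simpa [sub_eq_zero] using hz.symm, ?_⟩
    exact hasBeta_one_of_primitive hS.countable (hS.continuousOn_inv hp0).neg
      (fun t ht => by
        rw [← he _ t ht]
        simp [betaForm, hl])
      (fun t ht htS => hS.hasDerivAt_neg_inv hp0 ht htS) (hi2 _ hp0)
      (tendsto_inv_sub_of_tendsto_infty hγ.tendsto_start _).neg
      (((tendsto_of_tendsto_coe hγ.tendsto_end).sub_const _).inv₀ (sub_ne_zero.2 hz.symm)).neg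
  · exact absurd rfl hne

end

/-! ### From tuples to sequences -/

/-- Extension of a tuple of exponents by zero. -/
def extendExp {n : ℕ} (α : Fin (n + 2) → ℂ) (i : ℕ) : ℂ := if h : i < n + 2 then α ⟨i, h⟩ else 0

/-- Extension of a tuple of points by the last point. -/
def extendPoints {n : ℕ} (z : Fin (n + 2) → ℂ) (i : ℕ) : ℂ :=
  if h : i < n + 2 then z ⟨i, h⟩ else z (Fin.last (n + 1))

section

variable {n : ℕ} {z α : Fin (n + 2) → ℂ} {p q : OnePoint ℂ} {γ : ℝ → ℂ}
  {L : Fin (n + 2) → ℝ → ℂ} {S : Set ℝ} {K : ℝ} {ℓ₀ ℓ₁ : ℝ → ℂ} {lam : ℂ}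

theorem extendExp_coe (α : Fin (n + 2) → ℂ) (i : Fin (n + 2)) : extendExp α i = α i := by
  simp [extendExp]

theorem extendExp_zero (α : Fin (n + 2) → ℂ) : extendExp α 0 = α 0 := extendExp_coe α 0

theorem extendExp_last (α : Fin (n + 2) → ℂ) : extendExp α (n + 1) = α (Fin.last (n + 1)) :=
  extendExp_coe α (Fin.last (n + 1))

theorem extendExp_tail (α : Fin (n + 2) → ℂ) (i : ℕ) (hi : n + 1 < i) : extendExp α i = 0 := by
  simp [extendExp, show ¬ i < n + 2 by omega]

theorem extendPoints_coe (z : Fin (n + 2) → ℂ) (i : Fin (n + 2)) : extendPoints z i = z i := by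
  simp [extendPoints]

theorem contDiff_extendExp (i : ℕ) :
    ContDiff ℂ 1 (fun α : Fin (n + 2) → ℂ => extendExp α i) := by
  unfold extendExp
  split_ifs
  · exact contDiff_apply ℂ ℂ _
  · exact contDiff_const

theorem contDiff_outer_extendExp (i : ℕ) :
    ContDiff ℂ 1 (fun α : Fin (n + 2) → ℂ => outer (n + 1) (extendExp α) i) := by
  unfold outer
  split_ifs
  · exact contDiff_extendExp 0
  · exact contDiff_extendExp (n + 1)
  · exact contDiff_const

theorem shift_extendExp (lam : ℂ) (α : Fin (n + 2) → ℂ) :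
    shift lam (n + 1) (extendExp α) = extendExp (fun i => α i + lam) := by
  ext i
  by_cases h : i < n + 2
  · simp [shift, extendExp, h, show i ≤ n + 1 by omega]
  · simp [shift, extendExp, h, show ¬ i ≤ n + 1 by omega]

theorem extendExp_mem_expDomain :
    extendExp α ∈ expDomain (endSign p) (endSign q) (n + 1) ↔ α ∈ convDomain n p q := by
  simp only [expDomain, convDomain, mem_ofPred_eq, endSign_eq_one_iff, endSign_eq_neg_one_iff,
    extendExp_zero, extendExp_last, Complex.sub_re]
  refine and_congr_right' (and_congr (imp_congr_right fun _ => ?_)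
    (and_congr_right' (imp_congr_right fun _ => ?_)))
  · refine ⟨fun h i hi => ?_, fun h k hk hkn => ?_⟩
    · have := h i (Nat.one_le_iff_ne_zero.2 fun h0 => hi (Fin.ext h0)) (by omega)
      rwa [extendExp_coe] at this
    · have := h ⟨k, by omega⟩ fun h0 => by
        have := congrArg Fin.val h0
        simp at this
        omega
      rwa [← extendExp_coe α ⟨k, by omega⟩] at this
  · refine ⟨fun h i hi => ?_, fun h k hk => ?_⟩
    · have := h i (Fin.val_lt_last hi)
      rwa [extendExp_coe] at this
    · have := h ⟨k, by omega⟩ fun h0 => by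
        have := congrArg Fin.val h0
        simp at this
        omega
      rwa [← extendExp_coe α ⟨k, by omega⟩] at this

theorem isPointSeq_extendPoints
    (hmid : ∀ i, i ≠ 0 → i ≠ Fin.last (n + 1) → z i ∈ avoidSet γ) :
    IsPointSeq γ (z 0) (z (Fin.last (n + 1))) (n + 1) (extendPoints z) where
  pos := by omega
  zero := extendPoints_coe z 0
  last i hi := by
    rcases hi.eq_or_lt with rfl | hi
    · exact extendPoints_coe z (Fin.last (n + 1))
    · simp [extendPoints, show ¬ i < n + 2 by omega]
  mid i h1 h2 := by
    have e := extendPoints_coe z ⟨i, by omega⟩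
    rw [show extendPoints z i = _ from e]
    refine hmid _ (fun h => ?_) fun h => ?_
    · have := congrArg Fin.val h
      simp at this
      omega
    · have := congrArg Fin.val h
      simp at this
      omega

/-- The factor by which the chosen branches of the powers differ from the normalized ones. -/
noncomputable def branchFactor (L : Fin (n + 2) → ℝ → ℂ) (α : Fin (n + 2) → ℂ) : ℂ :=
  Complex.exp (α (Fin.last (n + 1)) * L (Fin.last (n + 1)) (1 / 2) - α 0 * L 0 (1 / 2))

theorem unit_prod_mem :
    Ioo (0 : ℝ) 1 ×ˢ Ioo (0 : ℝ) 1 ∈ 𝓝[>] (0 : ℝ) ×ˢ 𝓝[<] (1 : ℝ) :=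
  prod_mem_prod (Ioo_mem_nhdsGT one_pos) (Ioo_mem_nhdsLT one_pos)

/-- The numerator of the normalized integral, up to the branch factor. -/
noncomputable def numVal (γ : ℝ → ℂ) (z α : Fin (n + 2) → ℂ) : ℂ :=
  betaVal γ (extendPoints z) (extendExp α) (n + 1)

/-- The denominator of the normalized integral, up to the branch factor. -/
noncomputable def denVal (γ : ℝ → ℂ) (z α : Fin (n + 2) → ℂ) : ℂ :=
  betaVal γ (endPoints (z 0) (z (Fin.last (n + 1)))) (outer (n + 1) (extendExp α)) 1

theorem IsBetaPath.hasBeta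
    (h : IsBetaPath S γ (z 0) (z (Fin.last (n + 1))) (endSign p) (endSign q) K ℓ₀ ℓ₁)
    (hmid : ∀ i, i ≠ 0 → i ≠ Fin.last (n + 1) → z i ∈ avoidSet γ) (hL : IsLogBranch z γ L)
    (hα : α ∈ convDomain n p q) :
    HasBeta γ L α (branchFactor L α * numVal γ z α) := by
  have hz := isPointSeq_extendPoints hmid
  have := (h.tendsto_betaInt hz (extendExp_mem_expDomain.2 hα) (extendExp_tail α)).const_mul
    (branchFactor L α)
  refine this.congr' ?_
  filter_upwards [unit_prod_mem] with ab ⟨ha, hb⟩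
  refine (iteratedIntegral_betaForm h.regular (h.ne_point hz) (extendExp_coe α) (fun i => ?_)
    ha hb).symm
  rw [extendPoints_coe]
  exact hL i

theorem IsBetaPath.hasOuterBeta
    (h : IsBetaPath S γ (z 0) (z (Fin.last (n + 1))) (endSign p) (endSign q) K ℓ₀ ℓ₁)
    (hL : IsLogBranch z γ L) (hα : α ∈ convDomain n p q) :
    HasOuterBeta γ L α (branchFactor L α * denVal γ z α) := by
  have hz := isPointSeq_endPoints γ (z 0) (z (Fin.last (n + 1)))
  have := (h.tendsto_betaInt hz (outer_mem_expDomain (by omega) (extendExp_mem_expDomain.2 hα))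
    (outer_tail (n + 1) (extendExp α))).const_mul (branchFactor L α)
  refine this.congr' ?_
  filter_upwards [unit_prod_mem] with ab ⟨ha, hb⟩
  refine (iteratedIntegral_betaForm (L := ![L 0, L (Fin.last (n + 1))])
    (α := ![α 0, α (Fin.last (n + 1))]) h.regular (h.ne_point hz) (fun i => ?_) (fun i => ?_)
    ha hb).symm
  · fin_cases i
    · simp [outer, extendExp_zero]
    · simp [outer, extendExp_last]
  · fin_cases i
    · exact hL 0
    · exact hL (Fin.last (n + 1))

theorem HasBeta.unique {m : ℕ} {L : Fin (m + 1) → ℝ → ℂ} {α : Fin (m + 1) → ℂ} {v w : ℂ}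
    (h : HasBeta γ L α v) (h' : HasBeta γ L α w) : v = w :=
  tendsto_nhds_unique h h'

/-- The branch factor is nonzero and common to numerator and denominator, so the quotient does not
depend on the chosen logarithms. -/
theorem IsBetaPath.isMeromorphicContinuation_iff
    (h : IsBetaPath S γ (z 0) (z (Fin.last (n + 1))) (endSign p) (endSign q) K ℓ₀ ℓ₁)
    (hmid : ∀ i, i ≠ 0 → i ≠ Fin.last (n + 1) → z i ∈ avoidSet γ) (hL : IsLogBranch z γ L)
    {P Q : (Fin (n + 2) → ℂ) → ℂ} :
    IsMeromorphicContinuation p q γ L P Q ↔ Differentiable ℂ P ∧ Differentiable ℂ Q ∧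
      (∃ β, Q β ≠ 0) ∧ ∀ β ∈ convDomain n p q, Q β * numVal γ z β = P β * denVal γ z β := by
  refine and_congr_right' (and_congr_right' (and_congr_right' (forall₂_congr fun β hβ => ?_)))
  have hb := h.hasBeta hmid hL hβ
  have hc := h.hasOuterBeta hL hβ
  have hne : branchFactor L β ≠ 0 := Complex.exp_ne_zero _
  refine ⟨?_, fun e => ⟨_, _, hb, hc, ?_⟩⟩
  · rintro ⟨b, c, hb', hc', e⟩
    rw [hb'.unique hb, hc'.unique hc] at e
    refine mul_left_cancel₀ hne ?_
    linear_combination e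
  · linear_combination branchFactor L β * e

theorem IsBetaPath.isQuotientPair
    (h : IsBetaPath S γ (z 0) (z (Fin.last (n + 1))) (endSign p) (endSign q) K ℓ₀ ℓ₁)
    (hmid : ∀ i, i ≠ 0 → i ≠ Fin.last (n + 1) → z i ∈ avoidSet γ) (hL : IsLogBranch z γ L)
    (hne : ∃ β ∈ convDomain n p q, ∃ c : ℂ, c ≠ 0 ∧ HasOuterBeta γ L β c) :
    ∃ e f N M, IsQuotientPair (convDomain n p q) (numVal γ z) (denVal γ z) e f N M := by
  have hz := isPointSeq_extendPoints hmid
  have hz' := isPointSeq_endPoints γ (z 0) (z (Fin.last (n + 1)))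
  have hD : {α : Fin (n + 2) → ℂ | extendExp α ∈ expDomain (endSign p) (endSign q) (n + 1)} =
      convDomain n p q := by
    ext α
    exact extendExp_mem_expDomain
  have hD' : convDomain n p q ⊆ {α : Fin (n + 2) → ℂ |
      outer (n + 1) (extendExp α) ∈ expDomain (endSign p) (endSign q) 1} := fun α hα =>
    outer_mem_expDomain (by omega) (extendExp_mem_expDomain.2 hα)
  obtain ⟨e, he, hne_e, N, hN, hNe⟩ := h.exists_entireOn hz (contDiff_extendExp (n := n))
    extendExp_tail (θ₁ := fun i => (((i : ℕ) + 1 : ℤ) : ℂ) / ((n + 1 + 2 : ℕ) : ℂ))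
    fun i hi => by simp [extendExp, show i < n + 2 by omega]
  -- For the denominator m = 1, and (i+1)/(m+2) becomes 1/3 and 2/3 for the two outer exponents.
  obtain ⟨f, hf, hne_f, M, hM, hMf⟩ := h.exists_entireOn hz' (contDiff_outer_extendExp (n := n))
    (fun α => outer_tail (n + 1) (extendExp α)) (θ₁ := fun i => if i = 0 then 1 / 3 else 2 / 3)
    fun i hi => by
      interval_cases i
      · simp [outer, extendExp_zero]
      · norm_num [outer, extendExp_last]
  rw [hD] at hNe
  refine ⟨e, f, N, M, ⟨?_, ?_, ?_, ?_, he, hf, hN, hM, fun h0 => hne_e (by rw [h0]; rfl),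
    fun h0 => hne_f (by rw [h0]; rfl), fun x hx => hNe hx, fun x hx => hMf (hD' hx)⟩⟩
  · rw [← hD]
    exact isOpen_preimage_expDomain (fun i => (contDiff_extendExp i).continuous) _ _ _
  · rw [← hD]
    exact h.continuousOn_betaVal_exps hz (fun i => (contDiff_extendExp i).continuous)
      extendExp_tail
  · exact (h.continuousOn_betaVal_exps hz' (fun i => (contDiff_outer_extendExp i).continuous)
      fun α => outer_tail (n + 1) (extendExp α)).mono hD'
  · obtain ⟨β, hβ, c, hc, hcβ⟩ := hne
    refine ⟨β, hβ, fun h0 => hc ?_⟩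
    rw [hcβ.unique (h.hasOuterBeta hL hβ), h0, mul_zero]

theorem exists_mem_convDomain_sub (n : ℕ) (p q : OnePoint ℂ) (lam : ℂ) :
    ∃ α ∈ convDomain n p q, (α - fun _ => lam) ∈ convDomain n p q := by
  classical
  have hl : Fin.last (n + 1) ≠ 0 := (Fin.last_pos).ne'
  -- The inner exponents are 0 and R exceeds |Re λ|, so a translation by λ cannot violate the
  -- conditions at finite endpoints. The conditions at ∞ involve only differences; there the value
  -- ±2R outweighs the other outer exponent.
  set R : ℝ := |lam.re| + 1 with hR
  have h1 : 0 < R := by positivity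
  have h2 := abs_le.1 (show |lam.re| ≤ R - 1 by rw [hR]; linarith)
  refine ⟨fun i => if i = 0 then (if p = OnePoint.infty then ((2 * R : ℝ) : ℂ) else (-R : ℝ))
    else if i = Fin.last (n + 1) then
      (if q = OnePoint.infty then ((-(2 * R) : ℝ) : ℂ) else (R : ℝ)) else 0, ?_, ?_⟩
  all_goals
    simp only [convDomain, mem_ofPred_eq, Pi.sub_apply, if_true, hl, if_false]
    refine ⟨fun hp => ?_, fun hp i hi => ?_, fun hq => ?_, fun hq i hi => ?_⟩ <;>
    (repeat' split_ifs) <;> simp_all only [Complex.sub_re, Complex.ofReal_re, Complex.zero_re,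
      not_true_eq_false, ne_eq] <;> linarith

theorem IsBetaPath.numVal_mul_denVal
    (h : IsBetaPath S γ (z 0) (z (Fin.last (n + 1))) (endSign p) (endSign q) K ℓ₀ ℓ₁)
    {C : Set (OnePoint ℂ)} (hC : IsOpen C)
    (hCc : IsPreconnected C) (hCa : ∀ w : ℂ, (w : OnePoint ℂ) ∈ C → w ∈ avoidSet γ)
    (hx : (z 0 : OnePoint ℂ) ∈ C ∨ (z (Fin.last (n + 1)) : OnePoint ℂ) ∈ C ∨ OnePoint.infty ∈ C)
    (hmid : ∀ i, i ≠ 0 → i ≠ Fin.last (n + 1) → (z i : OnePoint ℂ) ∈ C)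
    (hα : α ∈ convDomain n p q) (hβ : (fun i => α i + lam) ∈ convDomain n p q) :
    numVal γ z α * denVal γ z (fun i => α i + lam) =
      numVal γ z (fun i => α i + lam) * denVal γ z α := by
  have hz := isPointSeq_extendPoints fun i h0 h1 => hCa _ (hmid i h0 h1)
  have := h.isInvariant hC hCc hCa hx n (extendPoints z) (extendExp α) lam hz
    (fun i h1 h2 => ?_) (extendExp_tail α) (extendExp_mem_expDomain.2 hα)
    (by rw [shift_extendExp]; exact extendExp_mem_expDomain.2 hβ)
  · rwa [shift_extendExp] at this
  · have e := extendPoints_coe z ⟨i, by omega⟩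
    rw [show extendPoints z i = _ from e]
    refine hmid _ (fun h => ?_) fun h => ?_
    · have := congrArg Fin.val h
      simp at this
      omega
    · have := congrArg Fin.val h
      simp at this
      omega

end

end BetaIntegral

/-! ### The main theorem -/

theorem mainTheorem1 (n : ℕ) (z : Fin (n + 2) → ℂ) (p q : OnePoint ℂ) (γ : ℝ → ℂ)
    (L : Fin (n + 2) → ℝ → ℂ)
    (hγ : BetaIntegral.IsPathBetween z p q γ)
    (hL : BetaIntegral.IsLogBranch z γ L)
    (hwell : BetaIntegral.IsWellBehaved L)
    (hz : z 0 ≠ z (Fin.last (n + 1)))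
    (hnontrivial : p = q →
      ∃ β ∈ BetaIntegral.convDomain n p q, ∃ c : ℂ, c ≠ 0 ∧ BetaIntegral.HasOuterBeta γ L β c)
    (hcomp : BetaIntegral.InSpecialComponent z p q γ) :
    -- invariance of the quotient of the convergent integrals, with denominators cleared
    (∀ (α : Fin (n + 2) → ℂ) (lam : ℂ),
      α ∈ BetaIntegral.convDomain n p q → (fun i => α i + lam) ∈ BetaIntegral.convDomain n p q →
      ∃ b c b' c' : ℂ,
        BetaIntegral.HasBeta γ L α b ∧ BetaIntegral.HasOuterBeta γ L α c ∧
        BetaIntegral.HasBeta γ L (fun i => α i + lam) b' ∧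
        BetaIntegral.HasOuterBeta γ L (fun i => α i + lam) c' ∧
        b * c' = b' * c) ∧
    -- the normalized integral is meromorphic in all exponents
    (∃ P Q : (Fin (n + 2) → ℂ) → ℂ, BetaIntegral.IsMeromorphicContinuation p q γ L P Q) ∧
    -- the continued normalized integral is invariant
    ∀ (α : Fin (n + 2) → ℂ) (lam w : ℂ),
      BetaIntegral.HasNormalizedBeta p q γ L α w ↔
        BetaIntegral.HasNormalizedBeta p q γ L (fun i => α i + lam) w := by
  obtain ⟨S, K, h⟩ := hγ.exists_isBetaPath hL hwell hz
  obtain ⟨C, hC, hCc, hCa, hx, hmid⟩ := hγ.exists_component hcomp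
  have hav : ∀ i, i ≠ 0 → i ≠ Fin.last (n + 1) → z i ∈ BetaIntegral.avoidSet γ :=
    fun i h0 h1 => hCa _ (hmid i h0 h1)
  have hinv : ∀ (α : Fin (n + 2) → ℂ) (lam : ℂ), α ∈ BetaIntegral.convDomain n p q →
      (fun i => α i + lam) ∈ BetaIntegral.convDomain n p q →
      BetaIntegral.numVal γ z α * BetaIntegral.denVal γ z (fun i => α i + lam) =
        BetaIntegral.numVal γ z (fun i => α i + lam) * BetaIntegral.denVal γ z α :=
    fun α lam hα hβ => h.numVal_mul_denVal hC hCc hCa hx hmid hα hβ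
  obtain ⟨e, f, N, M, hq⟩ := h.isQuotientPair hav hL
    (hγ.exists_hasOuterBeta_ne_zero hL hz hnontrivial)
  have htrans : ∀ (α : Fin (n + 2) → ℂ) (lam w : ℂ),
      BetaIntegral.HasNormalizedBeta p q γ L α w →
        BetaIntegral.HasNormalizedBeta p q γ L (fun i => α i + lam) w := by
    rintro α lam w ⟨P, Q, hPQ, hQα, rfl⟩
    obtain ⟨hP, hQ, -, hPQ⟩ := (h.isMeromorphicContinuation_iff hav hL).1 hPQ
    have e : ((fun i => α i + lam) - fun _ => lam) = α := by ext; simp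
    have hs : Differentiable ℂ fun x : Fin (n + 2) → ℂ => x - fun _ => lam := by fun_prop
    -- The translated pair represents the same meromorphic function, so regularity and value at α
    -- carry over to α + λ.
    refine ⟨fun x => P (x - fun _ => lam), fun x => Q (x - fun _ => lam),
      (h.isMeromorphicContinuation_iff hav hL).2
        ⟨hP.comp hs, hQ.comp hs, ⟨fun i => α i + lam, ?_⟩, ?_⟩, ?_, ?_⟩
    · simpa only [e] using hQα
    · refine hq.quotient_translate hP hQ hPQ (BetaIntegral.exists_mem_convDomain_sub n p q lam)
        fun x hx hxv => ?_
      have ex : (fun i => (x - fun _ => lam : Fin (n + 2) → ℂ) i + lam) = x := by ext; simp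
      have := hinv (x - fun _ => lam) lam hxv (by rwa [ex])
      rwa [ex] at this
    · simpa only [e] using hQα
    · simp only [e]
  refine ⟨fun α lam hα hβ => ⟨_, _, _, _, h.hasBeta hav hL hα, h.hasOuterBeta hL hα,
    h.hasBeta hav hL hβ, h.hasOuterBeta hL hβ, ?_⟩, ?_,
    fun α lam w => ⟨htrans α lam w, fun hw => ?_⟩⟩
  -- Each side contains one factor with exponents α and one with α + λ, so the branch factors agree.
  · linear_combination BetaIntegral.branchFactor L α *
      BetaIntegral.branchFactor L (fun i => α i + lam) * hinv α lam hα hβ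
  · obtain ⟨P, Q, hP, hQ, hne, hPQ⟩ := hq.exists_quotient
    exact ⟨P, Q, (h.isMeromorphicContinuation_iff hav hL).2 ⟨hP, hQ, hne, hPQ⟩⟩
  · simpa using htrans _ (-lam) w hw
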